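/- Let $r>0$. Given $\theta\in\mathbb R^n$, observe $X\sim N_n(\theta,I)$ and predict an independent $Y\sim N_n(\theta,rI)$ by a density estimate $\hat p(\cdot\mid X)$, with risk $\rho(\theta,\hat p)=\mathbb E_\theta\int p(y\mid\theta)\log\frac{p(y\mid\theta)}{\hat p(y\mid X)}\,dy$. Let $B(\pi)=\inf_{\hat p}\int\rho(\theta,\hat p)\,\pi(d\theta)$ be the Bayes risk of a prior $\pi$, and $R^*(\Theta)=\inf_{\hat p}\sup_{\theta\in\Theta}\rho(\theta,\hat p)$ the minimax risk. For $s\ge 0$ let $\Theta_0[s]=\{\theta\in\mathbb R^n:\#\{i:\theta_i\neq0\}\le s\}$. Put $v=(1+r^{-1})^{-1}$, $r_0=1/2$, $K=1+\lceil\log(1+r^{-1})/(2\log(1+4r))\rceil\cdot 1\{r<r_0\}$ and, for $0<\eta<1$, $\lambda_e=\sqrt{2\log\eta^{-1}}$, $\lambda_f=\sqrt{2\log\eta^{-v}}$. For $1\le k\le K$ let $\mu_{1k}=\min\{\lambda_f(1+4r)^{k-1},\lambda_e\}$, $\mu_{jk}=(j-1)\mu_{1K}+\mu_{1k}$ for $j\ge1$,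 and $\mu_{jk}=-\mu_{-j,k}$ for $j\le-1$. Let $C_j=K^{-1}\sum_{k=1}^K\delta_{\mu_{jk}}$. The univariate cluster prior is $\pi_{\sf C}[\eta,r]=(1-\eta)\delta_0+\frac{1-\eta}2\sum_{j\ge1}\eta^j(C_j+C_{-j})$, with Bayes predictive density estimate $\hat p_{\sf C}[\eta,r]$, and $\pi^{\sf C}_n$ is the law on $\mathbb R^n$ of $n$ independent coordinates with law $\pi_{\sf C}[\eta_n,r]$, where $\eta_n=s_n/n$. Set $a_k=r\{1+r^{-1}-(1+4r)^{2(k-1)}\}_+$. (a) For $1\le k\le K$, as $\eta\to0$, $\rho(\mu_{1k},\hat p_{\sf C}[\eta,r])$ is finite for all small $\eta$ and $$\rho(\mu_{1k},\hat p_{\sf C}[\eta,r])=\frac{\lambda_f^2}{2r}\,a_k+O(\lambda_f).$$ Moreover $\mu_{11}=\lambda_f$, $a_1=1$ and $\rho(\mu_{11},\hat p_{\sf C}[\eta,r])\sim\lambda_f^2/(2r)$; the $a_k$ strictly decrease in $k\le K$ and are positive for $k<K$; for all small $\eta$ the risks $\rho(\mu_{1k},\hat p_{\sf C}[\eta,r])$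 strictly decrease in $k\le K$; and if $K\ge2$ then $a_K=0$ and $\rho(\mu_{1K},\hat p_{\sf C}[\eta,r])=o(\lambda_f^2)$. (b) Let $s_n$ be integers with $s_n\ge1$ for all large $n$ and $\eta_n=s_n/n\to0$, and put $\lambda_{f,n}=\lambda_f(\eta_n)$. Then, as $n\to\infty$, $$B(\pi^{\sf C}_n)\sim n\eta_n\frac{\lambda_{f,n}^2}{2r}\cdot\frac1K\sum_{k=1}^K a_k,\qquad \frac{B(\pi^{\sf C}_n)}{R^*(\Theta_0[s_n])}\to\frac1K\sum_{k=1}^K a_k .$$ (c) If moreover $r>r_0$ and $s_n\to\infty$, then $K=1$ and the limit in (b) is $1$: $B(\pi^{\sf C}_n)/R^*(\Theta_0[s_n])\to1$. Since also $\pi^{\sf C}_n(\Theta_0[(1+\varepsilon)s_n])\to1$ for every $\varepsilon>0$, the cluster prior is asymptotically least favorable. (d) If instead $r<r_0$, then (still under the assumptions of (b)) $K\ge2$ and the limit in (b) is strictly smaller than $1$; in particular $B(\pi^{\sf C}_n)<R^*(\Theta_0[s_n])$ for all large $n$. -/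

import Mathlib

open MeasureTheory ProbabilityTheory Filter Topology Asymptotics
open scoped ENNReal

noncomputable section

namespace SparsePrediction

/-! ### The Gaussian predictive model

Given `θ ∈ ℝⁿ`, the past `X ∼ N(θ, I)` is observed and the future `Y ∼ N(θ, r I)`, independent of
`X`, is to be predicted.  The number `r > 0` is the ratio of the future to the past variance. -/

/-- The law `N(θ, w I)` on `ℝⁿ`. -/
def normalLaw {n : ℕ} (θ : Fin n → ℝ) (w : ℝ) : Measure (Fin n → ℝ) :=
  Measure.pi fun i => gaussianReal (θ i) w.toNNReal

/-- The Lebesgue density of `N(θ, w I)` on `ℝⁿ`, for `w > 0`. -/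
def normalDensity {n : ℕ} (θ : Fin n → ℝ) (w : ℝ) (z : Fin n → ℝ) : ℝ≥0∞ :=
  ∏ i, gaussianPDF (θ i) w.toNNReal (z i)

/-- `p x y` (read `p̂(y | x)`) is a predictive density estimate: jointly measurable, and a
probability density in `y` for every observation `x`. -/
def IsPredictiveDensity {n : ℕ} (p : (Fin n → ℝ) → (Fin n → ℝ) → ℝ≥0∞) : Prop :=
  Measurable (Function.uncurry p) ∧ ∀ x, ∫⁻ y, p x y = 1

/-- The predictive Kullback-Leibler risk
`ρ(θ, p̂) = E_θ ∫ p(y | θ) log (p(y | θ) / p̂(y | X)) dy`. -/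
def predRisk {n : ℕ} (r : ℝ) (θ : Fin n → ℝ) (p : (Fin n → ℝ) → (Fin n → ℝ) → ℝ≥0∞) : ℝ≥0∞ :=
  ∫⁻ x, InformationTheory.klDiv (normalLaw θ r) (volume.withDensity (p x)) ∂(normalLaw θ 1)

/-- The Bayes predictive density estimate of the prior `π`:
`p̂_π(y | x) = ∫ p(x | θ) p(y | θ) π(dθ) / ∫ p(x | θ) π(dθ)`. -/
def bayesDensity {n : ℕ} (r : ℝ) (π : Measure (Fin n → ℝ)) (x y : Fin n → ℝ) : ℝ≥0∞ :=
  (∫⁻ θ, normalDensity θ 1 x * normalDensity θ r y ∂π) / ∫⁻ θ, normalDensity θ 1 x ∂π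

/-- The Bayes risk `B(π)`: the infimum of the integrated risk over all predictive density
estimates. -/
def predBayesRisk {n : ℕ} (r : ℝ) (π : Measure (Fin n → ℝ)) : ℝ≥0∞ :=
  ⨅ (p : (Fin n → ℝ) → (Fin n → ℝ) → ℝ≥0∞) (_ : IsPredictiveDensity p),
    ∫⁻ θ, predRisk r θ p ∂π

/-- The minimax risk `R*(Θ)`. -/
def predMinimaxRisk {n : ℕ} (r : ℝ) (Θ : Set (Fin n → ℝ)) : ℝ≥0∞ :=
  ⨅ (p : (Fin n → ℝ) → (Fin n → ℝ) → ℝ≥0∞) (_ : IsPredictiveDensity p),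
    ⨆ θ ∈ Θ, predRisk r θ p

/-- The sparse parameter set `Θ₀[s]`: at most `s` coordinates are nonzero. -/
def sparseSet (n : ℕ) (s : ℝ) : Set (Fin n → ℝ) :=
  {θ | (({i | θ i ≠ 0} : Set (Fin n)).ncard : ℝ) ≤ s}

/-- The priors `π n` on `ℝⁿ` are asymptotically least favorable for the sets `Θ₀[s n]`: they
concentrate on them, and their Bayes risk is asymptotic to the minimax risk. -/
def AsymptoticallyLeastFavorable (r : ℝ) (s : ℕ → ℕ) (π : ∀ n : ℕ, Measure (Fin n → ℝ)) : Prop :=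
  (∀ᶠ n in atTop, IsProbabilityMeasure (π n)) ∧
  (∀ ε : ℝ, 0 < ε → Tendsto (fun n => π n (sparseSet n ((1 + ε) * s n))) atTop (𝓝 1)) ∧
  Tendsto (fun n => predBayesRisk r (π n) / predMinimaxRisk r (sparseSet n (s n))) atTop (𝓝 1)

/-! ### The clustered discrete prior -/

/-- `v = (1 + r⁻¹)⁻¹`. -/
def oracleVar (r : ℝ) : ℝ := (1 + r⁻¹)⁻¹

/-- `λ_e = √(2 log η⁻¹)`. -/
def lamE (η : ℝ) : ℝ := √(2 * Real.log η⁻¹)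

/-- `λ_f = √(2 log η^(-v))`. -/
def lamF (r η : ℝ) : ℝ := √(2 * Real.log (η ^ (-oracleVar r)))

/-- The common cluster size `K(r)`; the critical value of `r` is `r₀ = 1/2`. -/
def clusterSize (r : ℝ) : ℕ :=
  1 + if r < 1 / 2 then ⌈Real.log (1 + r⁻¹) / (2 * Real.log (1 + 4 * r))⌉₊ else 0

/-- The atoms `μ_{1k} = λ_f (1 + 4r)^(k-1) ∧ λ_e`, `1 ≤ k ≤ K`, of the first cluster. -/
def firstAtom (r η : ℝ) (k : ℕ) : ℝ := min (lamF r η * (1 + 4 * r) ^ (k - 1)) (lamE η)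

/-- The atoms of the `j`-th cluster: `μ_{jk} = (j - 1) μ_{1K} + μ_{1k}` for `j ≥ 1`, and
`μ_{jk} = -μ_{-j,k}` for `j ≤ -1`. -/
def atom (r η : ℝ) (j : ℤ) (k : ℕ) : ℝ :=
  (j.sign : ℝ) * (((|j| : ℤ) - 1 : ℝ) * firstAtom r η (clusterSize r) + firstAtom r η k)

/-- `C_j`, the uniform distribution on the `K` atoms of the `j`-th cluster. -/
def cluster (r η : ℝ) (j : ℤ) : Measure ℝ :=
  (clusterSize r : ℝ≥0∞)⁻¹ • ∑ k ∈ Finset.Icc 1 (clusterSize r), Measure.dirac (atom r η j k)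

/-- The univariate prior
`π_C[η, r] = (1 - η) δ₀ + (1 - η)/2 ∑_{j ≥ 1} η^j (C_j + C_{-j})`. -/
def clusterPriorOne (r η : ℝ) : Measure ℝ :=
  ENNReal.ofReal (1 - η) • Measure.dirac 0 +
    ENNReal.ofReal ((1 - η) / 2) • Measure.sum fun i : ℕ =>
      ENNReal.ofReal (η ^ (i + 1)) • (cluster r η (i + 1) + cluster r η (-(i + 1)))

/-- The multivariate prior on `ℝⁿ`: the coordinates are independent with law `π_C[η, r]`. -/
def clusterPrior (n : ℕ) (r η : ℝ) : Measure (Fin n → ℝ) :=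
  Measure.pi fun _ => clusterPriorOne r η

/-- `ρ(μ_{1k}, p̂_C[η, r])`: the univariate (`n = 1`) predictive risk, at the `k`-th atom of the
first cluster, of the Bayes predictive density estimate of the univariate cluster prior. -/
def firstClusterRisk (r η : ℝ) (k : ℕ) : ℝ≥0∞ :=
  predRisk r (fun _ : Fin 1 => atom r η 1 k) (bayesDensity r (clusterPrior 1 r η))

/-- `{1 + r⁻¹ - (1 + 4r)^(2(k-1))}₊`. -/
def decayFactor (r : ℝ) (k : ℕ) : ℝ := max (1 + r⁻¹ - (1 + 4 * r) ^ (2 * (k - 1))) 0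

/-- The first order constant `K⁻¹ ∑_{k=1}^K r {1 + r⁻¹ - (1 + 4r)^(2(k-1))}₊`. -/
def bayesConst (r : ℝ) : ℝ :=
  (clusterSize r : ℝ)⁻¹ * ∑ k ∈ Finset.Icc 1 (clusterSize r), r * decayFactor r k

end SparsePrediction

end

open SparsePrediction

/-!
Write `l = log (1/η)` and `v = oracleVar r`. The future `Y` matters only through the sufficient
statistic `(r X + Y) / (1 + r) ∼ N(θ, v I)` of the pair `(X, Y)`: if `m_w` is the marginal density
of a normal observation of variance `w` under a prior, the Bayes predictive density is
`N(y; x, 1 + r) m_v((r x + y) / (1 + r)) / m₁(x)`, and its risk at `θ` is the difference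
`D_v(θ) - D₁(θ)` of the divergences `D_w(θ) = E log (p(U | θ) / m_w(U))`, `U ∼ N(θ, w)`
(`PredictivePair.predRisk_eq`). This also holds for improper priors, and for product priors it is
additive over the coordinates (`predBayesRisk_pi`).

If a univariate prior has mass close to `1` at the origin and mass of order `η` elsewhere, then
`D_w(θ) ≥ min (θ² / (2w), l) - O(√l)` (`le_klTo`), and an atom of mass `c` at `t` gives
`D_w(θ) ≤ (θ - t)² / (2w) - log c` (`klTo_le_of_atom`). At the atoms `μ = μ_{1k} ∈ [λ_f, λ_e]` of
the first cluster these bounds meet, `D_v(μ) = l + O(√l)` and `D₁(μ) = μ² / 2 + O(√l)`, so the risk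
is `(λ_e² - μ²) / 2 + O(√l)`, which is `λ_f² a_k / (2r) + O(λ_f)`.

The minimax risk over `Θ₀[s]` with `s = n η` is `s (1 - v) l + O(s √l)` (`predMinimaxRisk_bounds`).
The upper bound comes from the improper prior `δ₀ + exp (-l) dθ` in each coordinate, whose risk is
at most `(1 - v) l + O(√l)` at nonzero `θ` and `O(η √l)` at zero. For the lower bound
(`le_predMinimaxRisk_of_blocks`) the coordinates are split into `s` blocks of length
`m ∈ [1 / (2η), 1 / η]`, and each block receives one spike of size `√(2 v log m)`, the level below
which it cannot be located even from `X` and `Y` together. The Gibbs inequality bounds the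
integrated risk of every predictive density from below by comparing the log-likelihood ratio with
an explicit penalty.

The Bayes risk of the cluster prior is `n` times the integral of the univariate risk
(`predBayesRisk_clusterPrior`). The origin contributes `o(η l)`, the clusters `±j` with `j ≥ 2` have
mass `O(η²)` in total against a risk `O(j² l)`, and the clusters `±1` contribute
`η (1 - v) l K⁻¹ ∑ a_k`, up to lower order terms. Division by the minimax risk gives the limit
`K⁻¹ ∑ a_k`. As `a₁ = 1`, `a_k` decreases, and `a_K = 0` when `K ≥ 2`, this is `1` for `K = 1` and
less than `1` otherwise. Chernoff's bound for the number of nonzero coordinates gives the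
concentration of the prior.
-/

namespace SparsePrediction

/-! ### Divergence and Bayes risk of general predictive densities -/

lemma lintegral_fin_prod {n : ℕ} (μ : Fin n → Measure ℝ) [∀ i, SigmaFinite (μ i)]
    (f : Fin n → ℝ → ℝ≥0∞) (hf : ∀ i, Measurable (f i)) :
    ∫⁻ x, ∏ i, f i (x i) ∂Measure.pi μ = ∏ i, ∫⁻ x, f i x ∂μ i := by
  induction n with
  | zero => simp
  | succ n ih =>
    have e := (measurePreserving_piFinSuccAbove μ 0).symm
    rw [← e.lintegral_comp_emb (MeasurableEquiv.measurableEmbedding _)]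
    simp_rw [MeasurableEquiv.piFinSuccAbove_symm_apply, Fin.insertNthEquiv,
      Fin.prod_univ_succ, Fin.insertNth_zero]
    simp only [Fin.zero_succAbove, Equiv.coe_fn_mk, Fin.cons_zero, Fin.cons_succ]
    rw [← ih (fun i => μ (Fin.succ i)) (fun i => f (Fin.succ i)) (fun i => hf (Fin.succ i))]
    rw [← lintegral_prod_mul (hf 0).aemeasurable]
    · rfl
    · exact (Finset.measurable_prod Finset.univ fun (i : Fin n) _ =>
        (hf (Fin.succ i)).comp (measurable_pi_apply i)).aemeasurable

lemma normalLaw_eq_withDensity {n : ℕ} (θ : Fin n → ℝ) {w : ℝ} (hw : 0 < w) :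
    normalLaw θ w = volume.withDensity (normalDensity θ w) := by
  have hw' : w.toNNReal ≠ 0 := by simpa using hw
  refine (Measure.pi_eq fun s hs => ?_)
  have hS : MeasurableSet (Set.univ.pi s) := MeasurableSet.univ_pi hs
  rw [withDensity_apply _ hS, ← lintegral_indicator hS]
  have : (Set.univ.pi s).indicator (normalDensity θ w) =
      fun x => ∏ i, (s i).indicator (gaussianPDF (θ i) w.toNNReal) (x i) := by
    funext x
    by_cases hx : x ∈ Set.univ.pi s
    · rw [Set.indicator_of_mem hx]
      exact Finset.prod_congr rfl fun i _ => (Set.indicator_of_mem (hx i trivial) _).symm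
    · rw [Set.indicator_of_notMem hx]
      simp only [Set.mem_pi, Set.mem_univ, true_implies, not_forall] at hx
      obtain ⟨i, hi⟩ := hx
      exact (Finset.prod_eq_zero (Finset.mem_univ i) (Set.indicator_of_notMem hi _)).symm
  rw [this, volume_pi, lintegral_fin_prod _ _ fun i => (measurable_gaussianPDF _ _).indicator (hs i)]
  refine Finset.prod_congr rfl fun i _ => ?_
  rw [gaussianReal_apply _ hw', lintegral_indicator (hs i)]

instance {n : ℕ} (θ : Fin n → ℝ) (w : ℝ) : IsProbabilityMeasure (normalLaw θ w) := by
  unfold normalLaw; infer_instance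

lemma measurable_uncurry_normalDensity {n : ℕ} (w : ℝ) :
    Measurable fun q : (Fin n → ℝ) × (Fin n → ℝ) => normalDensity q.1 w q.2 := by
  unfold normalDensity gaussianPDF gaussianPDFReal
  fun_prop

lemma measurable_normalDensity {n : ℕ} (θ : Fin n → ℝ) (w : ℝ) :
    Measurable (normalDensity θ w) := by
  unfold normalDensity gaussianPDF gaussianPDFReal
  fun_prop

lemma ofReal_integral_le_lintegral {α : Type*} [MeasurableSpace α] (μ : Measure α) (f : α → ℝ) :
    ENNReal.ofReal (∫ x, f x ∂μ) ≤ ∫⁻ x, ENNReal.ofReal (f x) ∂μ := by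
  by_cases hf : Integrable f μ
  · rw [integral_eq_lintegral_pos_part_sub_lintegral_neg_part hf]
    refine (ENNReal.ofReal_le_ofReal (sub_le_self _ ENNReal.toReal_nonneg)).trans ?_
    exact ENNReal.ofReal_toReal_le
  · simp [integral_undef hf]

/-- The divergence of `P` from `Q` when the log-likelihood ratio is the integrable function `L`. -/
lemma klDiv_eq_of_withDensity_exp {α : Type*} [MeasurableSpace α] {P Q : Measure α}
    [IsProbabilityMeasure P] [IsProbabilityMeasure Q] {L : α → ℝ} (hL : Measurable L)
    (hPQ : P = Q.withDensity fun x => ENNReal.ofReal (Real.exp (L x))) (hint : Integrable L P) :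
    InformationTheory.klDiv P Q = ENNReal.ofReal (∫ x, L x ∂P) ∧ 0 ≤ ∫ x, L x ∂P := by
  have hac : P ≪ Q := hPQ ▸ withDensity_absolutelyContinuous _ _
  have hm : Measurable fun x => ENNReal.ofReal (Real.exp (L x)) := by fun_prop
  have hrn : P.rnDeriv Q =ᵐ[Q] fun x => ENNReal.ofReal (Real.exp (L x)) := by
    have := Measure.rnDeriv_withDensity Q hm
    rwa [← hPQ] at this
  have hllr : llr P Q =ᵐ[P] L := by
    filter_upwards [hac.ae_le hrn] with x hx
    rw [llr, hx, ENNReal.toReal_ofReal (Real.exp_pos _).le, Real.log_exp]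
  have hint' : Integrable (llr P Q) P := (integrable_congr hllr).2 hint
  have h1 := InformationTheory.klDiv_of_ac_of_integrable hac hint'
  have h2 := InformationTheory.integral_llr_add_sub_measure_univ_nonneg hac hint'
  simp only [probReal_univ, integral_congr_ae hllr] at h1 h2
  constructor
  · rw [h1]; congr 1; ring
  · linarith

/-- One half of the Gibbs variational principle for the divergence. -/
lemma ofReal_integral_add_one_le_klDiv {α : Type*} [MeasurableSpace α] {P Q : Measure α}
    [IsProbabilityMeasure P] [IsProbabilityMeasure Q] {h : α → ℝ} (hm : Measurable h)
    (hint : Integrable h P) :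
    ENNReal.ofReal (∫ x, h x ∂P + 1) ≤
      InformationTheory.klDiv P Q + ∫⁻ x, ENNReal.ofReal (Real.exp (h x)) ∂Q := by
  by_cases htop : InformationTheory.klDiv P Q = ∞
  · simp [htop]
  obtain ⟨hac, -⟩ := InformationTheory.klDiv_ne_top_iff.1 htop
  rw [InformationTheory.klDiv_eq_lintegral_klFun_of_ac hac, ← lintegral_add_right _ (by fun_prop)]
  have hi : Integrable (fun x => (P.rnDeriv Q x).toReal • h x) Q :=
    (integrable_rnDeriv_smul_iff hac).2 hint
  have e : ∫ x, h x ∂P + 1 = ∫ x, ((P.rnDeriv Q x).toReal • h x + 1) ∂Q := by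
    rw [integral_add hi (integrable_const _), integral_rnDeriv_smul hac]; simp
  rw [e]
  refine (ofReal_integral_le_lintegral _ _).trans (lintegral_mono fun x => ?_)
  rw [← ENNReal.ofReal_add (InformationTheory.klFun_nonneg ENNReal.toReal_nonneg)
    (Real.exp_pos _).le]
  refine ENNReal.ofReal_le_ofReal ?_
  set t := (P.rnDeriv Q x).toReal
  have ht : 0 ≤ t := ENNReal.toReal_nonneg
  rw [smul_eq_mul, InformationTheory.klFun_apply]
  rcases ht.eq_or_lt with h0 | h0
  · rw [← h0]; simp [(Real.exp_pos _).le]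
  · have h1 : h x - Real.log t + 1 ≤ Real.exp (h x - Real.log t) := Real.add_one_le_exp _
    rw [Real.exp_sub, Real.exp_log h0, le_div_iff₀ h0] at h1
    nlinarith

lemma lintegral_tilt_le_one {E : Type*} [MeasurableSpace E] {μ π : Measure E} [SFinite μ]
    [SFinite π] {p : E → E → ℝ≥0∞} (hp : Measurable (Function.uncurry p)) (hp1 : ∀ x, ∫⁻ y, p x y ∂μ = 1)
    {N : E → E → ℝ≥0∞} (hN : Measurable (Function.uncurry N)) {H : E → E → E → ℝ≥0∞}
    (hH : Measurable fun q : E × E × E => H q.1 q.2.1 q.2.2) {g : E → ℝ≥0∞}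
    (hg : ∫⁻ x, g x ∂μ ≤ 1) (hle : ∀ x y, ∫⁻ θ, H θ x y * N θ x ∂π ≤ g x) :
    ∫⁻ θ, (∫⁻ x, N θ x * ∫⁻ y, p x y * H θ x y ∂μ ∂μ) ∂π ≤ 1 := by
  have hpx : ∀ x, Measurable (p x) := fun x => hp.of_uncurry_left
  have hF : Measurable fun q : (E × E) × E => p q.1.2 q.2 * H q.1.1 q.1.2 q.2 :=
    (hp.comp (by fun_prop : Measurable fun q : (E × E) × E => (q.1.2, q.2))).mul
      (hH.comp (by fun_prop : Measurable fun q : (E × E) × E => (q.1.1, q.1.2, q.2)))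
  have hNT : Measurable fun q : E × E => N q.1 q.2 * ∫⁻ y, p q.2 y * H q.1 q.2 y ∂μ :=
    hN.mul hF.lintegral_prod_right'
  rw [lintegral_lintegral_swap hNT.aemeasurable]
  refine (lintegral_mono fun x => ?_).trans hg
  have hpH : ∀ θ, Measurable fun y => p x y * H θ x y := fun θ =>
    hF.comp (by fun_prop : Measurable fun y => ((θ, x), y))
  have hG : Measurable fun q : E × E => p x q.2 * (H q.1 x q.2 * N q.1 x) :=
    ((hpx x).comp measurable_snd).mul
      ((hH.comp (by fun_prop : Measurable fun q : E × E => (q.1, x, q.2))).mul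
        (hN.comp (by fun_prop : Measurable fun q : E × E => (q.1, x))))
  have e : ∀ θ, N θ x * ∫⁻ y, p x y * H θ x y ∂μ = ∫⁻ y, p x y * (H θ x y * N θ x) ∂μ := by
    intro θ
    rw [← lintegral_const_mul _ (hpH θ)]
    exact lintegral_congr fun y => by ring
  have hy : ∀ y, ∫⁻ θ, p x y * (H θ x y * N θ x) ∂π ≤ p x y * g x := by
    intro y
    have hm : Measurable fun θ => H θ x y * N θ x :=
      (hH.comp (by fun_prop : Measurable fun θ : E => (θ, x, y))).mul
        (hN.comp (by fun_prop : Measurable fun θ : E => (θ, x)))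
    rw [lintegral_const_mul _ hm]
    exact mul_le_mul_right (hle x y) _
  rw [lintegral_congr e, lintegral_lintegral_swap hG.aemeasurable]
  refine (lintegral_mono hy).trans_eq ?_
  rw [lintegral_mul_const _ (hpx x), hp1 x, one_mul]

/-- A lower bound for the integrated risk of every predictive density: `h θ x y` plays the role of
`log (p(y | θ) / b(x, y))`, where `g(x) b(x, y)` dominates the marginal density of `(x, y)`.  With
`g` the marginal density of `x` this is the optimality of the Bayes predictive density. -/
lemma lintegral_le_lintegral_predRisk_add_one {n : ℕ} {r : ℝ}
    (π : Measure (Fin n → ℝ)) [IsProbabilityMeasure π]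
    {p : (Fin n → ℝ) → (Fin n → ℝ) → ℝ≥0∞} (hp : IsPredictiveDensity p)
    (h : (Fin n → ℝ) → (Fin n → ℝ) → (Fin n → ℝ) → ℝ)
    (hm : Measurable fun q : (Fin n → ℝ) × (Fin n → ℝ) × (Fin n → ℝ) => h q.1 q.2.1 q.2.2)
    (hint : ∀ θ x, Integrable (h θ x) (normalLaw θ r))
    (hint2 : ∀ θ, Integrable (fun x => ∫ y, h θ x y ∂normalLaw θ r) (normalLaw θ 1))
    (g : (Fin n → ℝ) → ℝ≥0∞) (hg : ∫⁻ x, g x ≤ 1)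
    (hle : ∀ x y, ∫⁻ θ, ENNReal.ofReal (Real.exp (h θ x y)) * normalDensity θ 1 x ∂π ≤ g x) :
    ∫⁻ θ, ENNReal.ofReal ((∫ x, ∫ y, h θ x y ∂normalLaw θ r ∂normalLaw θ 1) + 1) ∂π ≤
      ∫⁻ θ, predRisk r θ p ∂π + 1 := by
  have hQ : ∀ x, IsProbabilityMeasure (volume.withDensity (p x)) := fun x =>
    ⟨by rw [withDensity_apply _ MeasurableSet.univ, Measure.restrict_univ, hp.2 x]⟩
  have hpx : ∀ x, Measurable (p x) := fun x => hp.1.comp (measurable_const.prodMk measurable_id)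
  -- the exponential moment term, as an integral against Lebesgue measure
  let T : (Fin n → ℝ) → (Fin n → ℝ) → ℝ≥0∞ := fun θ x =>
    ∫⁻ y, p x y * ENNReal.ofReal (Real.exp (h θ x y))
  have hF : Measurable fun q : ((Fin n → ℝ) × (Fin n → ℝ)) × (Fin n → ℝ) =>
      p q.1.2 q.2 * ENNReal.ofReal (Real.exp (h q.1.1 q.1.2 q.2)) := by
    refine Measurable.mul (hp.1.comp (by fun_prop : Measurable fun q : ((Fin n → ℝ) × (Fin n → ℝ))
      × (Fin n → ℝ) => (q.1.2, q.2))) ?_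
    exact (hm.comp (by fun_prop : Measurable fun q : ((Fin n → ℝ) × (Fin n → ℝ))
      × (Fin n → ℝ) => (q.1.1, q.1.2, q.2))).exp.ennreal_ofReal
  have hT : Measurable (Function.uncurry T) := hF.lintegral_prod_right'
  have hND := measurable_uncurry_normalDensity (n := n) 1
  have hNT : Measurable fun q : (Fin n → ℝ) × (Fin n → ℝ) => normalDensity q.1 1 q.2 * T q.1 q.2 :=
    hND.mul hT
  have hTx : ∀ θ, Measurable (T θ) := fun θ => hT.comp (measurable_const.prodMk measurable_id)
  have key : ∀ θ, ENNReal.ofReal ((∫ x, ∫ y, h θ x y ∂normalLaw θ r ∂normalLaw θ 1) + 1) ≤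
      predRisk r θ p + ∫⁻ x, normalDensity θ 1 x * T θ x := by
    intro θ
    have e : ∫ x, ∫ y, h θ x y ∂normalLaw θ r ∂normalLaw θ 1 + 1 =
        ∫ x, (∫ y, h θ x y ∂normalLaw θ r + 1) ∂normalLaw θ 1 := by
      rw [integral_add (hint2 θ) (integrable_const _)]; simp
    have e2 : ∫⁻ x, normalDensity θ 1 x * T θ x = ∫⁻ x, T θ x ∂normalLaw θ 1 := by
      rw [normalLaw_eq_withDensity θ one_pos,
        lintegral_withDensity_eq_lintegral_mul _ (measurable_normalDensity θ 1) (hTx θ)]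
      rfl
    rw [e, e2, predRisk, ← lintegral_add_right _ (hTx θ)]
    refine (ofReal_integral_le_lintegral _ _).trans (lintegral_mono fun x => ?_)
    have hhx : Measurable (h θ x) :=
      hm.comp (measurable_const.prodMk (measurable_const.prodMk measurable_id))
    have := ofReal_integral_add_one_le_klDiv (Q := volume.withDensity (p x)) hhx (hint θ x)
    rwa [lintegral_withDensity_eq_lintegral_mul _ (hpx x) hhx.exp.ennreal_ofReal] at this
  have hH : Measurable fun q : (Fin n → ℝ) × (Fin n → ℝ) × (Fin n → ℝ) =>
      ENNReal.ofReal (Real.exp (h q.1 q.2.1 q.2.2)) := hm.exp.ennreal_ofReal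
  have key2 : ∫⁻ θ, (∫⁻ x, normalDensity θ 1 x * T θ x) ∂π ≤ 1 :=
    lintegral_tilt_le_one hp.1 hp.2 (N := fun θ x => normalDensity θ 1 x) hND
      (H := fun θ x y => ENNReal.ofReal (Real.exp (h θ x y))) hH hg hle
  calc _ ≤ ∫⁻ θ, (predRisk r θ p + ∫⁻ x, normalDensity θ 1 x * T θ x) ∂π := lintegral_mono key
    _ = ∫⁻ θ, predRisk r θ p ∂π + ∫⁻ θ, (∫⁻ x, normalDensity θ 1 x * T θ x) ∂π :=
      lintegral_add_right _ hNT.lintegral_prod_right'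
    _ ≤ _ := by gcongr

/-! ### Gaussian integrals of functions of exponential growth -/

/-- Measurable functions on the line of at most exponential growth.  They are integrable under every
Gaussian law, and form a class stable under sums and affine substitutions. -/
def HasExpGrowth (A : ℝ → ℝ) : Prop :=
  Measurable A ∧ ∃ C c : ℝ, 0 ≤ C ∧ 0 ≤ c ∧ ∀ u, |A u| ≤ C * Real.exp (c * |u|)

namespace HasExpGrowth

lemma of_le {A B : ℝ → ℝ} (hA : Measurable A) (hB : HasExpGrowth B) (h : ∀ u, |A u| ≤ B u) :
    HasExpGrowth A := by
  obtain ⟨-, C, c, hC, hc, hB⟩ := hB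
  exact ⟨hA, C, c, hC, hc, fun u => (h u).trans ((le_abs_self _).trans (hB u))⟩

lemma const (a : ℝ) : HasExpGrowth fun _ => a :=
  ⟨measurable_const, |a|, 0, abs_nonneg _, le_rfl, fun u => by simp⟩

lemma add {A B : ℝ → ℝ} (hA : HasExpGrowth A) (hB : HasExpGrowth B) :
    HasExpGrowth fun u => A u + B u := by
  obtain ⟨mA, C, c, hC, hc, hA⟩ := hA
  obtain ⟨mB, D, d, hD, hd, hB⟩ := hB
  refine ⟨mA.add mB, C + D, max c d, by positivity, by positivity, fun u => ?_⟩
  have h1 : Real.exp (c * |u|) ≤ Real.exp (max c d * |u|) := by gcongr; exact le_max_left _ _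
  have h2 : Real.exp (d * |u|) ≤ Real.exp (max c d * |u|) := by gcongr; exact le_max_right _ _
  calc |A u + B u| ≤ |A u| + |B u| := abs_add_le _ _
    _ ≤ C * Real.exp (c * |u|) + D * Real.exp (d * |u|) := add_le_add (hA u) (hB u)
    _ ≤ C * Real.exp (max c d * |u|) + D * Real.exp (max c d * |u|) := by gcongr
    _ = _ := by ring

lemma const_mul {A : ℝ → ℝ} (hA : HasExpGrowth A) (a : ℝ) : HasExpGrowth fun u => a * A u := by
  obtain ⟨mA, C, c, hC, hc, hA⟩ := hA
  refine ⟨mA.const_mul a, |a| * C, c, by positivity, hc, fun u => ?_⟩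
  rw [abs_mul, mul_assoc]
  gcongr
  exact hA u

lemma neg {A : ℝ → ℝ} (hA : HasExpGrowth A) : HasExpGrowth fun u => -A u := by
  simpa using hA.const_mul (-1)

lemma sub {A B : ℝ → ℝ} (hA : HasExpGrowth A) (hB : HasExpGrowth B) :
    HasExpGrowth fun u => A u - B u := by
  simpa [sub_eq_add_neg] using hA.add hB.neg

lemma abs {A : ℝ → ℝ} (hA : HasExpGrowth A) : HasExpGrowth fun u => |A u| := by
  obtain ⟨mA, C, c, hC, hc, hA⟩ := hA
  exact ⟨mA.abs, C, c, hC, hc, fun u => by simpa using hA u⟩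

lemma exp_mul (a : ℝ) : HasExpGrowth fun u => Real.exp (a * u) := by
  refine ⟨by fun_prop, 1, |a|, zero_le_one, abs_nonneg _, fun u => ?_⟩
  rw [one_mul, Real.abs_exp, ← abs_mul]
  exact Real.exp_le_exp.2 (le_abs_self _)

lemma id : HasExpGrowth fun u => u := by
  refine ⟨measurable_id, 1, 1, zero_le_one, zero_le_one, fun u => ?_⟩
  have := Real.add_one_le_exp |u|
  simp only [one_mul]; linarith

lemma sq : HasExpGrowth fun u => u ^ 2 := by
  refine ⟨by fun_prop, 2, 1, by norm_num, zero_le_one, fun u => ?_⟩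
  have := Real.quadratic_le_exp_of_nonneg (abs_nonneg u)
  rw [abs_of_nonneg (sq_nonneg u), one_mul]
  nlinarith [abs_nonneg u, sq_abs u]

lemma comp_affine {A : ℝ → ℝ} (hA : HasExpGrowth A) (a b : ℝ) :
    HasExpGrowth fun u => A (a * u + b) := by
  obtain ⟨mA, C, c, hC, hc, hA⟩ := hA
  refine ⟨mA.comp (by fun_prop), C * Real.exp (c * |b|), c * |a|, by positivity, by positivity,
    fun u => (hA _).trans ?_⟩
  rw [mul_assoc, ← Real.exp_add]
  gcongr
  have : |a * u + b| ≤ |a| * |u| + |b| := (abs_add_le _ _).trans (by rw [abs_mul])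
  nlinarith

lemma integrable {A : ℝ → ℝ} (hA : HasExpGrowth A) (θ : ℝ) (w : NNReal) :
    Integrable A (gaussianReal θ w) := by
  obtain ⟨mA, C, c, hC, hc, hA⟩ := hA
  have h : Integrable (fun u => C * (Real.exp (c * u) + Real.exp (-c * u))) (gaussianReal θ w) :=
    ((integrable_exp_mul_gaussianReal c).add (integrable_exp_mul_gaussianReal (-c))).const_mul C
  refine h.mono' mA.aestronglyMeasurable (ae_of_all _ fun u => (hA u).trans ?_)
  gcongr
  rcases abs_cases u with ⟨h, -⟩ | ⟨h, -⟩ <;> rw [h]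
  · linarith [Real.exp_pos (-c * u)]
  · rw [mul_neg, ← neg_mul]; linarith [Real.exp_pos (c * u)]

end HasExpGrowth

/-- The Gaussian density with real variance `w > 0`. -/
noncomputable def pdf (θ w u : ℝ) : ℝ := gaussianPDFReal θ w.toNNReal u

lemma pdf_eq {w : ℝ} (hw : 0 < w) (θ u : ℝ) :
    pdf θ w u = (√(2 * Real.pi * w))⁻¹ * Real.exp (-(u - θ) ^ 2 / (2 * w)) := by
  rw [pdf, gaussianPDFReal, Real.coe_toNNReal _ hw.le]

lemma pdf_pos {w : ℝ} (hw : 0 < w) (θ u : ℝ) : 0 < pdf θ w u :=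
  gaussianPDFReal_pos _ _ _ (by simpa using hw)

lemma measurable_pdf : Measurable fun q : ℝ × ℝ × ℝ => pdf q.1 q.2.1 q.2.2 := by
  unfold pdf gaussianPDFReal
  fun_prop

lemma measurable_pdf_right (θ w : ℝ) : Measurable (pdf θ w) := by
  unfold pdf
  fun_prop

lemma lintegral_pdf {w : ℝ} (hw : 0 < w) (θ : ℝ) : ∫⁻ u, ENNReal.ofReal (pdf θ w u) = 1 :=
  lintegral_gaussianPDFReal_eq_one θ (by simpa using hw)

lemma log_pdf {w : ℝ} (hw : 0 < w) (θ u : ℝ) :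
    Real.log (pdf θ w u) = -Real.log (√(2 * Real.pi * w)) - (u - θ) ^ 2 / (2 * w) := by
  rw [pdf_eq hw, Real.log_mul (by positivity) (Real.exp_ne_zero _), Real.log_exp, Real.log_inv]
  ring

lemma hasExpGrowth_log_pdf {w : ℝ} (hw : 0 < w) (θ : ℝ) :
    HasExpGrowth fun u => Real.log (pdf θ w u) := by
  have h := ((HasExpGrowth.sq.comp_affine 1 (-θ)).const_mul (-(2 * w)⁻¹)).add
    (HasExpGrowth.const (-Real.log (√(2 * Real.pi * w))))
  convert h using 2 with u
  rw [log_pdf hw]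
  ring

lemma oracleVar_pos {r : ℝ} (hr : 0 < r) : 0 < oracleVar r := by
  unfold oracleVar; positivity

lemma oracleVar_eq {r : ℝ} (hr : 0 < r) : oracleVar r = r / (1 + r) := by
  unfold oracleVar; field_simp; ring

/-- The sufficient statistic `w = (r x + y) / (1 + r)` for `θ` based on `(x, y)`, of law
`N(θ, v)`. -/
noncomputable def stat (r x y : ℝ) : ℝ := (r * x + y) / (1 + r)

lemma measurable_stat (r : ℝ) : Measurable fun q : ℝ × ℝ => stat r q.1 q.2 := by
  unfold stat; fun_prop

lemma pdf_mul_pdf {r : ℝ} (hr : 0 < r) (θ x y : ℝ) :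
    pdf θ 1 x * pdf θ r y = pdf x (1 + r) y * pdf θ (oracleVar r) (stat r x y) := by
  rw [pdf_eq one_pos, pdf_eq hr, pdf_eq (by linarith), pdf_eq (oracleVar_pos hr)]
  rw [mul_mul_mul_comm]
  conv_rhs => rw [mul_mul_mul_comm]
  rw [← mul_inv, ← mul_inv, ← Real.exp_add, ← Real.exp_add,
    ← Real.sqrt_mul (by positivity), ← Real.sqrt_mul (by positivity), oracleVar_eq hr, stat]
  congr 1
  · congr 2; field_simp
  · congr 1; field_simp; ring

lemma integral_stat {r : ℝ} (hr : 0 < r) (θ : ℝ) {A : ℝ → ℝ} (hA : HasExpGrowth A) :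
    Integrable (fun x => ∫ y, A (stat r x y) ∂gaussianReal θ r.toNNReal) 
      (gaussianReal θ (1 : ℝ).toNNReal) ∧ 
    ∫ x, ∫ y, A (stat r x y) ∂gaussianReal θ r.toNNReal ∂gaussianReal θ (1 : ℝ).toNNReal =
      ∫ u, A u ∂gaussianReal θ (oracleVar r).toNNReal := by
  set μ := gaussianReal θ (1 : ℝ).toNNReal
  set ν := gaussianReal θ r.toNNReal
  have hmap : (μ.prod ν).map (fun q => stat r q.1 q.2) =
      gaussianReal θ (oracleVar r).toNNReal := by
    have h1 : (μ.map fun x => r / (1 + r) * x) ∗ (ν.map fun y => 1 / (1 + r) * y) =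
        gaussianReal θ (oracleVar r).toNNReal := by
      rw [gaussianReal_map_const_mul, gaussianReal_map_const_mul, gaussianReal_conv_gaussianReal]
      congr 1
      · field_simp; ring
      · rw [oracleVar_eq hr]
        ext
        have : 0 ≤ r / (1 + r) := by positivity
        simp [Real.coe_toNNReal _ hr.le, this]
        field_simp
        ring
    rw [← h1, Measure.conv, Measure.map_prod_map _ _ (by fun_prop) (by fun_prop),
      Measure.map_map (by fun_prop) (by fun_prop)]
    congr 1
    funext q
    simp only [stat, Function.comp, Prod.map]
    ring
  have hI : Integrable (fun q : ℝ × ℝ => A (stat r q.1 q.2)) (μ.prod ν) := by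
    have := hA.integrable θ (oracleVar r).toNNReal
    rw [← hmap] at this
    exact this.comp_measurable (measurable_stat r)
  refine ⟨hI.integral_prod_left, ?_⟩
  rw [← integral_prod _ hI, ← hmap, integral_map (measurable_stat r).aemeasurable
    hA.1.aestronglyMeasurable]

lemma HasExpGrowth.comp_stat {r : ℝ} {A : ℝ → ℝ} (hA : HasExpGrowth A) (x : ℝ) :
    HasExpGrowth fun y => A (stat r x y) := by
  convert hA.comp_affine (1 / (1 + r)) (r * x / (1 + r)) using 3 with y
  rw [stat]; ring

/-- The expectation of a sum over the coordinates of functions of the sufficient statistic and of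
the observation. -/
lemma integral_sum_stat {n : ℕ} {r : ℝ} (hr : 0 < r) (θ : Fin n → ℝ) {A B : Fin n → ℝ → ℝ}
    (hA : ∀ i, HasExpGrowth (A i)) (hB : ∀ i, HasExpGrowth (B i)) :
    (∀ x : Fin n → ℝ, Integrable (fun y => ∑ i, (A i (stat r (x i) (y i)) - B i (x i)))
      (normalLaw θ r)) ∧
    Integrable (fun x => ∫ y, ∑ i, (A i (stat r (x i) (y i)) - B i (x i)) ∂normalLaw θ r)
      (normalLaw θ 1) ∧
    ∫ x, ∫ y, ∑ i, (A i (stat r (x i) (y i)) - B i (x i)) ∂normalLaw θ r ∂normalLaw θ 1 =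
      ∑ i, (∫ u, A i u ∂gaussianReal (θ i) (oracleVar r).toNNReal -
        ∫ u, B i u ∂gaussianReal (θ i) (1 : ℝ).toNNReal) := by
  have h1 : ∀ (x : Fin n → ℝ) (i : Fin n), Integrable (fun y : Fin n → ℝ =>
      A i (stat r (x i) (y i)) - B i (x i)) (normalLaw θ r) := fun x i => by
    refine Integrable.sub ?_ (integrable_const _)
    exact integrable_comp_eval (μ := fun i => gaussianReal (θ i) r.toNNReal) (i := i)
      (f := fun y => A i (stat r (x i) y)) (((hA i).comp_stat (x i)).integrable _ _)
  have h2 : ∀ (x : Fin n → ℝ),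
      ∫ y, ∑ i, (A i (stat r (x i) (y i)) - B i (x i)) ∂normalLaw θ r =
        ∑ i, (∫ y, A i (stat r (x i) y) ∂gaussianReal (θ i) r.toNNReal - B i (x i)) := fun x => by
    rw [integral_finsetSum _ fun i _ => h1 x i]
    refine Finset.sum_congr rfl fun i _ => ?_
    have hi := ((hA i).comp_stat (r := r) (x i)).integrable (θ i) r.toNNReal
    have hi' : Integrable (fun y : Fin n → ℝ => A i (stat r (x i) (y i))) (normalLaw θ r) :=
      integrable_comp_eval (μ := fun i => gaussianReal (θ i) r.toNNReal) (i := i)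
        (f := fun y => A i (stat r (x i) y)) hi
    rw [integral_sub hi' (integrable_const _)]
    congr 1
    · exact integral_comp_eval (μ := fun i => gaussianReal (θ i) r.toNNReal) (i := i)
        (f := fun y => A i (stat r (x i) y)) hi.aestronglyMeasurable
    · simp
  have h3 : ∀ i, Integrable (fun a => ∫ y, A i (stat r a y) ∂gaussianReal (θ i) r.toNNReal - B i a)
      (gaussianReal (θ i) (1 : ℝ).toNNReal) := fun i =>
    (integral_stat hr (θ i) (hA i)).1.sub ((hB i).integrable _ _)
  have h4 : ∀ i, Integrable (fun x : Fin n → ℝ =>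
      ∫ y, A i (stat r (x i) y) ∂gaussianReal (θ i) r.toNNReal - B i (x i)) (normalLaw θ 1) :=
    fun i => integrable_comp_eval (μ := fun i => gaussianReal (θ i) (1 : ℝ).toNNReal) (i := i) 
      (f := fun a => ∫ y, A i (stat r a y) ∂gaussianReal (θ i) r.toNNReal - B i a) (h3 i)
  simp_rw [h2]
  refine ⟨fun x => integrable_finsetSum _ fun i _ => h1 x i,
    integrable_finsetSum _ fun i _ => h4 i, ?_⟩
  rw [integral_finsetSum _ fun i _ => h4 i]
  refine Finset.sum_congr rfl fun i _ => ?_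
  rw [← (integral_stat hr (θ i) (hA i)).2, 
    ← integral_sub (integral_stat hr (θ i) (hA i)).1 ((hB i).integrable _ _)]
  exact integral_comp_eval (μ := fun i => gaussianReal (θ i) (1 : ℝ).toNNReal) (i := i) 
      (f := fun a => ∫ y, A i (stat r a y) ∂gaussianReal (θ i) r.toNNReal - B i a)
      (h3 i).aestronglyMeasurable

/-! ### Product predictive densities built from a mixing measure -/

/-- The integral of `log (p(u | θ) / m(u))` under `N(θ, w)`: the divergence from `m` when `m` is a
probability density, but `m` may also be the marginal density of an improper prior. -/
noncomputable def klTo (w : ℝ) (m : ℝ → ℝ) (θ : ℝ) : ℝ :=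
  ∫ u, Real.log (pdf θ w u / m u) ∂gaussianReal θ w.toNNReal

/-- `m₁` and `mᵥ` are the marginal densities of the observation `x` and of the sufficient statistic
of `(x, y)` under one and the same, possibly improper, prior.  Only the consequence that
`p(y | x) = N(y; x, 1 + r) mᵥ(stat x y) / m₁(x)` is a density in `y` is recorded. -/
structure PredictivePair (r : ℝ) (m₁ mᵥ : ℝ → ℝ) : Prop where
  meas₁ : Measurable m₁
  measᵥ : Measurable mᵥ
  pos₁ : ∀ u, 0 < m₁ u
  posᵥ : ∀ u, 0 < mᵥ u
  growth₁ : HasExpGrowth fun u => Real.log (m₁ u)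
  growthᵥ : HasExpGrowth fun u => Real.log (mᵥ u)
  lintegral_eq : ∀ x, ∫⁻ y, ENNReal.ofReal (pdf x (1 + r) y * mᵥ (stat r x y)) =
    ENNReal.ofReal (m₁ x)

/-- One coordinate of `pairDensity`. -/
noncomputable def pairFactor (r : ℝ) (m₁ mᵥ : ℝ → ℝ) (x y : ℝ) : ℝ≥0∞ :=
  ENNReal.ofReal (pdf x (1 + r) y * mᵥ (stat r x y) / m₁ x)

/-- The predictive density with independent coordinates `N(y; x, 1 + r) mᵥ(stat x y) / m₁(x)`. -/
noncomputable def pairDensity {n : ℕ} (r : ℝ) (m₁ mᵥ : ℝ → ℝ) (x y : Fin n → ℝ) : ℝ≥0∞ :=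
  ∏ i, pairFactor r m₁ mᵥ (x i) (y i)

/-- The univariate risk `ρ(θ)` of the predictive density of a pair. -/
noncomputable def pairRisk (r : ℝ) (m₁ mᵥ : ℝ → ℝ) (θ : ℝ) : ℝ :=
  klTo (oracleVar r) mᵥ θ - klTo 1 m₁ θ

lemma hasExpGrowth_log_ratio {w : ℝ} (hw : 0 < w) {m : ℝ → ℝ} (hpos : ∀ u, 0 < m u)
    (hm : HasExpGrowth fun u => Real.log (m u)) (θ : ℝ) :
    HasExpGrowth fun u => Real.log (pdf θ w u / m u) := by
  convert (hasExpGrowth_log_pdf hw θ).sub hm using 2 with u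
  rw [Real.log_div (pdf_pos hw θ u).ne' (hpos u).ne']

lemma IsPredictiveDensity.measurable_right {n : ℕ} {p : (Fin n → ℝ) → (Fin n → ℝ) → ℝ≥0∞}
    (hp : IsPredictiveDensity p) (x : Fin n → ℝ) : Measurable (p x) :=
  hp.1.comp (measurable_const.prodMk measurable_id)

namespace PredictivePair

variable {r : ℝ} {m₁ mᵥ : ℝ → ℝ}

lemma measurable_factor (h : PredictivePair r m₁ mᵥ) : Measurable fun q : ℝ × ℝ =>
    pairFactor r m₁ mᵥ q.1 q.2 := by
  unfold pairFactor
  refine Measurable.ennreal_ofReal (Measurable.div (Measurable.mul ?_ ?_) ?_)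
  · exact measurable_pdf.comp (by fun_prop : Measurable fun q : ℝ × ℝ => (q.1, 1 + r, q.2))
  · exact h.measᵥ.comp (measurable_stat r)
  · exact h.meas₁.comp measurable_fst

lemma isPredictiveDensity (h : PredictivePair r m₁ mᵥ) {n : ℕ} :
    IsPredictiveDensity (pairDensity (n := n) r m₁ mᵥ) := by
  constructor
  · have : ∀ i : Fin n, Measurable fun q : (Fin n → ℝ) × (Fin n → ℝ) =>
        pairFactor r m₁ mᵥ (q.1 i) (q.2 i) := fun i => by
      have hi : Measurable fun q : (Fin n → ℝ) × (Fin n → ℝ) => (q.1 i, q.2 i) := by fun_prop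
      have := h.measurable_factor.comp hi
      exact this
    exact Finset.measurable_prod Finset.univ fun i _ => this i
  · intro x
    unfold pairDensity
    rw [volume_pi, lintegral_fin_prod (fun _ => volume) (fun i => pairFactor r m₁ mᵥ (x i))
      (fun i => h.measurable_factor.of_uncurry_left)]
    refine Finset.prod_eq_one fun i _ => ?_
    unfold pairFactor
    simp_rw [ENNReal.ofReal_div_of_pos (h.pos₁ (x i)), div_eq_mul_inv]
    rw [lintegral_mul_const', h.lintegral_eq, ENNReal.mul_inv_cancel]
    · simpa using h.pos₁ (x i)
    · exact ENNReal.ofReal_ne_top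
    · exact ENNReal.inv_ne_top.2 (by simpa using h.pos₁ (x i))

/-- The log-likelihood ratio of `p(y | θ)` against the predictive density of the pair. -/
noncomputable def llr (_ : PredictivePair r m₁ mᵥ) {n : ℕ} (θ x y : Fin n → ℝ) : ℝ :=
  ∑ i, (Real.log (pdf (θ i) (oracleVar r) (stat r (x i) (y i)) / mᵥ (stat r (x i) (y i))) -
    Real.log (pdf (θ i) 1 (x i) / m₁ (x i)))

lemma measurable_llr (h : PredictivePair r m₁ mᵥ) {n : ℕ} :
    Measurable fun q : (Fin n → ℝ) × (Fin n → ℝ) × (Fin n → ℝ) => h.llr q.1 q.2.1 q.2.2 := by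
  refine Finset.measurable_sum _ fun i _ => Measurable.sub ?_ ?_
  · have hs : Measurable fun q : (Fin n → ℝ) × (Fin n → ℝ) × (Fin n → ℝ) =>
        stat r (q.2.1 i) (q.2.2 i) := by unfold stat; fun_prop
    refine (Measurable.div ?_ (h.measᵥ.comp hs)).log
    exact measurable_pdf.comp ((by fun_prop : Measurable fun q : (Fin n → ℝ) × (Fin n → ℝ) ×
      (Fin n → ℝ) => q.1 i).prodMk (measurable_const.prodMk hs))
  · have hs : Measurable fun q : (Fin n → ℝ) × (Fin n → ℝ) × (Fin n → ℝ) => q.2.1 i := by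
      fun_prop
    refine (Measurable.div ?_ (h.meas₁.comp hs)).log
    exact measurable_pdf.comp ((by fun_prop : Measurable fun q : (Fin n → ℝ) × (Fin n → ℝ) ×
      (Fin n → ℝ) => q.1 i).prodMk (measurable_const.prodMk hs))

lemma exp_llr_term (h : PredictivePair r m₁ mᵥ) (hr : 0 < r) (θ x y : ℝ) :
    Real.exp (Real.log (pdf θ (oracleVar r) (stat r x y) / mᵥ (stat r x y)) -
      Real.log (pdf θ 1 x / m₁ x)) * pdf θ 1 x =
      pdf θ (oracleVar r) (stat r x y) / mᵥ (stat r x y) * m₁ x := by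
  have h1 := pdf_pos one_pos θ x
  have h2 := pdf_pos (oracleVar_pos hr) θ (stat r x y)
  have h3 := h.pos₁ x
  have h4 := h.posᵥ (stat r x y)
  rw [Real.exp_sub, Real.exp_log (by positivity), Real.exp_log (by positivity)]
  field_simp

lemma pairDensity_mul_exp_llr (h : PredictivePair r m₁ mᵥ) (hr : 0 < r) {n : ℕ}
    (θ x y : Fin n → ℝ) :
    pairDensity r m₁ mᵥ x y * ENNReal.ofReal (Real.exp (h.llr θ x y)) = normalDensity θ r y := by
  rw [llr, Real.exp_sum, ENNReal.ofReal_prod_of_nonneg fun i _ => (Real.exp_pos _).le,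
    pairDensity, normalDensity, ← Finset.prod_mul_distrib]
  refine Finset.prod_congr rfl fun i _ => ?_
  unfold pairFactor
  rw [← ENNReal.ofReal_mul' (Real.exp_pos _).le, gaussianPDF]
  congr 1
  change _ = pdf (θ i) r (y i)
  have h1 := pdf_pos one_pos (θ i) (x i)
  have h3 := h.pos₁ (x i)
  have h4 := h.posᵥ (stat r (x i) (y i))
  have e := h.exp_llr_term hr (θ i) (x i) (y i)
  rw [← eq_div_iff h1.ne'] at e
  rw [e]
  have e2 := pdf_mul_pdf hr (θ i) (x i) (y i)
  field_simp
  linarith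

lemma integral_llr (h : PredictivePair r m₁ mᵥ) (hr : 0 < r) {n : ℕ} (θ : Fin n → ℝ) :
    (∀ x : Fin n → ℝ, Integrable (h.llr θ x) (normalLaw θ r)) ∧
    Integrable (fun x => ∫ y, h.llr θ x y ∂normalLaw θ r) (normalLaw θ 1) ∧
    ∫ x, ∫ y, h.llr θ x y ∂normalLaw θ r ∂normalLaw θ 1 = ∑ i, pairRisk r m₁ mᵥ (θ i) :=
  integral_sum_stat hr θ
    (A := fun i u => Real.log (pdf (θ i) (oracleVar r) u / mᵥ u))
    (B := fun i u => Real.log (pdf (θ i) 1 u / m₁ u))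
    (fun _ => hasExpGrowth_log_ratio (oracleVar_pos hr) h.posᵥ h.growthᵥ _)
    (fun _ => hasExpGrowth_log_ratio one_pos h.pos₁ h.growth₁ _)

lemma predRisk_eq (h : PredictivePair r m₁ mᵥ) (hr : 0 < r) {n : ℕ} (θ : Fin n → ℝ) :
    predRisk r θ (pairDensity r m₁ mᵥ) = ENNReal.ofReal (∑ i, pairRisk r m₁ mᵥ (θ i)) ∧
      0 ≤ ∑ i, pairRisk r m₁ mᵥ (θ i) := by
  obtain ⟨h1, h2, h3⟩ := h.integral_llr hr θ
  have hp := h.isPredictiveDensity (n := n)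
  have key : ∀ x : Fin n → ℝ, InformationTheory.klDiv (normalLaw θ r)
      (volume.withDensity (pairDensity r m₁ mᵥ x)) =
      ENNReal.ofReal (∫ y, h.llr θ x y ∂normalLaw θ r) ∧ 0 ≤ ∫ y, h.llr θ x y ∂normalLaw θ r := by
    intro x
    have hpx : Measurable (pairDensity r m₁ mᵥ x) := hp.measurable_right x
    have : IsProbabilityMeasure (volume.withDensity (pairDensity r m₁ mᵥ x)) :=
      ⟨by rw [withDensity_apply _ MeasurableSet.univ, Measure.restrict_univ, hp.2 x]⟩
    have hx : Measurable fun y : Fin n → ℝ => (θ, x, y) := by fun_prop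
    have hL : Measurable (h.llr θ x) := by
      have := h.measurable_llr.comp hx
      exact this
    refine klDiv_eq_of_withDensity_exp hL ?_ (h1 x)
    rw [← withDensity_mul _ hpx hL.exp.ennreal_ofReal, normalLaw_eq_withDensity θ hr]
    congr 1
    funext y
    exact (h.pairDensity_mul_exp_llr hr θ x y).symm
  rw [← h3]
  refine ⟨?_, integral_nonneg fun x => (key x).2⟩
  rw [predRisk, ofReal_integral_eq_lintegral_ofReal h2 (ae_of_all _ fun x => (key x).2)]
  exact lintegral_congr fun x => (key x).1

lemma pairRisk_nonneg (h : PredictivePair r m₁ mᵥ) (hr : 0 < r) (θ : ℝ) :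
    0 ≤ pairRisk r m₁ mᵥ θ := by
  simpa using (h.predRisk_eq hr (n := 1) fun _ => θ).2

end PredictivePair

lemma measurable_klTo {w : ℝ} (hw : 0 < w) {m : ℝ → ℝ} (hm : Measurable m) :
    Measurable (klTo w m) := by
  have e : klTo w m = fun θ => ∫ u, pdf θ w u • Real.log (pdf θ w u / m u) := by
    funext θ
    exact integral_gaussianReal_eq_integral_smul (by simpa using hw)
  rw [e]
  have hp : Measurable fun q : ℝ × ℝ => pdf q.1 w q.2 :=
    measurable_pdf.comp (by fun_prop : Measurable fun q : ℝ × ℝ => (q.1, w, q.2))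
  have : Measurable fun q : ℝ × ℝ => pdf q.1 w q.2 • Real.log (pdf q.1 w q.2 / m q.2) :=
    hp.smul (hp.div (hm.comp measurable_snd)).log
  exact (this.stronglyMeasurable.integral_prod_right').measurable

/-! ### Bayes predictive densities of product priors -/

/-- The marginal density of an observation with variance `w` under the prior `π`. -/
noncomputable def mix (π : Measure ℝ) (w u : ℝ) : ℝ := ∫ θ, pdf θ w u ∂π

lemma pdf_le {w : ℝ} (hw : 0 < w) (θ u : ℝ) : pdf θ w u ≤ (√(2 * Real.pi * w))⁻¹ := by
  rw [pdf_eq hw]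
  refine mul_le_of_le_one_right (by positivity) (Real.exp_le_one_iff.2 ?_)
  rw [neg_div]
  exact neg_nonpos.2 (by positivity)

lemma measurable_pdf_left (w u : ℝ) : Measurable fun θ => pdf θ w u :=
  measurable_pdf.comp (by fun_prop : Measurable fun θ : ℝ => (θ, w, u))

lemma integrable_pdf_left {w : ℝ} (hw : 0 < w) (π : Measure ℝ) [IsFiniteMeasure π] (u : ℝ) :
    Integrable (fun θ => pdf θ w u) π :=
  Integrable.of_bound (measurable_pdf_left w u).aestronglyMeasurable (√(2 * Real.pi * w))⁻¹
    (ae_of_all _ fun θ => by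
      rw [Real.norm_of_nonneg (pdf_pos hw θ u).le]; exact pdf_le hw θ u)

lemma ofReal_mix {w : ℝ} (hw : 0 < w) (π : Measure ℝ) [IsFiniteMeasure π] (u : ℝ) :
    ENNReal.ofReal (mix π w u) = ∫⁻ θ, ENNReal.ofReal (pdf θ w u) ∂π :=
  ofReal_integral_eq_lintegral_ofReal (integrable_pdf_left hw π u)
    (ae_of_all _ fun θ => (pdf_pos hw θ u).le)

lemma mul_pdf_le_mix {w : ℝ} (hw : 0 < w) {π : Measure ℝ} [IsFiniteMeasure π] {c : ℝ} (hc : 0 ≤ c)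
    {t : ℝ} (h : ENNReal.ofReal c • Measure.dirac t ≤ π) (u : ℝ) : c * pdf t w u ≤ mix π w u := by
  have : ∫ θ, pdf θ w u ∂(ENNReal.ofReal c • Measure.dirac t) ≤ ∫ θ, pdf θ w u ∂π :=
    integral_mono_measure h (ae_of_all _ fun θ => (pdf_pos hw θ u).le)
      (integrable_pdf_left hw π u)
  rwa [integral_smul_measure, integral_dirac, ENNReal.toReal_ofReal hc] at this

lemma mix_le {w : ℝ} (hw : 0 < w) (π : Measure ℝ) [IsProbabilityMeasure π] (u : ℝ) :
    mix π w u ≤ (√(2 * Real.pi * w))⁻¹ := by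
  calc mix π w u ≤ ∫ _, (√(2 * Real.pi * w))⁻¹ ∂π :=
        integral_mono (integrable_pdf_left hw π u) (integrable_const _) fun θ => pdf_le hw θ u
    _ = _ := by simp

lemma measurable_mix (π : Measure ℝ) [SFinite π] (w : ℝ) : Measurable (mix π w) := by
  have hp : Measurable fun q : ℝ × ℝ => pdf q.2 w q.1 :=
    measurable_pdf.comp (by fun_prop : Measurable fun q : ℝ × ℝ => (q.2, w, q.1))
  exact (hp.stronglyMeasurable.integral_prod_right').measurable

lemma lintegral_mix {w : ℝ} (hw : 0 < w) (π : Measure ℝ) [IsProbabilityMeasure π] :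
    ∫⁻ u, ENNReal.ofReal (mix π w u) = 1 := by
  simp_rw [ofReal_mix hw π]
  have hp : Measurable fun q : ℝ × ℝ => ENNReal.ofReal (pdf q.2 w q.1) :=
    (measurable_pdf.comp (by fun_prop : Measurable fun q : ℝ × ℝ => (q.2, w, q.1))).ennreal_ofReal
  rw [lintegral_lintegral_swap hp.aemeasurable]
  simp [lintegral_pdf hw]

section
variable {π : Measure ℝ} [IsProbabilityMeasure π] {c : ℝ}

lemma mix_pos (hc : 0 < c) (h0 : ENNReal.ofReal c • Measure.dirac 0 ≤ π) {w : ℝ} (hw : 0 < w)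
    (u : ℝ) : 0 < mix π w u :=
  (mul_pos hc (pdf_pos hw 0 u)).trans_le (mul_pdf_le_mix hw hc.le h0 u)

lemma hasExpGrowth_log_mix (hc : 0 < c) (h0 : ENNReal.ofReal c • Measure.dirac 0 ≤ π) {w : ℝ}
    (hw : 0 < w) : HasExpGrowth fun u => Real.log (mix π w u) := by
  refine HasExpGrowth.of_le (measurable_mix π w).log
    (B := fun u => |Real.log c| + |Real.log (pdf 0 w u)| + |Real.log (√(2 * Real.pi * w))⁻¹|)
    (((HasExpGrowth.const _).add (hasExpGrowth_log_pdf hw 0).abs).add (HasExpGrowth.const _))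
    fun u => ?_
  have h1 := Real.log_le_log (mul_pos hc (pdf_pos hw 0 u)) (mul_pdf_le_mix hw hc.le h0 u)
  rw [Real.log_mul hc.ne' (pdf_pos hw 0 u).ne'] at h1
  have h2 := Real.log_le_log (mix_pos hc h0 hw u) (mix_le hw π u)
  have := neg_abs_le (Real.log c)
  have := neg_abs_le (Real.log (pdf 0 w u))
  have := abs_nonneg (Real.log c)
  have := abs_nonneg (Real.log (pdf 0 w u))
  have := le_abs_self (Real.log (√(2 * Real.pi * w))⁻¹)
  have := abs_nonneg (Real.log (√(2 * Real.pi * w))⁻¹)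
  exact abs_le.2 ⟨by linarith, by linarith⟩

lemma predictivePair_mix {r : ℝ} (hr : 0 < r) (hc : 0 < c)
    (h0 : ENNReal.ofReal c • Measure.dirac 0 ≤ π) :
    PredictivePair r (mix π 1) (mix π (oracleVar r)) where
  meas₁ := measurable_mix π 1
  measᵥ := measurable_mix π _
  pos₁ := mix_pos hc h0 one_pos
  posᵥ := mix_pos hc h0 (oracleVar_pos hr)
  growth₁ := hasExpGrowth_log_mix hc h0 one_pos
  growthᵥ := hasExpGrowth_log_mix hc h0 (oracleVar_pos hr)
  lintegral_eq x := by
    have e : ∀ y, ENNReal.ofReal (pdf x (1 + r) y * mix π (oracleVar r) (stat r x y)) =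
        ∫⁻ θ, ENNReal.ofReal (pdf θ 1 x) * ENNReal.ofReal (pdf θ r y) ∂π := by
      intro y
      rw [ENNReal.ofReal_mul (pdf_pos (by linarith) x y).le, ofReal_mix (oracleVar_pos hr),
        ← lintegral_const_mul' _ _ ENNReal.ofReal_ne_top]
      refine lintegral_congr fun θ => ?_
      rw [← ENNReal.ofReal_mul (pdf_pos (by linarith) x y).le,
        ← ENNReal.ofReal_mul (pdf_pos one_pos θ x).le, pdf_mul_pdf hr]
    have hm : Measurable fun q : ℝ × ℝ =>
        ENNReal.ofReal (pdf q.2 1 x) * ENNReal.ofReal (pdf q.2 r q.1) :=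
      (measurable_pdf.comp
        (by fun_prop : Measurable fun q : ℝ × ℝ => (q.2, (1 : ℝ), x))).ennreal_ofReal.mul
      (measurable_pdf.comp (by fun_prop : Measurable fun q : ℝ × ℝ => (q.2, r, q.1))).ennreal_ofReal
    simp_rw [e]
    rw [lintegral_lintegral_swap hm.aemeasurable, ofReal_mix one_pos]
    refine lintegral_congr fun θ => ?_
    rw [lintegral_const_mul' _ _ ENNReal.ofReal_ne_top, lintegral_pdf hr, mul_one]

lemma bayesDensity_pi {r : ℝ} (hr : 0 < r) (hc : 0 < c)
    (h0 : ENNReal.ofReal c • Measure.dirac 0 ≤ π) {n : ℕ} :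
    bayesDensity r (Measure.pi fun _ : Fin n => π) =
      pairDensity r (mix π 1) (mix π (oracleVar r)) := by
  funext x y
  have hv := oracleVar_pos hr
  have hr1 : 0 < 1 + r := by linarith
  have hnum : ∫⁻ θ, normalDensity θ 1 x * normalDensity θ r y ∂(Measure.pi fun _ : Fin n => π) =
      ENNReal.ofReal (∏ i, pdf (x i) (1 + r) (y i) * mix π (oracleVar r) (stat r (x i) (y i))) := by
    rw [ENNReal.ofReal_prod_of_nonneg fun i _ =>
      mul_nonneg (pdf_pos hr1 _ _).le (mix_pos hc h0 hv _).le]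
    simp_rw [normalDensity, ← Finset.prod_mul_distrib]
    rw [lintegral_fin_prod (fun _ => π) (fun i t => gaussianPDF t (1 : ℝ).toNNReal (x i) *
      gaussianPDF t r.toNNReal (y i)) (fun i => 
        (measurable_pdf_left 1 (x i)).ennreal_ofReal.mul (measurable_pdf_left r (y i)).ennreal_ofReal)]
    refine Finset.prod_congr rfl fun i _ => ?_
    rw [ENNReal.ofReal_mul (pdf_pos hr1 _ _).le, ofReal_mix hv,
      ← lintegral_const_mul' _ _ ENNReal.ofReal_ne_top]
    refine lintegral_congr fun θ => ?_
    rw [← ENNReal.ofReal_mul (pdf_pos hr1 _ _).le, ← pdf_mul_pdf hr,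
      ENNReal.ofReal_mul (pdf_pos one_pos θ _).le]
    rfl
  have hden : ∫⁻ θ, normalDensity θ 1 x ∂(Measure.pi fun _ : Fin n => π) =
      ENNReal.ofReal (∏ i, mix π 1 (x i)) := by
    rw [ENNReal.ofReal_prod_of_nonneg fun i _ => (mix_pos hc h0 one_pos _).le]
    simp_rw [normalDensity]
    rw [lintegral_fin_prod (fun _ => π) (fun i t => gaussianPDF t (1 : ℝ).toNNReal (x i))
      (fun i => (measurable_pdf_left 1 (x i)).ennreal_ofReal)]
    refine Finset.prod_congr rfl fun i _ => ?_
    rw [ofReal_mix one_pos]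
    rfl
  rw [bayesDensity, hnum, hden, ← ENNReal.ofReal_div_of_pos
    (Finset.prod_pos fun i _ => mix_pos hc h0 one_pos _), ← Finset.prod_div_distrib, pairDensity,
    ENNReal.ofReal_prod_of_nonneg fun i _ => div_nonneg
      (mul_nonneg (pdf_pos hr1 _ _).le (mix_pos hc h0 hv _).le) (mix_pos hc h0 one_pos _).le]
  rfl

/-- The Bayes risk of a product prior is the sum of the univariate Bayes risks, and is attained by
the Bayes predictive density. -/
lemma predBayesRisk_pi {r : ℝ} (hr : 0 < r) (hc : 0 < c)
    (h0 : ENNReal.ofReal c • Measure.dirac 0 ≤ π) {n : ℕ} :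
    predBayesRisk r (Measure.pi fun _ : Fin n => π) =
      n * ∫⁻ t, ENNReal.ofReal (pairRisk r (mix π 1) (mix π (oracleVar r)) t) ∂π := by
  have h := predictivePair_mix hr hc h0
  have hv := oracleVar_pos hr
  set ρ := pairRisk r (mix π 1) (mix π (oracleVar r)) with hρ
  have hρm : Measurable ρ := (measurable_klTo hv h.measᵥ).sub (measurable_klTo one_pos h.meas₁)
  have hsum : ∫⁻ θ, ENNReal.ofReal (∑ i, ρ (θ i)) ∂(Measure.pi fun _ : Fin n => π) =
      n * ∫⁻ t, ENNReal.ofReal (ρ t) ∂π := by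
    have e : ∀ θ : Fin n → ℝ, ENNReal.ofReal (∑ i, ρ (θ i)) = ∑ i, ENNReal.ofReal (ρ (θ i)) :=
      fun θ => ENNReal.ofReal_sum_of_nonneg fun i _ => h.pairRisk_nonneg hr _
    simp_rw [e]
    have hmi : ∀ i : Fin n, Measurable fun θ : Fin n → ℝ => ENNReal.ofReal (ρ (θ i)) := fun i =>
      (hρm.comp (measurable_pi_apply i)).ennreal_ofReal
    rw [lintegral_finsetSum _ fun i _ => hmi i]
    have : ∀ i : Fin n, ∫⁻ θ, ENNReal.ofReal (ρ (θ i)) ∂(Measure.pi fun _ : Fin n => π) =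
        ∫⁻ t, ENNReal.ofReal (ρ t) ∂π := fun i =>
      (measurePreserving_eval (fun _ : Fin n => π) i).lintegral_comp hρm.ennreal_ofReal
    simp [this]
  rw [← hsum]
  refine le_antisymm ?_ ?_
  · refine (iInf₂_le _ (h.isPredictiveDensity (n := n))).trans_eq (lintegral_congr fun θ => ?_)
    exact (h.predRisk_eq hr θ).1
  · refine le_iInf₂ fun p hp => ?_
    have hle : ∀ x y : Fin n → ℝ, ∫⁻ θ, ENNReal.ofReal (Real.exp (h.llr θ x y)) *
        normalDensity θ 1 x ∂(Measure.pi fun _ : Fin n => π) ≤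
          ∏ i, ENNReal.ofReal (mix π 1 (x i)) := by
      intro x y
      have e : ∀ θ : Fin n → ℝ, ENNReal.ofReal (Real.exp (h.llr θ x y)) * normalDensity θ 1 x =
          ∏ i, (ENNReal.ofReal (mix π 1 (x i) / mix π (oracleVar r) (stat r (x i) (y i))) *
            ENNReal.ofReal (pdf (θ i) (oracleVar r) (stat r (x i) (y i)))) := by
        intro θ
        rw [PredictivePair.llr, Real.exp_sum, 
          ENNReal.ofReal_prod_of_nonneg fun i _ => (Real.exp_pos _).le, normalDensity,
          ← Finset.prod_mul_distrib]
        refine Finset.prod_congr rfl fun i _ => ?_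
        rw [← ENNReal.ofReal_mul' (pdf_pos hv _ _).le, gaussianPDF,
          ← ENNReal.ofReal_mul (Real.exp_pos _).le]
        congr 1
        refine (h.exp_llr_term hr (θ i) (x i) (y i)).trans ?_
        ring
      simp_rw [e]
      rw [lintegral_fin_prod (fun _ => π) (fun i t =>
        ENNReal.ofReal (mix π 1 (x i) / mix π (oracleVar r) (stat r (x i) (y i))) *
            ENNReal.ofReal (pdf t (oracleVar r) (stat r (x i) (y i))))
        (fun i => (measurable_pdf_left _ _).ennreal_ofReal.const_mul _)]
      refine (Finset.prod_congr rfl fun i _ => ?_).le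
      rw [lintegral_const_mul' _ _ ENNReal.ofReal_ne_top, ← ofReal_mix hv,
        ← ENNReal.ofReal_mul' (h.posᵥ _).le, div_mul_cancel₀ _ (h.posᵥ _).ne']
    have hg : ∫⁻ x : Fin n → ℝ, ∏ i, ENNReal.ofReal (mix π 1 (x i)) ≤ 1 := by
      rw [volume_pi, lintegral_fin_prod (fun _ => volume) (fun _ t => ENNReal.ofReal (mix π 1 t))
        (fun _ => h.meas₁.ennreal_ofReal)]
      simp [lintegral_mix one_pos π]
    have := lintegral_le_lintegral_predRisk_add_one (Measure.pi fun _ : Fin n => π) hp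
      (fun θ x y => h.llr θ x y) h.measurable_llr (fun θ => (h.integral_llr hr θ).1)
      (fun θ => (h.integral_llr hr θ).2.1) _ hg hle
    simp_rw [(h.integral_llr hr _).2.2] at this
    rw [lintegral_congr fun θ => ENNReal.ofReal_add (h.predRisk_eq hr θ).2 zero_le_one,
      lintegral_add_right _ measurable_const] at this
    simpa using this

end

/-! ### Bounds on the divergence from a mixture -/

lemma integral_sub_mean (θ : ℝ) (w : NNReal) : ∫ u, (u - θ) ∂gaussianReal θ w = 0 := by
  rw [integral_sub (HasExpGrowth.id.integrable θ w) (integrable_const _),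
    integral_id_gaussianReal]
  simp

lemma integral_sub_mean_sq (θ : ℝ) {w : ℝ} (hw : 0 < w) :
    ∫ u, (u - θ) ^ 2 ∂gaussianReal θ w.toNNReal = w := by
  have h := variance_fun_id_gaussianReal (μ := θ) (v := w.toNNReal)
  rw [variance_eq_integral (by fun_prop), integral_id_gaussianReal] at h
  rw [h, Real.coe_toNNReal _ hw.le]

lemma hasExpGrowth_sub (θ : ℝ) : HasExpGrowth fun u => u - θ :=
  HasExpGrowth.id.sub (HasExpGrowth.const θ)

lemma hasExpGrowth_sub_sq (θ : ℝ) : HasExpGrowth fun u => (u - θ) ^ 2 := by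
  simpa [sub_eq_add_neg] using HasExpGrowth.sq.comp_affine 1 (-θ)

lemma integral_abs_sub_mean_le (θ : ℝ) {w : ℝ} (hw : 0 < w) :
    ∫ u, |u - θ| ∂gaussianReal θ w.toNNReal ≤ (w + 1) / 2 := by
  have h2 := (hasExpGrowth_sub_sq θ).integrable θ w.toNNReal
  calc ∫ u, |u - θ| ∂gaussianReal θ w.toNNReal
      ≤ ∫ u, 1 / 2 * ((u - θ) ^ 2 + 1) ∂gaussianReal θ w.toNNReal := by
        refine integral_mono ((hasExpGrowth_sub θ).abs.integrable _ _)
          ((h2.add (integrable_const _)).const_mul _) fun u => ?_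
        have := sq_abs (u - θ)
        simp only
        nlinarith [sq_nonneg (|u - θ| - 1)]
    _ = (w + 1) / 2 := by
        rw [integral_const_mul, integral_add h2 (integrable_const _), integral_sub_mean_sq θ hw]
        simp; ring

section
variable {w : ℝ} (hw : 0 < w) {m : ℝ → ℝ} (hpos : ∀ u, 0 < m u)
  (hm : HasExpGrowth fun u => Real.log (m u))
include hw hpos hm

/-- An atom of mass `c` at `t` bounds the divergence. -/
lemma klTo_le_of_atom {c t : ℝ} (hc : 0 < c) (h : ∀ u, c * pdf t w u ≤ m u) (θ : ℝ) :
    klTo w m θ ≤ (θ - t) ^ 2 / (2 * w) - Real.log c := by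
  have hi : Integrable (fun u => (θ - t) / w * (u - θ)) (gaussianReal θ w.toNNReal) :=
    ((hasExpGrowth_sub θ).integrable _ _).const_mul _
  calc klTo w m θ ≤ ∫ u, ((θ - t) / w * (u - θ) + ((θ - t) ^ 2 / (2 * w) - Real.log c))
        ∂gaussianReal θ w.toNNReal := by
        refine integral_mono ((hasExpGrowth_log_ratio hw hpos hm θ).integrable _ _)
          (hi.add (integrable_const _)) fun u => ?_
        have h1 := Real.log_le_log (mul_pos hc (pdf_pos hw t u)) (h u)
        rw [Real.log_mul hc.ne' (pdf_pos hw t u).ne', log_pdf hw] at h1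
        simp only
        rw [Real.log_div (pdf_pos hw θ u).ne' (hpos u).ne', log_pdf hw]
        have : (θ - t) / w * (u - θ) + (θ - t) ^ 2 / (2 * w) =
            (u - t) ^ 2 / (2 * w) - (u - θ) ^ 2 / (2 * w) := by field_simp; ring
        linarith
    _ = _ := by
        rw [integral_add hi (integrable_const _), integral_const_mul, integral_sub_mean]
        simp

lemma klTo_le_of_le {c : ℝ} (hc : 0 < c) (h : ∀ u, c ≤ m u) (θ : ℝ) :
    klTo w m θ ≤ -Real.log (√(2 * Real.pi * w)) - Real.log c := by
  calc klTo w m θ ≤ ∫ _, (-Real.log (√(2 * Real.pi * w)) - Real.log c)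
        ∂gaussianReal θ w.toNNReal := by
        refine integral_mono ((hasExpGrowth_log_ratio hw hpos hm θ).integrable _ _)
          (integrable_const _) fun u => ?_
        have h1 := Real.log_le_log hc (h u)
        simp only
        rw [Real.log_div (pdf_pos hw θ u).ne' (hpos u).ne', log_pdf hw]
        have : 0 ≤ (u - θ) ^ 2 / (2 * w) := by positivity
        linarith
    _ = _ := by simp

omit hw hpos hm in
lemma min_sq_sub_le (hw : 0 < w) {l : ℝ} (hl : 0 ≤ l) (u θ : ℝ) :
    min (θ ^ 2 / (2 * w)) l - √(2 * w * l) / w * |u - θ| ≤ min (u ^ 2 / (2 * w)) l := by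
  set s := √(2 * w * l)
  have hs : s ^ 2 = 2 * w * l := Real.sq_sqrt (by positivity)
  have hs0 : 0 ≤ s := Real.sqrt_nonneg _
  have e : ∀ x : ℝ, min (x ^ 2 / (2 * w)) l = min |x| s ^ 2 / (2 * w) := by
    intro x
    have hl' : l = s ^ 2 / (2 * w) := by rw [hs]; field_simp
    rcases le_total |x| s with h | h
    · rw [min_eq_left h, sq_abs, min_eq_left]
      rw [hl', ← sq_abs x]; gcongr
    · rw [min_eq_right h, min_eq_right, hl']
      rw [hl', ← sq_abs x]; gcongr
  rw [e, e]
  have ha : min |θ| s ≤ min |u| s + |u - θ| := by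
    have : |θ| ≤ |u| + |u - θ| := by
      have := abs_sub_abs_le_abs_sub θ u
      rw [abs_sub_comm] at this; linarith
    rcases le_total |u| s with h | h
    · rw [min_eq_left h]; exact (min_le_left _ _).trans this
    · rw [min_eq_right h]; exact (min_le_right _ _).trans (by linarith [abs_nonneg (u - θ)])
  have h0 : 0 ≤ min |θ| s := le_min (abs_nonneg _) hs0
  have h1 : min |θ| s ≤ s := min_le_right _ _
  have h2 : 0 ≤ min |u| s := le_min (abs_nonneg _) hs0
  have h3 : min |u| s ≤ s := min_le_right _ _
  have : s / w * |u - θ| = 2 * s * |u - θ| / (2 * w) := by field_simp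
  rw [this, ← sub_div]
  gcongr
  nlinarith [abs_nonneg (u - θ), mul_nonneg (abs_nonneg (u - θ)) (sub_nonneg.2 h1),
    mul_nonneg (abs_nonneg (u - θ)) (sub_nonneg.2 h3)]

/-- When at most the mass `exp (-l)` is away from the origin, up to the factor `D`, the divergence
is at least `min (θ² / (2w)) l`, up to a term of the order of the square root of `l`. -/
lemma le_klTo {D l : ℝ} (hD : 1 ≤ D) (hl : 0 ≤ l)
    (h : ∀ u, m u ≤ pdf 0 w u + D * (Real.exp (-l) * (√(2 * Real.pi * w))⁻¹)) (θ : ℝ) :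
    min (θ ^ 2 / (2 * w)) l - (Real.log D + 2 + √(2 * w * l) / w * ((w + 1) / 2)) ≤
      klTo w m θ := by
  set s := √(2 * w * l)
  have hs0 : 0 ≤ s := Real.sqrt_nonneg _
  have hi1 := ((hasExpGrowth_sub_sq θ).integrable θ w.toNNReal).const_mul (2 * w)⁻¹
  have hi2 := ((hasExpGrowth_sub θ).abs.integrable θ w.toNNReal).const_mul (s / w)
  have hlogD : 0 ≤ Real.log D := Real.log_nonneg hD
  have hlog2 : Real.log 2 ≤ 1 := by linarith [Real.log_two_lt_d9]
  calc _ ≤ (min (θ ^ 2 / (2 * w)) l - (Real.log D + Real.log 2)) - (2 * w)⁻¹ * w -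
          s / w * ∫ u, |u - θ| ∂gaussianReal θ w.toNNReal := by
        have h1 : s / w * ∫ u, |u - θ| ∂gaussianReal θ w.toNNReal ≤ s / w * ((w + 1) / 2) :=
          mul_le_mul_of_nonneg_left (integral_abs_sub_mean_le θ hw) (by positivity)
        have h2 : (2 * w)⁻¹ * w = 1 / 2 := by field_simp
        linarith
    _ = ∫ u, ((min (θ ^ 2 / (2 * w)) l - (Real.log D + Real.log 2)) - (2 * w)⁻¹ * (u - θ) ^ 2 -
          s / w * |u - θ|) ∂gaussianReal θ w.toNNReal := by
        have hi3 : Integrable (fun u : ℝ => (min (θ ^ 2 / (2 * w)) l - (Real.log D + Real.log 2)) -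
          (2 * w)⁻¹ * (u - θ) ^ 2) (gaussianReal θ w.toNNReal) := (integrable_const _).sub hi1
        rw [integral_sub hi3 hi2, integral_sub (integrable_const _) hi1,
          integral_const_mul, integral_const_mul, integral_sub_mean_sq θ hw]
        simp
    _ ≤ klTo w m θ := by
        refine integral_mono (((integrable_const _).sub hi1).sub hi2)
          ((hasExpGrowth_log_ratio hw hpos hm θ).integrable _ _) fun u => ?_
        have hk : 0 < √(2 * Real.pi * w) := by positivity
        have hmu : m u ≤ D * (2 * (Real.exp (-min (u ^ 2 / (2 * w)) l) *
            (√(2 * Real.pi * w))⁻¹)) := by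
          refine (h u).trans ?_
          have h1 : pdf 0 w u ≤ Real.exp (-min (u ^ 2 / (2 * w)) l) * (√(2 * Real.pi * w))⁻¹ := by
            rw [pdf_eq hw, mul_comm]
            gcongr
            rw [sub_zero, neg_div]
            exact neg_le_neg (min_le_left _ _)
          have h2 : Real.exp (-l) * (√(2 * Real.pi * w))⁻¹ ≤
              Real.exp (-min (u ^ 2 / (2 * w)) l) * (√(2 * Real.pi * w))⁻¹ := by
            gcongr
            exact min_le_right _ _
          have h3 := pdf_pos hw 0 u
          nlinarith
        have h1 := Real.log_le_log (hpos u) hmu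
        rw [Real.log_mul (by positivity) (by positivity), Real.log_mul (by positivity)
          (by positivity), Real.log_mul (by positivity) (by positivity), Real.log_exp,
          Real.log_inv] at h1
        have h2 := min_sq_sub_le hw hl u θ
        simp only
        rw [Real.log_div (pdf_pos hw θ u).ne' (hpos u).ne', log_pdf hw]
        have : (2 * w)⁻¹ * (u - θ) ^ 2 = (u - θ) ^ 2 / (2 * w) := by field_simp
        linarith

lemma klTo_nonneg (hmm : Measurable m) (h1 : ∫⁻ u, ENNReal.ofReal (m u) = 1) (θ : ℝ) :
    0 ≤ klTo w m θ := by
  have : IsProbabilityMeasure (volume.withDensity fun u => ENNReal.ofReal (m u)) :=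
    ⟨by rw [withDensity_apply _ MeasurableSet.univ, Measure.restrict_univ, h1]⟩
  have hg := hasExpGrowth_log_ratio hw hpos hm θ
  refine (klDiv_eq_of_withDensity_exp (Q := volume.withDensity fun u => ENNReal.ofReal (m u)) hg.1
    ?_ (hg.integrable θ _)).2
  rw [← withDensity_mul _ hmm.ennreal_ofReal hg.1.exp.ennreal_ofReal,
    gaussianReal_of_var_ne_zero θ (by simpa using hw)]
  congr 1
  funext u
  have h2 := hpos u
  have h3 := pdf_pos hw θ u
  simp only [Pi.mul_apply]
  rw [Real.exp_log (by positivity), ← ENNReal.ofReal_mul h2.le, mul_div_cancel₀ _ h2.ne']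
  rfl

end

/-! ### The upper bound for the minimax risk -/

/-- The marginal density under the improper prior `δ₀ + exp (-l) dθ`. -/
noncomputable def slabMix (l w u : ℝ) : ℝ := pdf 0 w u + Real.exp (-l)

lemma slabMix_pos {w : ℝ} (hw : 0 < w) (l u : ℝ) : 0 < slabMix l w u :=
  add_pos (pdf_pos hw 0 u) (Real.exp_pos _)

lemma hasExpGrowth_log_slabMix {w : ℝ} (hw : 0 < w) (l : ℝ) :
    HasExpGrowth fun u => Real.log (slabMix l w u) := by
  refine HasExpGrowth.of_le ((measurable_pdf_right 0 w).add_const _).log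
    (HasExpGrowth.const (|l| + |Real.log ((√(2 * Real.pi * w))⁻¹ + Real.exp (-l))|)) fun u => ?_
  have h1 : Real.log (Real.exp (-l)) ≤ Real.log (slabMix l w u) :=
    Real.log_le_log (Real.exp_pos _) (le_add_of_nonneg_left (pdf_pos hw 0 u).le)
  have h2 : Real.log (slabMix l w u) ≤ Real.log ((√(2 * Real.pi * w))⁻¹ + Real.exp (-l)) :=
    Real.log_le_log (slabMix_pos hw l u) (by unfold slabMix; gcongr; exact pdf_le hw 0 u)
  rw [Real.log_exp] at h1
  have := le_abs_self l
  have := abs_nonneg l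
  have := le_abs_self (Real.log ((√(2 * Real.pi * w))⁻¹ + Real.exp (-l)))
  have := abs_nonneg (Real.log ((√(2 * Real.pi * w))⁻¹ + Real.exp (-l)))
  exact abs_le.2 ⟨by linarith, by linarith⟩

lemma predictivePair_slabMix {r : ℝ} (hr : 0 < r) (l : ℝ) :
    PredictivePair r (slabMix l 1) (slabMix l (oracleVar r)) where
  meas₁ := (measurable_pdf_right 0 1).add_const _
  measᵥ := (measurable_pdf_right 0 _).add_const _
  pos₁ := slabMix_pos one_pos l
  posᵥ := slabMix_pos (oracleVar_pos hr) l
  growth₁ := hasExpGrowth_log_slabMix one_pos l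
  growthᵥ := hasExpGrowth_log_slabMix (oracleVar_pos hr) l
  lintegral_eq x := by
    have hr1 : 0 < 1 + r := by linarith
    have e : ∀ y, ENNReal.ofReal (pdf x (1 + r) y * slabMix l (oracleVar r) (stat r x y)) =
        ENNReal.ofReal (pdf 0 1 x) * ENNReal.ofReal (pdf 0 r y) +
          ENNReal.ofReal (Real.exp (-l)) * ENNReal.ofReal (pdf x (1 + r) y) := by
      intro y
      have h1 := (pdf_pos one_pos 0 x).le
      have h2 := (pdf_pos hr 0 y).le
      have h3 := (pdf_pos hr1 x y).le
      rw [slabMix, mul_add, ← pdf_mul_pdf hr, ← ENNReal.ofReal_mul h1,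
        ← ENNReal.ofReal_mul (Real.exp_pos _).le, mul_comm (Real.exp _),
        ENNReal.ofReal_add (mul_nonneg h1 h2) (mul_nonneg h3 (Real.exp_pos _).le)]
    simp_rw [e]
    rw [lintegral_add_left ((measurable_pdf_right 0 r).ennreal_ofReal.const_mul _),
      lintegral_const_mul' _ _ ENNReal.ofReal_ne_top, lintegral_const_mul' _ _ ENNReal.ofReal_ne_top,
      lintegral_pdf hr, lintegral_pdf hr1, mul_one, mul_one,
      ← ENNReal.ofReal_add (pdf_pos one_pos 0 x).le (Real.exp_pos _).le]
    rfl

lemma oracleVar_lt_one {r : ℝ} (hr : 0 < r) : oracleVar r < 1 := by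
  rw [oracleVar_eq hr, div_lt_one (by linarith)]; linarith

lemma pairRisk_slabMix_le {r : ℝ} (hr : 0 < r) : ∃ C : ℝ, 0 ≤ C ∧ ∀ l : ℝ, 0 ≤ l → ∀ θ,
    pairRisk r (slabMix l 1) (slabMix l (oracleVar r)) θ ≤
      (1 - oracleVar r) * l + C * (1 + √l) := by
  have hv := oracleVar_pos hr
  have hv1 := oracleVar_lt_one hr
  set v := oracleVar r
  set c := |Real.log (√(2 * Real.pi * v))|
  set d := Real.log (√(2 * Real.pi * 1))
  have hpi : 1 ≤ √(2 * Real.pi * 1) := by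
    rw [Real.one_le_sqrt]; nlinarith [Real.pi_gt_three]
  have hd : 0 ≤ d := Real.log_nonneg hpi
  have hc : 0 ≤ c := abs_nonneg _
  refine ⟨c + d + 2 + 2, by positivity, fun l hl θ => ?_⟩
  have h := predictivePair_slabMix hr l
  have a1 : klTo v (slabMix l v) θ ≤ θ ^ 2 / (2 * v) := by
    have := klTo_le_of_atom hv h.posᵥ h.growthᵥ one_pos (t := 0)
      (fun u => by rw [one_mul]; exact le_add_of_nonneg_right (Real.exp_pos _).le) θ
    simpa using this
  have a2 : klTo v (slabMix l v) θ ≤ c + l := by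
    have := klTo_le_of_le hv h.posᵥ h.growthᵥ (Real.exp_pos (-l))
      (fun u => le_add_of_nonneg_left (pdf_pos hv 0 u).le) θ
    rw [Real.log_exp] at this
    have h3 := neg_le_abs (Real.log (√(2 * Real.pi * v)))
    linarith
  have a3 := le_klTo one_pos h.pos₁ h.growth₁ hpi hl (fun u => le_of_eq (by
    rw [slabMix, mul_comm (Real.exp (-l)), mul_inv_cancel_left₀ (by positivity)])) θ
  have hs : √(2 * 1 * l) ≤ 2 * √l := by
    rw [Real.sqrt_le_left (by positivity), mul_pow, Real.sq_sqrt hl]; linarith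
  have hs0 := Real.sqrt_nonneg l
  have hmin : min (θ ^ 2 / (2 * v)) l ≤ min (θ ^ 2 / (2 * 1)) l + (1 - v) * l := by
    rcases le_total (θ ^ 2 / (2 * 1)) l with h1 | h1
    · rw [min_eq_left h1]
      rcases le_total (θ ^ 2) (2 * v * l) with h2 | h2
      · refine (min_le_left _ _).trans ?_
        rw [div_le_iff₀ (by positivity)]
        nlinarith
      · refine (min_le_right _ _).trans ?_
        nlinarith
    · rw [min_eq_right h1]
      refine (min_le_right _ _).trans ?_
      nlinarith
  have a4 : klTo v (slabMix l v) θ ≤ min (θ ^ 2 / (2 * v)) l + c := by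
    rcases min_cases (θ ^ 2 / (2 * v)) l with ⟨h, -⟩ | ⟨h, -⟩ <;> rw [h] <;> linarith
  have : 0 ≤ (c + d + 2) * √l := by positivity
  have hd' : Real.log (√(2 * Real.pi * 1)) = d := rfl
  rw [hd'] at a3
  have a5 : min (θ ^ 2 / (2 * 1)) l - (d + 2 + 2 * √l) ≤ klTo 1 (slabMix l 1) θ := by
    refine le_trans ?_ a3
    have : √(2 * 1 * l) / 1 * ((1 + 1) / 2) = √(2 * 1 * l) := by ring
    rw [this]
    exact sub_le_sub_left (add_le_add_right hs _) _
  have a6 : klTo v (slabMix l v) θ - klTo 1 (slabMix l 1) θ ≤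
      (1 - v) * l + (c + (d + 2 + 2 * √l)) := by linarith
  refine a6.trans ?_
  linarith

/-- The exponent `α < 1` trades integrability against the size of the bound. -/
lemma log_one_add_mul_exp_le {c a : ℝ} (hc : 1 ≤ c) (ha : 1 / 2 ≤ a) (ha1 : a ≤ 1) (t : ℝ) :
    Real.log (1 + c * Real.exp t) ≤ 2 * c * Real.exp (a * t) := by
  have he := Real.exp_pos t
  have h1 : Real.log (1 + c * Real.exp t) ≤ c * Real.log (1 + Real.exp t) := by
    rw [← Real.log_rpow (by positivity)]
    exact Real.log_le_log (by positivity) (one_add_mul_self_le_rpow_one_add (by linarith) hc)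
  have h2 : a * Real.log (1 + Real.exp t) ≤ Real.exp (a * t) := by
    rw [← Real.log_rpow (by positivity)]
    have h3 : (1 + Real.exp t) ^ a ≤ 1 + Real.exp (a * t) := by
      have := Real.rpow_add_le_add_rpow zero_le_one he.le (by linarith : 0 ≤ a) ha1
      rwa [Real.one_rpow, ← Real.exp_mul, mul_comm t a] at this
    refine (Real.log_le_log (by positivity) h3).trans ?_
    linarith [Real.log_le_sub_one_of_pos (by positivity : 0 < 1 + Real.exp (a * t))]
  have h4 : 0 ≤ Real.log (1 + Real.exp t) := Real.log_nonneg (by linarith)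
  have h5 : Real.log (1 + Real.exp t) ≤ 2 * Real.exp (a * t) := by nlinarith
  nlinarith

lemma pairRisk_slabMix_zero_le {r : ℝ} (hr : 0 < r) : ∃ C : ℝ, 0 ≤ C ∧ ∀ l : ℝ, 1 ≤ l →
    pairRisk r (slabMix l 1) (slabMix l (oracleVar r)) 0 ≤ C * (Real.exp (-l) * √l) := by
  refine ⟨2 * Real.exp (1 / 2) * √(4 * Real.pi), by positivity, fun l hl => ?_⟩
  have hv := oracleVar_pos hr
  have h := predictivePair_slabMix hr l
  have a1 : klTo (oracleVar r) (slabMix l (oracleVar r)) 0 ≤ 0 := by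
    have := klTo_le_of_atom hv h.posᵥ h.growthᵥ one_pos (t := 0)
      (fun u => by rw [one_mul]; exact le_add_of_nonneg_right (Real.exp_pos _).le) 0
    simpa using this
  set k := √(2 * Real.pi * 1)
  have hk : 1 ≤ k := by rw [Real.one_le_sqrt]; nlinarith [Real.pi_gt_three]
  set a := 1 - 1 / (2 * l) with ha
  have hl2 : 1 / (2 * l) ≤ 1 / 2 := by
    rw [div_le_div_iff₀ (by positivity) (by positivity)]; linarith
  have ha2 : 1 / 2 ≤ a := by linarith
  have ha1 : a ≤ 1 := by have : 0 ≤ 1 / (2 * l) := by positivity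
                         linarith
  have e1 : -klTo 1 (slabMix l 1) 0 =
      ∫ u, pdf 0 1 u * Real.log (1 + k * Real.exp (u ^ 2 / 2 - l)) := by
    rw [klTo, integral_gaussianReal_eq_integral_smul (by simp), ← integral_neg]
    refine integral_congr_ae (ae_of_all _ fun u => ?_)
    change -(pdf 0 1 u * Real.log (pdf 0 1 u / slabMix l 1 u)) = _
    rw [← mul_neg, ← Real.log_inv, inv_div]
    congr 2
    rw [slabMix, add_div, div_self (pdf_pos one_pos 0 u).ne', pdf_eq one_pos, Real.exp_sub,
      sub_zero, neg_div, Real.exp_neg, Real.exp_neg]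
    simp only [k]
    field_simp
  have hint : Integrable fun u : ℝ => Real.exp (-(1 / (4 * l)) * u ^ 2) :=
    integrable_exp_neg_mul_sq (by positivity)
  have e2 : ∫ u, pdf 0 1 u * Real.log (1 + k * Real.exp (u ^ 2 / 2 - l)) ≤
      ∫ u, 2 * Real.exp (1 / 2 - l) * Real.exp (-(1 / (4 * l)) * u ^ 2) := by
    refine integral_mono_of_nonneg (ae_of_all _ fun u => ?_) (hint.const_mul _)
      (ae_of_all _ fun u => ?_)
    · exact mul_nonneg (pdf_pos one_pos 0 u).le (Real.log_nonneg (by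
        have : 0 ≤ k * Real.exp (u ^ 2 / 2 - l) := by positivity
        linarith))
    · have := mul_le_mul_of_nonneg_left (log_one_add_mul_exp_le hk ha2 ha1 (u ^ 2 / 2 - l))
        (pdf_pos one_pos 0 u).le
      refine this.trans_eq ?_
      have hk' : k⁻¹ * k = 1 := inv_mul_cancel₀ (by positivity)
      calc pdf 0 1 u * (2 * k * Real.exp (a * (u ^ 2 / 2 - l)))
          = (k⁻¹ * k) * (2 * (Real.exp (-(u - 0) ^ 2 / (2 * 1)) *
              Real.exp (a * (u ^ 2 / 2 - l)))) := by rw [pdf_eq one_pos]; ring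
        _ = 2 * Real.exp (1 / 2 - l + -(1 / (4 * l)) * u ^ 2) := by
          rw [hk', one_mul, ← Real.exp_add]
          congr 2
          rw [ha]
          field_simp
          ring
        _ = _ := by rw [Real.exp_add]; exact (mul_assoc _ _ _).symm
  rw [integral_const_mul, integral_gaussian, Real.exp_sub, div_eq_mul_inv, ← Real.exp_neg] at e2
  have e3 : √(Real.pi / (1 / (4 * l))) = √(4 * Real.pi) * √l := by
    rw [← Real.sqrt_mul (by positivity)]
    congr 1; field_simp
  rw [e3] at e2
  rw [pairRisk]
  linarith

lemma predMinimaxRisk_le {r : ℝ} (hr : 0 < r) : ∃ C : ℝ, 0 ≤ C ∧ ∀ l : ℝ, 1 ≤ l → ∀ n s : ℕ,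
    predMinimaxRisk r (sparseSet n s) ≤
      ENNReal.ofReal (s * ((1 - oracleVar r) * l + C * √l) + n * (C * (Real.exp (-l) * √l))) := by
  obtain ⟨C₁, hC₁, h1⟩ := pairRisk_slabMix_le hr
  obtain ⟨C₂, hC₂, h2⟩ := pairRisk_slabMix_zero_le hr
  refine ⟨2 * C₁ + C₂, by positivity, fun l hl n s => ?_⟩
  have h := predictivePair_slabMix hr l
  have hv1 := oracleVar_lt_one hr
  refine (iInf₂_le _ (h.isPredictiveDensity (n := n))).trans (iSup₂_le fun θ hθ => ?_)
  rw [(h.predRisk_eq hr θ).1]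
  refine ENNReal.ofReal_le_ofReal ?_
  have hsl : 1 ≤ √l := Real.one_le_sqrt.2 hl
  set M := (1 - oracleVar r) * l + (2 * C₁ + C₂) * √l
  set N := (2 * C₁ + C₂) * (Real.exp (-l) * √l)
  have hM : 0 ≤ M := add_nonneg (mul_nonneg (by linarith) (by linarith)) (by positivity)
  have hN : 0 ≤ N := by positivity
  have key : ∀ i, pairRisk r (slabMix l 1) (slabMix l (oracleVar r)) (θ i) ≤
      (if θ i ≠ 0 then M else 0) + N := by
    intro i
    split_ifs with hi
    · refine (h1 l (by linarith) (θ i)).trans ?_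
      have : C₁ * (1 + √l) ≤ (2 * C₁ + C₂) * √l := by nlinarith
      linarith
    · rw [not_ne_iff.1 hi, zero_add]
      refine (h2 l hl).trans ?_
      have : 0 ≤ Real.exp (-l) * √l := by positivity
      nlinarith
  have hcard : ((Finset.univ.filter fun i => θ i ≠ 0).card : ℝ) ≤ s := by
    have := hθ
    rw [sparseSet, Set.mem_ofPred_eq, Set.ncard_eq_toFinset_card'] at this
    simpa using this
  calc _ ≤ ∑ i, ((if θ i ≠ 0 then M else 0) + N) := Finset.sum_le_sum fun i _ => key i
    _ = (Finset.univ.filter fun i => θ i ≠ 0).card * M + n * N := by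
      rw [Finset.sum_add_distrib, ← Finset.sum_filter]; simp
    _ ≤ s * M + n * N := by gcongr

/-! ### The lower bound for the minimax risk -/

section
variable {s m n : ℕ} (e : Fin s × Fin m ↪ Fin n) (μ : ℝ)

/-- The parameter with the value `μ` at one coordinate `e (b, I b)` of each of the `s` blocks, and
`0` elsewhere. -/
noncomputable def spikeParam (I : Fin s → Fin m) : Fin n → ℝ :=
  Function.extend e (fun q => if q.2 = I q.1 then μ else 0) 0

/-- The uniform prior on the parameters with one spike per block. -/
noncomputable def spikePrior : Measure (Fin n → ℝ) :=
  ((m : ℝ≥0∞) ^ s)⁻¹ • ∑ I : Fin s → Fin m, Measure.dirac (spikeParam e μ I)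

variable {e μ}

lemma spikeParam_apply (I : Fin s → Fin m) (q : Fin s × Fin m) :
    spikeParam e μ I (e q) = if q.2 = I q.1 then μ else 0 :=
  e.injective.extend_apply _ _ _

lemma spikeParam_of_notMem (I : Fin s → Fin m) {i : Fin n} (hi : i ∉ Set.range e) :
    spikeParam e μ I i = 0 :=
  Function.extend_apply' _ _ _ (by simpa using hi)

lemma spikeParam_mem (I : Fin s → Fin m) : spikeParam e μ I ∈ sparseSet n s := by
  have hsub : {i | spikeParam e μ I i ≠ 0} ⊆ Set.range fun b => e (b, I b) := by
    intro i hi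
    by_cases h : i ∈ Set.range e
    · obtain ⟨⟨b, j⟩, rfl⟩ := h
      have hi' : spikeParam e μ I (e (b, j)) ≠ 0 := hi
      rw [spikeParam_apply] at hi'
      have : j = I b := by by_contra hne; simp [hne] at hi'
      exact ⟨b, by rw [this]⟩
    · exact absurd (spikeParam_of_notMem I h) hi
  have h1 := Set.ncard_le_ncard hsub (Set.finite_range _)
  have h2 : (Set.range fun b => e (b, I b)).ncard ≤ s := by
    rw [← Set.image_univ]
    refine (Set.ncard_image_le Set.finite_univ).trans ?_
    simp [Set.ncard_univ]
  change ((_ : ℕ) : ℝ) ≤ _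
  exact_mod_cast h1.trans h2

lemma sum_spikeParam (I : Fin s → Fin m) (F : Fin n → ℝ → ℝ) (h0 : ∀ i, F i 0 = 0) :
    ∑ i, F i (spikeParam e μ I i) = ∑ b, F (e (b, I b)) μ := by
  have h1 : ∑ q : Fin s × Fin m, F (e q) (spikeParam e μ I (e q)) =
      ∑ i, F i (spikeParam e μ I i) :=
    Fintype.sum_of_injective e e.injective _ _
      (fun i hi => by rw [spikeParam_of_notMem I hi, h0]) fun _ => rfl
  rw [← h1, Fintype.sum_prod_type]
  refine Finset.sum_congr rfl fun b _ => ?_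
  rw [Finset.sum_eq_single (I b) _ (by simp)]
  · rw [spikeParam_apply, if_pos rfl]
  · intro j _ hj
    rw [spikeParam_apply, if_neg hj, h0]

lemma lintegral_spikePrior (f : (Fin n → ℝ) → ℝ≥0∞) :
    ∫⁻ θ, f θ ∂spikePrior e μ = ((m : ℝ≥0∞) ^ s)⁻¹ * ∑ I, f (spikeParam e μ I) := by
  rw [spikePrior, lintegral_smul_measure, lintegral_finsetSum_measure]
  simp

lemma isProbabilityMeasure_spikePrior (hm : m ≠ 0) : IsProbabilityMeasure (spikePrior e μ) := by
  constructor
  rw [← lintegral_one, lintegral_spikePrior]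
  simp only [Finset.sum_const, Finset.card_univ, Fintype.card_pi, Fintype.card_fin,
    Finset.prod_const, nsmul_eq_mul, mul_one, Nat.cast_pow]
  exact ENNReal.inv_mul_cancel (by simp [hm]) (by simp)

lemma lintegral_spikePrior_le (hm : m ≠ 0) {f : (Fin n → ℝ) → ℝ≥0∞} {c : ℝ≥0∞}
    (h : ∀ I, f (spikeParam e μ I) ≤ c) : ∫⁻ θ, f θ ∂spikePrior e μ ≤ c := by
  have := isProbabilityMeasure_spikePrior (e := e) (μ := μ) hm
  calc ∫⁻ θ, f θ ∂spikePrior e μ ≤ ∫⁻ _, c ∂spikePrior e μ := by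
        rw [lintegral_spikePrior, lintegral_spikePrior]
        gcongr with I
        exact h I
    _ = c := by simp

lemma le_lintegral_spikePrior (hm : m ≠ 0) {f : (Fin n → ℝ) → ℝ≥0∞} {c : ℝ≥0∞}
    (h : ∀ I, c ≤ f (spikeParam e μ I)) : c ≤ ∫⁻ θ, f θ ∂spikePrior e μ := by
  have := isProbabilityMeasure_spikePrior (e := e) (μ := μ) hm
  calc c = ∫⁻ _, c ∂spikePrior e μ := by simp
    _ ≤ ∫⁻ θ, f θ ∂spikePrior e μ := by
        rw [lintegral_spikePrior, lintegral_spikePrior]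
        gcongr with I
        exact h I

end

/-- The penalty which dominates the logarithm of the normalized likelihood ratio of a block, split
over the coordinates: at the spike it bounds `log (1 + A)`, elsewhere `log (1 + B) ≤ B`. -/
noncomputable def spikePenalty (v μ : ℝ) (m : ℕ) (t u : ℝ) : ℝ :=
  if t ≠ 0 then 1 + μ / v * |u - μ| else (m : ℝ)⁻¹ * Real.exp ((μ * u - μ ^ 2 / 2) / v)

section
variable {v μ : ℝ} {m : ℕ}

lemma spikePenalty_nonneg (hv : 0 < v) (hμ : 0 ≤ μ) (t u : ℝ) : 0 ≤ spikePenalty v μ m t u := by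
  unfold spikePenalty
  split_ifs <;> positivity

lemma measurable_spikePenalty : Measurable fun q : ℝ × ℝ => spikePenalty v μ m q.1 q.2 := by
  unfold spikePenalty
  refine Measurable.ite ?_ (by fun_prop) (by fun_prop)
  exact (measurableSet_singleton (0 : ℝ)).compl.preimage measurable_fst

lemma hasExpGrowth_lin (t c : ℝ) : HasExpGrowth fun u => (t * u - t ^ 2 / 2) / c := by
  convert ((HasExpGrowth.id.const_mul t).sub (HasExpGrowth.const (t ^ 2 / 2))).const_mul c⁻¹
    using 2 with u
  rw [div_eq_inv_mul]

lemma hasExpGrowth_spikePenalty (t : ℝ) : HasExpGrowth (spikePenalty v μ m t) := by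
  unfold spikePenalty
  by_cases ht : t = 0
  · simp only [ht, ne_eq, not_true_eq_false, if_false]
    convert ((HasExpGrowth.exp_mul (μ / v)).const_mul (Real.exp (-(μ ^ 2 / 2) / v))).const_mul
      (m : ℝ)⁻¹ using 3 with u
    rw [← Real.exp_add]
    congr 1; ring
  · simp only [ne_eq, ht, not_false_eq_true, if_true]
    exact (HasExpGrowth.const 1).add ((hasExpGrowth_sub μ).abs.const_mul _)

lemma integral_lin (t c : ℝ) :
    ∫ u, (t * u - t ^ 2 / 2) / c ∂gaussianReal t v.toNNReal = t ^ 2 / (2 * c) := by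
  rw [integral_div, integral_sub ((HasExpGrowth.id.const_mul t).integrable _ _)
    (integrable_const _), integral_const_mul, integral_id_gaussianReal]
  simp
  ring

lemma integral_spikePenalty_le (hv : 0 < v) (hμ : 0 < μ) :
    ∫ u, spikePenalty v μ m μ u ∂gaussianReal μ v.toNNReal ≤ 1 + μ / v * ((v + 1) / 2) := by
  simp only [spikePenalty, ne_eq, hμ.ne', not_false_eq_true, if_true]
  rw [integral_add (integrable_const _)
    (((hasExpGrowth_sub μ).abs.integrable _ _).const_mul _), integral_const_mul]
  have := mul_le_mul_of_nonneg_left (integral_abs_sub_mean_le μ hv) (by positivity : 0 ≤ μ / v)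
  simpa using this

lemma integral_spikePenalty_zero (hv : 0 < v) :
    ∫ u, spikePenalty v μ m 0 u ∂gaussianReal 0 v.toNNReal = (m : ℝ)⁻¹ := by
  simp only [spikePenalty, ne_eq, not_true_eq_false, if_false]
  have h : ∀ u : ℝ, Real.exp ((μ * u - μ ^ 2 / 2) / v) =
      Real.exp (-(μ ^ 2 / 2) / v) * Real.exp (μ / v * u) := fun u => by
    rw [← Real.exp_add]; congr 1; ring
  simp_rw [h]
  rw [integral_const_mul, integral_const_mul]
  have := congrFun (mgf_fun_id_gaussianReal (μ := 0) (v := v.toNNReal)) (μ / v)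
  rw [mgf] at this
  rw [this, ← Real.exp_add, Real.coe_toNNReal _ hv.le]
  have : -(μ ^ 2 / 2) / v + (0 * (μ / v) + v * (μ / v) ^ 2 / 2) = 0 := by field_simp; ring
  rw [this, Real.exp_zero, mul_one]

/-- In one block, the average of the likelihood ratios is at most the exponential of the total
penalty, wherever the spike is. -/
lemma block_average_le (hv : 0 < v) (hμ : 0 < μ) (hm : m ≠ 0) (hl : μ ^ 2 = 2 * v * Real.log m)
    (u : Fin m → ℝ) (j : Fin m) :
    (m : ℝ)⁻¹ * ∑ i, Real.exp ((μ * u i - μ ^ 2 / 2) / v) ≤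
      Real.exp (∑ i, spikePenalty v μ m (if i = j then μ else 0) (u i)) := by
  have hm' : (0 : ℝ) < m := by positivity
  set L : Fin m → ℝ := fun i => Real.exp ((μ * u i - μ ^ 2 / 2) / v) with hL
  have hL0 : ∀ i, 0 < L i := fun i => Real.exp_pos _
  set B := ∑ i ∈ Finset.univ.erase j, (m : ℝ)⁻¹ * L i
  have hB : 0 ≤ B := Finset.sum_nonneg fun i _ => by have := hL0 i; positivity
  have h1 : (m : ℝ)⁻¹ * ∑ i, L i = (m : ℝ)⁻¹ * L j + B := by
    rw [Finset.mul_sum, ← Finset.add_sum_erase _ _ (Finset.mem_univ j)]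
  have h2 : ∑ i, spikePenalty v μ m (if i = j then μ else 0) (u i) =
      (1 + μ / v * |u j - μ|) + B := by
    rw [← Finset.add_sum_erase _ _ (Finset.mem_univ j)]
    congr 1
    · simp [spikePenalty, hμ.ne']
    · refine Finset.sum_congr rfl fun i hi => ?_
      simp [spikePenalty, Finset.ne_of_mem_erase hi, hL]
  have h3 : (m : ℝ)⁻¹ * L j ≤ Real.exp (μ / v * |u j - μ|) := by
    have : (m : ℝ)⁻¹ = Real.exp (-(μ ^ 2 / (2 * v))) := by
      rw [hl, mul_div_cancel_left₀ _ (by positivity), Real.exp_neg, Real.exp_log hm']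
    rw [this, hL, ← Real.exp_add, Real.exp_le_exp]
    have e : -(μ ^ 2 / (2 * v)) + (μ * u j - μ ^ 2 / 2) / v = μ / v * (u j - μ) := by
      field_simp; ring
    rw [e]
    exact mul_le_mul_of_nonneg_left (le_abs_self _) (by positivity)
  have h4 : 1 ≤ Real.exp (μ / v * |u j - μ|) := Real.one_le_exp (by positivity)
  have h5 : (2 : ℝ) ≤ Real.exp 1 := by linarith [Real.add_one_le_exp (1 : ℝ)]
  have h6 : B + 1 ≤ Real.exp B := Real.add_one_le_exp B
  have h7 : 0 < (m : ℝ)⁻¹ * L j := by have := hL0 j; positivity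
  rw [h1, h2, Real.exp_add, Real.exp_add]
  have h8 : 1 + (m : ℝ)⁻¹ * L j ≤ Real.exp 1 * Real.exp (μ / v * |u j - μ|) := by nlinarith
  nlinarith

end

lemma average_prod_eq_one {s m : ℕ} (hm : m ≠ 0) (L : Fin s → Fin m → ℝ) (hL : ∀ b i, 0 < L b i) :
    ((m : ℝ) ^ s)⁻¹ * ∑ I : Fin s → Fin m, ∏ b, (L b (I b) / ((m : ℝ)⁻¹ * ∑ i, L b i)) = 1 := by
  have hm' : (0 : ℝ) < m := by positivity
  have : Nonempty (Fin m) := ⟨⟨0, Nat.pos_of_ne_zero hm⟩⟩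
  have h1 : ∑ I : Fin s → Fin m, ∏ b, (L b (I b) / ((m : ℝ)⁻¹ * ∑ i, L b i)) =
      ∏ b : Fin s, ∑ j, (L b j / ((m : ℝ)⁻¹ * ∑ i, L b i)) := by
    rw [Finset.prod_univ_sum, Fintype.piFinset_univ]
  have h2 : ∀ b, ∑ j, (L b j / ((m : ℝ)⁻¹ * ∑ i, L b i)) = m := by
    intro b
    have : 0 < ∑ i, L b i := Finset.sum_pos (fun i _ => hL b i) Finset.univ_nonempty
    rw [← Finset.sum_div]
    field_simp
  rw [h1, Finset.prod_congr rfl fun b _ => h2 b]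
  simp only [Finset.prod_const, Finset.card_univ, Fintype.card_fin]
  exact inv_mul_cancel₀ (by positivity)

lemma normalDensity_eq_mul_exp {n : ℕ} (θ x : Fin n → ℝ) :
    normalDensity θ 1 x = normalDensity 0 1 x *
      ENNReal.ofReal (Real.exp (∑ i, (θ i * x i - θ i ^ 2 / 2) / 1)) := by
  rw [Real.exp_sum, ENNReal.ofReal_prod_of_nonneg fun i _ => (Real.exp_pos _).le, normalDensity,
    normalDensity, ← Finset.prod_mul_distrib]
  refine Finset.prod_congr rfl fun i _ => ?_
  rw [gaussianPDF, gaussianPDF, ← ENNReal.ofReal_mul (gaussianPDFReal_nonneg _ _ _)]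
  congr 1
  change pdf (θ i) 1 (x i) = pdf 0 1 (x i) * _
  rw [pdf_eq one_pos, pdf_eq one_pos, mul_assoc _ (Real.exp _), ← Real.exp_add]
  congr 2
  ring

/-- The Bayes risk of the uniform prior on parameters with one spike in each of `s` blocks of length
`m` bounds the minimax risk from below. -/
lemma le_predMinimaxRisk_of_blocks {r : ℝ} (hr : 0 < r) {s m n : ℕ} (hm : 2 ≤ m)
    (e : Fin s × Fin m ↪ Fin n) {μ : ℝ} (hμ : 0 < μ)
    (hl : μ ^ 2 = 2 * oracleVar r * Real.log m) :
    ENNReal.ofReal (s * (μ ^ 2 / (2 * r) - (1 + μ / oracleVar r * ((oracleVar r + 1) / 2))) -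
      n * (m : ℝ)⁻¹) ≤ predMinimaxRisk r (sparseSet n s) := by
  have hv := oracleVar_pos hr
  have hm0 : m ≠ 0 := by omega
  have hm' : (0 : ℝ) < m := by positivity
  set v := oracleVar r
  set κ := μ ^ 2 / (2 * r) - (1 + μ / v * ((v + 1) / 2)) with hκ
  set H := s * κ - n * (m : ℝ)⁻¹
  have := isProbabilityMeasure_spikePrior (e := e) (μ := μ) hm0
  let A : ℝ → ℝ → ℝ := fun t u => (t * u - t ^ 2 / 2) / v - spikePenalty v μ m t u
  let B : ℝ → ℝ → ℝ := fun t u => (t * u - t ^ 2 / 2) / 1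
  have hA : ∀ t, HasExpGrowth (A t) := fun t =>
    (hasExpGrowth_lin t v).sub (hasExpGrowth_spikePenalty t)
  have hB : ∀ t, HasExpGrowth (B t) := fun t => hasExpGrowth_lin t 1
  have hsum := fun θ : Fin n → ℝ => integral_sum_stat hr θ (A := fun i => A (θ i))
    (B := fun i => B (θ i)) (fun i => hA (θ i)) (fun i => hB (θ i))
  have hAm : Measurable fun q : ℝ × ℝ => A q.1 q.2 :=
    (by fun_prop : Measurable fun q : ℝ × ℝ => (q.1 * q.2 - q.1 ^ 2 / 2) / v).sub
      measurable_spikePenalty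
  have hBm : Measurable fun q : ℝ × ℝ => B q.1 q.2 := by fun_prop
  let h : (Fin n → ℝ) → (Fin n → ℝ) → (Fin n → ℝ) → ℝ := fun θ x y =>
    ∑ i, (A (θ i) (stat r (x i) (y i)) - B (θ i) (x i))
  have hmeas : Measurable fun q : (Fin n → ℝ) × (Fin n → ℝ) × (Fin n → ℝ) =>
      h q.1 q.2.1 q.2.2 := by
    refine Finset.measurable_sum _ fun i _ => ?_
    have h1 : Measurable fun q : (Fin n → ℝ) × (Fin n → ℝ) × (Fin n → ℝ) =>
        (q.1 i, stat r (q.2.1 i) (q.2.2 i)) := by unfold stat; fun_prop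
    have h2 : Measurable fun q : (Fin n → ℝ) × (Fin n → ℝ) × (Fin n → ℝ) =>
        (q.1 i, q.2.1 i) := by fun_prop
    exact (hAm.comp h1).sub (hBm.comp h2)
  have hg : ∫⁻ x, normalDensity (0 : Fin n → ℝ) 1 x ≤ 1 := by
    have : (normalLaw (0 : Fin n → ℝ) 1) Set.univ = 1 := measure_univ
    rw [normalLaw_eq_withDensity _ one_pos, withDensity_apply _ MeasurableSet.univ,
      Measure.restrict_univ] at this
    exact this.le
  -- the mean of the exponent at every parameter of the prior
  have hH : ∀ I : Fin s → Fin m, H ≤ ∫ x, ∫ y, h (spikeParam e μ I) x y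
      ∂normalLaw (spikeParam e μ I) r ∂normalLaw (spikeParam e μ I) 1 := by
    intro I
    rw [(hsum (spikeParam e μ I)).2.2]
    have h1 : ∀ i, (if spikeParam e μ I i ≠ 0 then κ else 0) - (m : ℝ)⁻¹ ≤
        ∫ u, A (spikeParam e μ I i) u ∂gaussianReal (spikeParam e μ I i) v.toNNReal -
        ∫ u, B (spikeParam e μ I i) u ∂gaussianReal (spikeParam e μ I i) (1 : ℝ).toNNReal := by
      intro i
      have h3 : ∀ t, ∫ u, A t u ∂gaussianReal t v.toNNReal =
          t ^ 2 / (2 * v) - ∫ u, spikePenalty v μ m t u ∂gaussianReal t v.toNNReal := by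
        intro t
        rw [← integral_lin t v]
        exact integral_sub ((hasExpGrowth_lin t v).integrable _ _)
          ((hasExpGrowth_spikePenalty t).integrable _ _)
      rw [h3, integral_lin]
      have h4 : spikeParam e μ I i = μ ∨ spikeParam e μ I i = 0 := by
        by_cases hi : i ∈ Set.range e
        · obtain ⟨q, rfl⟩ := hi
          rw [spikeParam_apply]
          split_ifs
          · exact Or.inl rfl
          · exact Or.inr rfl
        · exact Or.inr (spikeParam_of_notMem I hi)
      rcases h4 with h4 | h4 <;> rw [h4]
      · rw [if_pos hμ.ne', hκ]
        have h5 := integral_spikePenalty_le (m := m) hv hμ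
        have h6 : μ ^ 2 / (2 * v) - μ ^ 2 / (2 * 1) = μ ^ 2 / (2 * r) := by
          rw [show v = r / (1 + r) from oracleVar_eq hr]; field_simp; ring
        have : 0 < (m : ℝ)⁻¹ := by positivity
        linarith
      · rw [integral_spikePenalty_zero hv]; simp
    refine le_trans (le_of_eq ?_) (Finset.sum_le_sum fun i _ => h1 i)
    rw [Finset.sum_sub_distrib, sum_spikeParam I (fun _ t => if t ≠ 0 then κ else 0) (by simp)]
    simp [hμ.ne', H]
  have hle : ∀ x y : Fin n → ℝ, ∫⁻ θ, ENNReal.ofReal (Real.exp (h θ x y)) * normalDensity θ 1 x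
      ∂spikePrior e μ ≤ normalDensity 0 1 x := by
    intro x y
    set w : Fin n → ℝ := fun i => stat r (x i) (y i) with hw
    set L : Fin s → Fin m → ℝ := fun b i => Real.exp ((μ * w (e (b, i)) - μ ^ 2 / 2) / v)
    have hL : ∀ b i, 0 < L b i := fun b i => Real.exp_pos _
    have : Nonempty (Fin m) := ⟨⟨0, Nat.pos_of_ne_zero hm0⟩⟩
    have hZ : ∀ b, 0 < (m : ℝ)⁻¹ * ∑ i, L b i := fun b => mul_pos (by positivity)
      (Finset.sum_pos (fun i _ => hL b i) Finset.univ_nonempty)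
    have hterm : ∀ I : Fin s → Fin m, ENNReal.ofReal (Real.exp (h (spikeParam e μ I) x y)) *
        normalDensity (spikeParam e μ I) 1 x ≤ normalDensity 0 1 x *
          ENNReal.ofReal (∏ b, (L b (I b) / ((m : ℝ)⁻¹ * ∑ i, L b i))) := by
      intro I
      set θ := spikeParam e μ I with hθ
      rw [normalDensity_eq_mul_exp θ, mul_left_comm, ← ENNReal.ofReal_mul (Real.exp_pos _).le,
        ← Real.exp_add]
      refine mul_le_mul_right (ENNReal.ofReal_le_ofReal ?_) _
      have e1 : h θ x y + ∑ i, (θ i * x i - θ i ^ 2 / 2) / 1 =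
          ∑ i, (θ i * w i - θ i ^ 2 / 2) / v - ∑ i, spikePenalty v μ m (θ i) (w i) := by
        rw [← Finset.sum_add_distrib, ← Finset.sum_sub_distrib]
        exact Finset.sum_congr rfl fun i _ => by simp only [A, B, hw]; ring
      have e2 : ∑ i, (θ i * w i - θ i ^ 2 / 2) / v =
          ∑ b, (μ * w (e (b, I b)) - μ ^ 2 / 2) / v :=
        sum_spikeParam I (fun i t => (t * w i - t ^ 2 / 2) / v) (by simp)
      have e3 : ∑ b, ∑ i, spikePenalty v μ m (if i = I b then μ else 0) (w (e (b, i))) ≤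
          ∑ i, spikePenalty v μ m (θ i) (w i) := by
        rw [← Fintype.sum_prod_type']
        calc _ = ∑ q : Fin s × Fin m, spikePenalty v μ m (θ (e q)) (w (e q)) := by
              refine Finset.sum_congr rfl fun q _ => ?_
              rw [hθ, spikeParam_apply]
          _ = ∑ i ∈ Finset.univ.map e, spikePenalty v μ m (θ i) (w i) := by
              rw [Finset.sum_map]
          _ ≤ _ := Finset.sum_le_univ_sum_of_nonneg fun i => spikePenalty_nonneg hv hμ.le _ _
      rw [e1, e2, Real.exp_sub, Real.exp_sum, Finset.prod_div_distrib]
      refine div_le_div_of_nonneg_left (Finset.prod_nonneg fun b _ => (Real.exp_pos _).le)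
        (Finset.prod_pos fun b _ => hZ b) ?_
      calc ∏ b, ((m : ℝ)⁻¹ * ∑ i, L b i)
          ≤ ∏ b, Real.exp (∑ i, spikePenalty v μ m (if i = I b then μ else 0) (w (e (b, i)))) :=
            Finset.prod_le_prod (fun b _ => (hZ b).le) fun b _ =>
              block_average_le hv hμ hm0 hl (fun i => w (e (b, i))) (I b)
        _ ≤ _ := by
            rw [← Real.exp_sum]
            exact Real.exp_le_exp.2 e3
    rw [lintegral_spikePrior]
    calc _ ≤ ((m : ℝ≥0∞) ^ s)⁻¹ * ∑ I : Fin s → Fin m, normalDensity 0 1 x *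
          ENNReal.ofReal (∏ b, (L b (I b) / ((m : ℝ)⁻¹ * ∑ i, L b i))) := by
          exact mul_le_mul_right (Finset.sum_le_sum fun I _ => hterm I) _
      _ = normalDensity 0 1 x * ENNReal.ofReal (((m : ℝ) ^ s)⁻¹ *
            ∑ I : Fin s → Fin m, ∏ b, (L b (I b) / ((m : ℝ)⁻¹ * ∑ i, L b i))) := by
          rw [← Finset.mul_sum, ENNReal.ofReal_mul (by positivity),
            ENNReal.ofReal_inv_of_pos (by positivity), ENNReal.ofReal_pow hm'.le,
            ENNReal.ofReal_natCast, ENNReal.ofReal_sum_of_nonneg fun I _ =>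
              Finset.prod_nonneg fun b _ => (div_pos (hL b _) (hZ b)).le]
          ring
      _ = normalDensity 0 1 x := by
          rw [average_prod_eq_one hm0 L hL]; simp
  refine le_iInf₂ fun p hp => ?_
  have key := lintegral_le_lintegral_predRisk_add_one (spikePrior e μ) hp h hmeas
    (fun θ => (hsum θ).1) (fun θ => (hsum θ).2.1) _ hg hle
  have h1 : ENNReal.ofReal (H + 1) ≤ (⨆ θ ∈ sparseSet n s, predRisk r θ p) + 1 := by
    refine (le_lintegral_spikePrior (e := e) (μ := μ) hm0 fun I => ?_).trans (key.trans ?_)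
    · exact ENNReal.ofReal_le_ofReal (add_le_add_left (hH I) 1)
    · gcongr
      exact lintegral_spikePrior_le hm0 fun I =>
        le_iSup₂_of_le (spikeParam e μ I) (spikeParam_mem I) le_rfl
  rcases le_total H 0 with h0 | h0
  · rw [ENNReal.ofReal_of_nonpos h0]; exact zero_le
  · rw [ENNReal.ofReal_add h0 zero_le_one, ENNReal.ofReal_one] at h1
    exact (ENNReal.add_le_add_iff_right ENNReal.one_ne_top).1 h1

/-! ### The first order of the minimax risk -/

lemma oracleVar_div {r : ℝ} (hr : 0 < r) : oracleVar r / r = 1 - oracleVar r := by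
  rw [oracleVar_eq hr]; field_simp; ring

/-- The minimax risk over `Θ₀[s]` is `s (1 - v) log (n / s)`, up to terms of the order of
`s √(log (n / s))`. -/
lemma predMinimaxRisk_bounds {r : ℝ} (hr : 0 < r) : ∃ C : ℝ, 0 ≤ C ∧ ∀ n s : ℕ, 1 ≤ s →
    1 ≤ Real.log ((s : ℝ) / n)⁻¹ →
    ENNReal.ofReal (s * ((1 - oracleVar r) * Real.log ((s : ℝ) / n)⁻¹ -
      C * √(Real.log ((s : ℝ) / n)⁻¹))) ≤ predMinimaxRisk r (sparseSet n s) ∧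
    predMinimaxRisk r (sparseSet n s) ≤
      ENNReal.ofReal (s * ((1 - oracleVar r) * Real.log ((s : ℝ) / n)⁻¹ +
        C * √(Real.log ((s : ℝ) / n)⁻¹))) := by
  obtain ⟨C, hC, hup⟩ := predMinimaxRisk_le hr
  have hv := oracleVar_pos hr
  have hv1 := oracleVar_lt_one hr
  set v := oracleVar r
  refine ⟨max (2 * C) (4 + 2 / v), by positivity, fun n s hs hl => ?_⟩
  have hs' : (0 : ℝ) < s := by positivity
  have hn : n ≠ 0 := by
    rintro rfl
    simp at hl
    linarith
  have hn' : (0 : ℝ) < n := by positivity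
  set l := Real.log ((s : ℝ) / n)⁻¹ with hldef
  have hsl : 1 ≤ √l := Real.one_le_sqrt.2 hl
  have hexp : Real.exp (-l) = s / n := by
    rw [hldef, Real.log_inv, neg_neg, Real.exp_log (by positivity)]
  have hexp' : Real.exp l = n / s := by
    rw [hldef, Real.exp_log (by positivity), inv_div]
  constructor
  · have h2 : 2 * (s : ℝ) ≤ n := by
      have : (2 : ℝ) ≤ n / s := by
        rw [← hexp']; linarith [Real.add_one_le_exp l]
      rwa [le_div_iff₀ hs'] at this
    have h2n : 2 * s ≤ n := by exact_mod_cast h2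
    have hm2 : 2 ≤ n / s := (Nat.le_div_iff_mul_le (by omega)).2 h2n
    have hmn : s * (n / s) ≤ n := Nat.mul_div_le n s
    set m := n / s with hm
    have hm' : (0 : ℝ) < m := by positivity
    have hm1 : (n : ℝ) / s ≤ 2 * m := by
      have h3 : n < s * (m + 1) := Nat.lt_mul_div_succ n (by omega)
      have h4 : n ≤ s * (2 * m) := h3.le.trans (Nat.mul_le_mul_left s (by omega))
      rw [div_le_iff₀ hs', mul_comm]
      exact_mod_cast h4
    have hm3 : (m : ℝ) ≤ n / s := by
      rw [le_div_iff₀ hs', mul_comm]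
      exact_mod_cast hmn
    have hlog1 : Real.log m ≤ l := by
      rw [← Real.log_exp l, hexp']; exact Real.log_le_log hm' hm3
    have hlog2 : l - 1 ≤ Real.log m := by
      have := Real.log_le_log (by positivity) hm1
      rw [← hexp', Real.log_exp, Real.log_mul two_ne_zero hm'.ne'] at this
      linarith [Real.log_two_lt_d9]
    have hlog0 : 0 < Real.log m := Real.log_pos (by exact_mod_cast hm2)
    set μ := √(2 * v * Real.log m) with hμ
    have hμ0 : 0 < μ := Real.sqrt_pos.2 (by positivity)
    have hμ2 : μ ^ 2 = 2 * v * Real.log m := Real.sq_sqrt (by positivity)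
    have hμl : μ ≤ 2 * √l := by
      rw [hμ, Real.sqrt_le_left (by positivity), mul_pow, Real.sq_sqrt (by linarith)]
      nlinarith
    let e : Fin s × Fin m ↪ Fin n :=
      finProdFinEquiv.toEmbedding.trans (Fin.castLEEmb hmn)
    refine le_trans (ENNReal.ofReal_le_ofReal ?_) (le_predMinimaxRisk_of_blocks hr hm2 e hμ0 hμ2)
    change _ ≤ s * (μ ^ 2 / (2 * r) - (1 + μ / v * ((v + 1) / 2))) - n * (m : ℝ)⁻¹
    have e1 : μ ^ 2 / (2 * r) = (1 - v) * Real.log m := by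
      rw [hμ2, ← oracleVar_div hr]; field_simp; rfl
    have e2 : n * (m : ℝ)⁻¹ ≤ s * 2 := by
      rw [div_le_iff₀ hs'] at hm1
      rw [← div_eq_mul_inv, div_le_iff₀ hm']; linarith
    have e3 : μ / v * ((v + 1) / 2) ≤ 2 / v * √l := by
      have : μ / v * ((v + 1) / 2) ≤ (2 * √l) / v * 1 := by gcongr; linarith
      refine this.trans_eq ?_
      ring
    have e4 : (4 + 2 / v) * √l ≤ max (2 * C) (4 + 2 / v) * √l := by
      gcongr; exact le_max_right _ _
    have e5 : (1 - v) * l - max (2 * C) (4 + 2 / v) * √l ≤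
        μ ^ 2 / (2 * r) - (1 + μ / v * ((v + 1) / 2)) - 2 := by
      rw [e1]
      nlinarith
    have := mul_le_mul_of_nonneg_left e5 hs'.le
    linarith
  · refine (hup l hl n s).trans (ENNReal.ofReal_le_ofReal ?_)
    have e1 : (n : ℝ) * (C * (Real.exp (-l) * √l)) = s * (C * √l) := by
      rw [hexp]; field_simp
    have e2 : 2 * C * √l ≤ max (2 * C) (4 + 2 / v) * √l := by
      gcongr; exact le_max_left _ _
    have := mul_le_mul_of_nonneg_left e2 hs'.le
    rw [e1]
    change s * ((1 - v) * l + C * √l) + s * (C * √l) ≤ _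
    linarith

/-! ### The cluster prior -/

lemma sq_lamE {η : ℝ} (h0 : 0 < η) (h1 : η < 1) : lamE η ^ 2 = 2 * Real.log η⁻¹ :=
  Real.sq_sqrt (by have := Real.log_nonneg ((one_le_inv₀ h0).2 h1.le); positivity)

lemma lamE_nonneg (η : ℝ) : 0 ≤ lamE η := Real.sqrt_nonneg _

lemma lamF_nonneg (r η : ℝ) : 0 ≤ lamF r η := Real.sqrt_nonneg _

lemma lamF_eq {r η : ℝ} (h0 : 0 < η) : lamF r η = √(2 * oracleVar r * Real.log η⁻¹) := by
  rw [lamF, Real.log_rpow h0, Real.log_inv]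
  congr 1; ring

lemma sq_lamF {r η : ℝ} (hr : 0 < r) (h0 : 0 < η) (h1 : η < 1) :
    lamF r η ^ 2 = 2 * oracleVar r * Real.log η⁻¹ := by
  have := Real.log_nonneg ((one_le_inv₀ h0).2 h1.le)
  have := oracleVar_pos hr
  rw [lamF_eq h0, Real.sq_sqrt (by positivity)]

lemma lamF_le_lamE {r η : ℝ} (hr : 0 < r) (h0 : 0 < η) (h1 : η < 1) : lamF r η ≤ lamE η := by
  have := Real.log_nonneg ((one_le_inv₀ h0).2 h1.le)
  have := oracleVar_lt_one hr
  rw [← sq_le_sq₀ (lamF_nonneg r η) (lamE_nonneg η), sq_lamF hr h0 h1, sq_lamE h0 h1]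
  nlinarith

lemma one_le_clusterSize (r : ℝ) : 1 ≤ clusterSize r := Nat.le_add_right _ _

lemma firstAtom_nonneg {r : ℝ} (hr : 0 < r) (η : ℝ) (k : ℕ) : 0 ≤ firstAtom r η k :=
  le_min (mul_nonneg (lamF_nonneg _ _) (by positivity)) (lamE_nonneg _)

lemma firstAtom_le (r η : ℝ) (k : ℕ) : firstAtom r η k ≤ lamE η := min_le_right _ _

lemma lamF_le_firstAtom {r η : ℝ} (hr : 0 < r) (h0 : 0 < η) (h1 : η < 1) (k : ℕ) :
    lamF r η ≤ firstAtom r η k :=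
  le_min (le_mul_of_one_le_right (lamF_nonneg _ _) (one_le_pow₀ (by linarith)))
    (lamF_le_lamE hr h0 h1)

/-- At the `k`-th atom of the first cluster the first order of the risk is
`(λ_e² - μ_{1k}²) / 2 = λ_f² {1 + r⁻¹ - (1 + 4r)^(2(k-1))}₊ / 2`. -/
lemma log_sub_firstAtom_sq {r η : ℝ} (hr : 0 < r) (h0 : 0 < η) (h1 : η < 1) (k : ℕ) :
    Real.log η⁻¹ - firstAtom r η k ^ 2 / 2 = oracleVar r * Real.log η⁻¹ * decayFactor r k := by
  have hl := Real.log_nonneg ((one_le_inv₀ h0).2 h1.le)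
  have hv := oracleVar_pos hr
  have hF := sq_lamF hr h0 h1
  have hE := sq_lamE h0 h1
  set q := (1 + 4 * r) ^ (k - 1) with hq
  have hq0 : 0 < q := by positivity
  have e : (1 + 4 * r) ^ (2 * (k - 1)) = q ^ 2 := by rw [hq, ← pow_mul, mul_comm 2]
  have hv' : oracleVar r * (1 + r⁻¹) = 1 := by
    unfold oracleVar; exact inv_mul_cancel₀ (by positivity)
  have hmin : firstAtom r η k ^ 2 = min ((lamF r η * q) ^ 2) (lamE η ^ 2) := by
    have hFq : 0 ≤ lamF r η * q := mul_nonneg (lamF_nonneg _ _) hq0.le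
    rw [firstAtom]
    rcases le_total (lamF r η * q) (lamE η) with h | h
    · rw [min_eq_left h, min_eq_left (by gcongr)]
    · rw [min_eq_right h, min_eq_right (pow_le_pow_left₀ (lamE_nonneg η) h 2)]
  rw [hmin, mul_pow, hF, hE, decayFactor, e, mul_max_of_nonneg _ _ (by positivity)]
  have e1 : oracleVar r * Real.log η⁻¹ * (1 + r⁻¹ - q ^ 2) =
      Real.log η⁻¹ - 2 * oracleVar r * Real.log η⁻¹ * q ^ 2 / 2 := by
    linear_combination Real.log η⁻¹ * hv'
  rw [e1, mul_zero]
  rcases le_total (2 * oracleVar r * Real.log η⁻¹ * q ^ 2) (2 * Real.log η⁻¹) with h | h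
  · rw [min_eq_left h, max_eq_left (by linarith)]
  · rw [min_eq_right h, max_eq_right (by linarith)]; ring

lemma atom_succ (r η : ℝ) (i k : ℕ) :
    atom r η (i + 1) k = i * firstAtom r η (clusterSize r) + firstAtom r η k := by
  have h1 : ((i : ℤ) + 1).sign = 1 := Int.sign_eq_one_of_pos (by positivity)
  have h2 : |(i : ℤ) + 1| = i + 1 := abs_of_nonneg (by positivity)
  rw [atom, h1, h2]
  push_cast
  ring

lemma atom_neg (r η : ℝ) (j : ℤ) (k : ℕ) : atom r η (-j) k = -atom r η j k := by
  rw [atom, atom, Int.sign_neg, abs_neg]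
  push_cast
  ring

lemma atom_one (r η : ℝ) (k : ℕ) : atom r η 1 k = firstAtom r η k := by
  simpa using atom_succ r η 0 k

lemma sq_atom_succ_le {r η : ℝ} (hr : 0 < r) (h0 : 0 < η) (h1 : η < 1) (i k : ℕ) :
    atom r η (i + 1) k ^ 2 ≤ (i + 1) ^ 2 * (2 * Real.log η⁻¹) := by
  rw [atom_succ, ← sq_lamE h0 h1, ← mul_pow]
  have a1 := firstAtom_le r η k
  have a2 := firstAtom_le r η (clusterSize r)
  have a3 := firstAtom_nonneg hr η k
  have a4 := firstAtom_nonneg hr η (clusterSize r)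
  have hi : (0 : ℝ) ≤ i := by positivity
  refine pow_le_pow_left₀ (by positivity) ?_ 2
  nlinarith

lemma lintegral_cluster (r η : ℝ) (j : ℤ) (f : ℝ → ℝ≥0∞) :
    ∫⁻ t, f t ∂cluster r η j =
      (clusterSize r : ℝ≥0∞)⁻¹ * ∑ k ∈ Finset.Icc 1 (clusterSize r), f (atom r η j k) := by
  rw [cluster, lintegral_smul_measure, lintegral_finsetSum_measure]
  simp

lemma cluster_univ (r η : ℝ) (j : ℤ) : cluster r η j Set.univ = 1 := by
  have := one_le_clusterSize r
  rw [← lintegral_one, lintegral_cluster]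
  simp only [Finset.sum_const, Nat.card_Icc, add_tsub_cancel_right, nsmul_eq_mul, mul_one]
  exact ENNReal.inv_mul_cancel (by simp; omega) (by simp)

lemma lintegral_clusterPriorOne (r η : ℝ) (f : ℝ → ℝ≥0∞) :
    ∫⁻ t, f t ∂clusterPriorOne r η = ENNReal.ofReal (1 - η) * f 0 +
      ENNReal.ofReal ((1 - η) / 2) * ∑' i : ℕ, ENNReal.ofReal (η ^ (i + 1)) *
        (∫⁻ t, f t ∂cluster r η (i + 1) + ∫⁻ t, f t ∂cluster r η (-(i + 1))) := by
  rw [clusterPriorOne, lintegral_add_measure, lintegral_smul_measure, lintegral_smul_measure,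
    lintegral_sum_measure]
  simp [lintegral_smul_measure, lintegral_add_measure, mul_add]

/-- The part of the univariate cluster prior away from the atom at the origin. -/
noncomputable def clusterTail (r η : ℝ) : Measure ℝ :=
  ENNReal.ofReal ((1 - η) / 2) • Measure.sum fun i : ℕ =>
    ENNReal.ofReal (η ^ (i + 1)) • (cluster r η (i + 1) + cluster r η (-(i + 1)))

lemma clusterTail_univ (r : ℝ) {η : ℝ} (h0 : 0 < η) (h1 : η < 1) :
    clusterTail r η Set.univ = ENNReal.ofReal η := by
  have hs : HasSum (fun i : ℕ => η ^ (i + 1) * 2) (η / (1 - η) * 2) := by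
    have := ((hasSum_geometric_of_lt_one h0.le h1).mul_left η).mul_right 2
    simpa [pow_succ', div_eq_mul_inv] using this
  rw [clusterTail, Measure.smul_apply, Measure.sum_apply _ MeasurableSet.univ, smul_eq_mul]
  have e : ∀ i : ℕ, (ENNReal.ofReal (η ^ (i + 1)) •
      (cluster r η (i + 1) + cluster r η (-(i + 1)))) Set.univ =
        ENNReal.ofReal (η ^ (i + 1) * 2) := fun i => by
    rw [Measure.smul_apply, Measure.add_apply, cluster_univ, cluster_univ,
      ENNReal.ofReal_mul (by positivity), smul_eq_mul, one_add_one_eq_two]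
    simp
  simp_rw [e]
  rw [← ENNReal.ofReal_tsum_of_nonneg (fun i => by positivity) hs.summable, hs.tsum_eq,
    ← ENNReal.ofReal_mul (by linarith)]
  have : 1 - η ≠ 0 := by linarith
  congr 1
  field_simp

lemma isProbabilityMeasure_clusterPriorOne (r : ℝ) {η : ℝ} (h0 : 0 < η) (h1 : η < 1) :
    IsProbabilityMeasure (clusterPriorOne r η) := by
  constructor
  change (ENNReal.ofReal (1 - η) • Measure.dirac 0 + clusterTail r η : Measure ℝ) Set.univ = 1
  rw [Measure.add_apply, clusterTail_univ r h0 h1, Measure.smul_apply, Measure.dirac_apply_of_mem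
    (Set.mem_univ _), smul_eq_mul, mul_one, ← ENNReal.ofReal_add (by linarith) h0.le]
  simp

lemma dirac_zero_le_clusterPriorOne (r η : ℝ) :
    ENNReal.ofReal (1 - η) • Measure.dirac 0 ≤ clusterPriorOne r η :=
  Measure.le_add_right le_rfl

lemma dirac_atom_le_clusterPriorOne (r : ℝ) {η : ℝ} (h0 : 0 < η) (h1 : η < 1) {j : ℤ}
    (hj : j = 1 ∨ j = -1) {k : ℕ} (hk : k ∈ Finset.Icc 1 (clusterSize r)) :
    ENNReal.ofReal ((1 - η) * η / (2 * clusterSize r)) • Measure.dirac (atom r η j k) ≤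
      clusterPriorOne r η := by
  have hK : (0 : ℝ) < clusterSize r := by exact_mod_cast one_le_clusterSize r
  refine Measure.le_iff.2 fun S hS => ?_
  have e1 : (clusterSize r : ℝ≥0∞)⁻¹ * Measure.dirac (atom r η j k) S ≤ cluster r η j S := by
    rw [cluster, Measure.smul_apply, smul_eq_mul, Measure.finsetSum_apply]
    gcongr
    exact Finset.single_le_sum (f := fun k => Measure.dirac (atom r η j k) S)
      (fun _ _ => zero_le) hk
  have e2 : cluster r η j S ≤ (cluster r η ((0 : ℕ) + 1) + cluster r η (-((0 : ℕ) + 1))) S := by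
    rcases hj with rfl | rfl
    · rw [Measure.add_apply]; simp
    · rw [Measure.add_apply]; simp
  have e3 : clusterTail r η S ≤ clusterPriorOne r η S := by
    change _ ≤ (ENNReal.ofReal (1 - η) • Measure.dirac 0 + clusterTail r η : Measure ℝ) S
    rw [Measure.add_apply]; exact le_add_self
  refine le_trans ?_ e3
  rw [clusterTail, Measure.smul_apply, Measure.smul_apply, Measure.sum_apply _ hS, smul_eq_mul,
    smul_eq_mul]
  calc ENNReal.ofReal ((1 - η) * η / (2 * clusterSize r)) * Measure.dirac (atom r η j k) S
      = ENNReal.ofReal ((1 - η) / 2) * (ENNReal.ofReal (η ^ (0 + 1)) *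
          ((clusterSize r : ℝ≥0∞)⁻¹ * Measure.dirac (atom r η j k) S)) := by
        have : (1 - η) * η / (2 * clusterSize r) = (1 - η) / 2 * (η ^ (0 + 1) *
          (clusterSize r : ℝ)⁻¹) := by field_simp; ring
        rw [this, ENNReal.ofReal_mul (by linarith), ENNReal.ofReal_mul (by positivity),
          ENNReal.ofReal_inv_of_pos hK, ENNReal.ofReal_natCast]
        ring
    _ ≤ ENNReal.ofReal ((1 - η) / 2) * (ENNReal.ofReal (η ^ (0 + 1)) *
          (cluster r η ((0 : ℕ) + 1) + cluster r η (-((0 : ℕ) + 1))) S) := by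
        gcongr
        exact e1.trans e2
    _ ≤ _ := by
        gcongr
        exact ENNReal.le_tsum (f := fun i : ℕ => (ENNReal.ofReal (η ^ (i + 1)) •
          (cluster r η (i + 1) + cluster r η (-(i + 1)))) S) 0

lemma mix_clusterPriorOne_le (r : ℝ) {η : ℝ} (h0 : 0 < η) (h1 : η < 1) {w : ℝ} (hw : 0 < w)
    (u : ℝ) : mix (clusterPriorOne r η) w u ≤ pdf 0 w u + η * (√(2 * Real.pi * w))⁻¹ := by
  have hfin : IsFiniteMeasure (clusterTail r η) := ⟨by rw [clusterTail_univ r h0 h1]; simp⟩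
  have e : clusterPriorOne r η = ENNReal.ofReal (1 - η) • Measure.dirac 0 + clusterTail r η := rfl
  have hfin2 : IsFiniteMeasure (ENNReal.ofReal (1 - η) • Measure.dirac (0 : ℝ)) :=
    ⟨by simp⟩
  have hp := pdf_pos hw 0 u
  have e1 : ∫ θ, pdf θ w u ∂clusterTail r η ≤ η * (√(2 * Real.pi * w))⁻¹ := by
    calc _ ≤ ∫ _, (√(2 * Real.pi * w))⁻¹ ∂clusterTail r η :=
          integral_mono (integrable_pdf_left hw _ u) (integrable_const _) fun θ => pdf_le hw θ u
      _ = _ := by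
          rw [integral_const, measureReal_def, clusterTail_univ r h0 h1,
            ENNReal.toReal_ofReal h0.le, smul_eq_mul]
  rw [mix, e, integral_add_measure (integrable_pdf_left hw _ u) (integrable_pdf_left hw _ u),
    integral_smul_measure, integral_dirac, ENNReal.toReal_ofReal (by linarith), smul_eq_mul]
  nlinarith

/-! ### The risk at the atoms of the first cluster -/

/-- The univariate risk of the Bayes predictive density of the cluster prior. -/
noncomputable def clusterRisk (r η t : ℝ) : ℝ :=
  pairRisk r (mix (clusterPriorOne r η) 1) (mix (clusterPriorOne r η) (oracleVar r)) t

section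
variable {r η : ℝ}

lemma predictivePair_cluster (hr : 0 < r) (h0 : 0 < η) (h1 : η < 1) :
    PredictivePair r (mix (clusterPriorOne r η) 1) (mix (clusterPriorOne r η) (oracleVar r)) := by
  have := isProbabilityMeasure_clusterPriorOne r h0 h1
  exact predictivePair_mix hr (sub_pos.2 h1) (dirac_zero_le_clusterPriorOne r η)

lemma clusterRisk_nonneg (hr : 0 < r) (h0 : 0 < η) (h1 : η < 1) (t : ℝ) : 0 ≤ clusterRisk r η t :=
  (predictivePair_cluster hr h0 h1).pairRisk_nonneg hr t

lemma firstClusterRisk_eq (hr : 0 < r) (h0 : 0 < η) (h1 : η < 1) (k : ℕ) :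
    firstClusterRisk r η k = ENNReal.ofReal (clusterRisk r η (atom r η 1 k)) := by
  have := isProbabilityMeasure_clusterPriorOne r h0 h1
  rw [firstClusterRisk, clusterPrior, bayesDensity_pi hr (sub_pos.2 h1)
    (dirac_zero_le_clusterPriorOne r η), ((predictivePair_cluster hr h0 h1).predRisk_eq hr _).1]
  simp [clusterRisk]

lemma clusterRisk_le (hr : 0 < r) (h0 : 0 < η) (h1 : η < 1) (t : ℝ) :
    clusterRisk r η t ≤ t ^ 2 / (2 * oracleVar r) - Real.log (1 - η) := by
  have := isProbabilityMeasure_clusterPriorOne r h0 h1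
  have h := predictivePair_cluster hr h0 h1
  have hv := oracleVar_pos hr
  have a1 := klTo_le_of_atom hv h.posᵥ h.growthᵥ (sub_pos.2 h1)
    (fun u => mul_pdf_le_mix hv (sub_pos.2 h1).le (dirac_zero_le_clusterPriorOne r η) u) t
  have a2 := klTo_nonneg one_pos h.pos₁ h.growth₁ h.meas₁ (lintegral_mix one_pos _) t
  rw [sub_zero] at a1
  rw [clusterRisk, pairRisk]
  linarith

lemma neg_log_one_sub_le (h0 : 0 < η) (h1 : η ≤ 1 / 2) : -Real.log (1 - η) ≤ 2 * η := by
  have h2 : 0 < 1 - η := by linarith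
  have := Real.log_le_sub_one_of_pos (inv_pos.2 h2)
  rw [Real.log_inv] at this
  refine this.trans ?_
  have : (1 - η)⁻¹ ≤ 1 + 2 * η := by
    rw [inv_le_iff_one_le_mul₀ h2]; nlinarith
  linarith

lemma le_half_of_one_le_log (h0 : 0 < η) (hl : 1 ≤ Real.log η⁻¹) : η ≤ 1 / 2 := by
  have h2 : 2 ≤ η⁻¹ := by
    have := Real.add_one_le_exp (Real.log η⁻¹)
    rw [Real.exp_log (inv_pos.2 h0)] at this; linarith
  rw [le_div_iff₀ two_pos]
  have := mul_le_mul_of_nonneg_left h2 h0.le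
  rwa [mul_inv_cancel₀ h0.ne'] at this

end

lemma clusterRisk_atom_bounds {r : ℝ} (hr : 0 < r) : ∃ C : ℝ, 0 ≤ C ∧ ∀ η : ℝ, 0 < η →
    1 ≤ Real.log η⁻¹ → ∀ j : ℤ, (j = 1 ∨ j = -1) → ∀ k ∈ Finset.Icc 1 (clusterSize r),
      |clusterRisk r η (atom r η j k) - oracleVar r * Real.log η⁻¹ * decayFactor r k| ≤
        C * √(Real.log η⁻¹) := by
  have hv := oracleVar_pos hr
  have hv1 := oracleVar_lt_one hr
  set v := oracleVar r with hvdef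
  have hK : (1 : ℝ) ≤ clusterSize r := by exact_mod_cast one_le_clusterSize r
  have hlogK : 0 ≤ Real.log (2 * clusterSize r) := Real.log_nonneg (by linarith)
  refine ⟨Real.log (2 * clusterSize r) + 5 + 2 / v, by positivity, fun η h0 hl j hj k hk => ?_⟩
  have hη := le_half_of_one_le_log h0 hl
  have h1 : η < 1 := by linarith
  have := isProbabilityMeasure_clusterPriorOne r h0 h1
  have h := predictivePair_cluster hr h0 h1
  rw [← hvdef] at h
  set π := clusterPriorOne r η
  have hnl := neg_log_one_sub_le h0 hη
  set l := Real.log η⁻¹ with hldef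
  have hsl : 1 ≤ √l := Real.one_le_sqrt.2 hl
  have hexp : Real.exp (-l) = η := by rw [hldef, Real.log_inv, neg_neg, Real.exp_log h0]
  set t := atom r η j k
  have ht : t ^ 2 = firstAtom r η k ^ 2 := by
    rcases hj with rfl | rfl
    · rw [← atom_one]
    · rw [← atom_one, ← neg_sq, ← atom_neg, neg_neg]
  have hF : 2 * v * l ≤ t ^ 2 := by
    rw [ht, ← sq_lamF hr h0 h1]
    exact pow_le_pow_left₀ (lamF_nonneg _ _) (lamF_le_firstAtom hr h0 h1 k) 2
  have hE : t ^ 2 ≤ 2 * l := by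
    rw [ht, ← sq_lamE h0 h1]
    exact pow_le_pow_left₀ (firstAtom_nonneg hr _ _) (firstAtom_le r η k) 2
  have hmain : l - t ^ 2 / 2 = v * l * decayFactor r k := by
    rw [ht]; exact log_sub_firstAtom_sq hr h0 h1 k
  have hc : 0 < (1 - η) * η / (2 * clusterSize r) := by
    have : 0 < 1 - η := by linarith
    positivity
  have a1 := klTo_le_of_atom hv h.posᵥ h.growthᵥ hc
    (fun u => mul_pdf_le_mix hv hc.le (dirac_atom_le_clusterPriorOne r h0 h1 hj hk) u) t
  have a2 := klTo_le_of_atom one_pos h.pos₁ h.growth₁ (sub_pos.2 h1)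
    (fun u => mul_pdf_le_mix one_pos (sub_pos.2 h1).le (dirac_zero_le_clusterPriorOne r η) u) t
  have a3 := le_klTo hv h.posᵥ h.growthᵥ le_rfl (by linarith : 0 ≤ l)
    (fun u => by rw [one_mul, hexp]; exact mix_clusterPriorOne_le r h0 h1 hv u) t
  have a4 := le_klTo one_pos h.pos₁ h.growth₁ le_rfl (by linarith : 0 ≤ l)
    (fun u => by rw [one_mul, hexp]; exact mix_clusterPriorOne_le r h0 h1 one_pos u) t
  rw [Real.log_div (mul_pos (by linarith) h0).ne' (by positivity),
    Real.log_mul (by linarith) h0.ne', sub_self, ← neg_neg (Real.log η), ← Real.log_inv,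
    ← hldef] at a1
  rw [sub_zero] at a2
  rw [min_eq_right (by rw [le_div_iff₀ (by positivity)]; linarith), Real.log_one] at a3
  rw [min_eq_left (by linarith), Real.log_one] at a4
  have s1 : √(2 * 1 * l) ≤ 2 * √l := by
    rw [Real.sqrt_le_left (by positivity), mul_pow, Real.sq_sqrt (by linarith)]; linarith
  have s2 : √(2 * v * l) / v * ((v + 1) / 2) ≤ 2 / v * √l := by
    have : √(2 * v * l) ≤ 2 * √l := by
      rw [Real.sqrt_le_left (by positivity), mul_pow, Real.sq_sqrt (by linarith)]; nlinarith
    calc √(2 * v * l) / v * ((v + 1) / 2) ≤ 2 * √l / v * 1 := by gcongr; linarith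
      _ = 2 / v * √l := by ring
  have s3 : √(2 * 1 * l) / 1 * ((1 + 1) / 2) = √(2 * 1 * l) := by ring
  rw [s3] at a4
  have e0 : (0 : ℝ) ^ 2 / (2 * v) = 0 := by simp
  rw [e0] at a1
  have hprod : (Real.log (2 * clusterSize r) + 5 + 2 / v) * √l =
      Real.log (2 * clusterSize r) * √l + 5 * √l + 2 / v * √l := by ring
  have hKl : Real.log (2 * clusterSize r) ≤ Real.log (2 * clusterSize r) * √l :=
    le_mul_of_one_le_right hlogK hsl
  have hvl : 0 ≤ 2 / v * √l := by positivity
  have hK0 : 0 ≤ Real.log (2 * clusterSize r) * √l := by positivity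
  have hdef : clusterRisk r η t = klTo v (mix π v) t - klTo 1 (mix π 1) t := rfl
  rw [← hmain, hdef, hprod, abs_le]
  have e1 : t ^ 2 / (2 * 1) = t ^ 2 / 2 := by norm_num
  rw [e1] at a2 a4
  generalize √(2 * 1 * l) = q at s1 a4
  constructor
  · linarith
  · linarith

section
variable {r : ℝ} (hr : 0 < r)
include hr

lemma one_lt_clusterSize_iff : 1 < clusterSize r ↔ r < 1 / 2 := by
  unfold clusterSize
  split_ifs with h
  · refine ⟨fun _ => h, fun _ => ?_⟩
    have h1 : 0 < Real.log (1 + r⁻¹) := Real.log_pos (by have := inv_pos.2 hr; linarith)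
    have h2 : 0 < Real.log (1 + 4 * r) := Real.log_pos (by linarith)
    have : 0 < ⌈Real.log (1 + r⁻¹) / (2 * Real.log (1 + 4 * r))⌉₊ := Nat.ceil_pos.2 (by positivity)
    omega
  · simpa using h

omit hr in
lemma clusterSize_sub_one (h : r < 1 / 2) : clusterSize r - 1 =
    ⌈Real.log (1 + r⁻¹) / (2 * Real.log (1 + 4 * r))⌉₊ := by
  unfold clusterSize
  rw [if_pos h]; omega

lemma pow_lt_iff (j : ℕ) : (1 + 4 * r) ^ (2 * j) < 1 + r⁻¹ ↔
    (j : ℝ) < Real.log (1 + r⁻¹) / (2 * Real.log (1 + 4 * r)) := by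
  have h1 : 0 < 1 + r⁻¹ := by positivity
  have h2 : 0 < Real.log (1 + 4 * r) := Real.log_pos (by linarith)
  rw [lt_div_iff₀ (by positivity), ← Real.log_lt_log_iff (by positivity) h1, Real.log_pow]
  push_cast
  rw [show (2 : ℝ) * j * Real.log (1 + 4 * r) = j * (2 * Real.log (1 + 4 * r)) by ring]

lemma decay_arg_pos {k : ℕ} (hk : k ∈ Set.Ico 1 (clusterSize r)) :
    (1 + 4 * r) ^ (2 * (k - 1)) < 1 + r⁻¹ := by
  obtain ⟨hk1, hk2⟩ := hk
  have hlt : r < 1 / 2 := (one_lt_clusterSize_iff hr).1 (by omega)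
  rw [pow_lt_iff hr, ← Nat.lt_ceil, ← clusterSize_sub_one hlt]
  omega

lemma decayFactor_pos {k : ℕ} (hk : k ∈ Set.Ico 1 (clusterSize r)) : 0 < decayFactor r k :=
  lt_max_of_lt_left (sub_pos.2 (decay_arg_pos hr hk))

lemma strictAntiOn_decayFactor : StrictAntiOn (decayFactor r) (Set.Icc 1 (clusterSize r)) := by
  intro k hk k' hk' hlt
  have hpos := decayFactor_pos hr (k := k) ⟨hk.1, lt_of_lt_of_le hlt hk'.2⟩
  refine max_lt ?_ hpos
  refine lt_of_lt_of_le ?_ (le_max_left _ _)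
  have : (1 + 4 * r) ^ (2 * (k - 1)) < (1 + 4 * r) ^ (2 * (k' - 1)) :=
    pow_lt_pow_right₀ (by linarith) (by have := hk.1; omega)
  linarith

lemma decayFactor_clusterSize (h : 2 ≤ clusterSize r) : decayFactor r (clusterSize r) = 0 := by
  have hlt : r < 1 / 2 := (one_lt_clusterSize_iff hr).1 (by omega)
  refine max_eq_right (sub_nonpos.2 (not_lt.1 fun hcon => ?_))
  rw [pow_lt_iff hr, ← Nat.lt_ceil, ← clusterSize_sub_one hlt] at hcon
  exact lt_irrefl _ hcon

lemma decayFactor_one : decayFactor r 1 = r⁻¹ := by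
  have : 0 < r⁻¹ := inv_pos.2 hr
  rw [decayFactor]
  simp [this.le]

omit hr in
lemma tendsto_log_inv : Tendsto (fun η : ℝ => Real.log η⁻¹) (𝓝[>] 0) atTop :=
  Real.tendsto_log_atTop.comp tendsto_inv_nhdsGT_zero

omit hr in
lemma eventually_small (M : ℝ) : ∀ᶠ η in 𝓝[>] (0 : ℝ), 0 < η ∧ M ≤ Real.log η⁻¹ :=
  (eventually_mem_nhdsWithin).and (tendsto_log_inv.eventually_ge_atTop M)

lemma tendsto_lamF : Tendsto (fun η => lamF r η) (𝓝[>] 0) atTop := by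
  have hv := oracleVar_pos hr
  have : Tendsto (fun η : ℝ => √(2 * oracleVar r * Real.log η⁻¹)) (𝓝[>] 0) atTop :=
    Real.tendsto_sqrt_atTop.comp (tendsto_log_inv.const_mul_atTop (by positivity))
  refine this.congr' ?_
  filter_upwards [eventually_small 0] with η hη
  rw [lamF_eq hη.1]

lemma firstClusterRisk_isBigO {k : ℕ} (hk : k ∈ Set.Icc 1 (clusterSize r)) :
    (fun η : ℝ => (firstClusterRisk r η k).toReal - lamF r η ^ 2 / 2 * decayFactor r k)
      =O[𝓝[>] 0] fun η => lamF r η := by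
  obtain ⟨C, hC, hb⟩ := clusterRisk_atom_bounds hr
  have hv := oracleVar_pos hr
  refine IsBigO.of_bound (C / √(2 * oracleVar r)) ?_
  filter_upwards [eventually_small 1] with η hη
  have h1 : η < 1 := by linarith [le_half_of_one_le_log hη.1 hη.2]
  rw [firstClusterRisk_eq hr hη.1 h1, ENNReal.toReal_ofReal (clusterRisk_nonneg hr hη.1 h1 _),
    sq_lamF hr hη.1 h1, Real.norm_eq_abs, Real.norm_of_nonneg (lamF_nonneg _ _), lamF_eq hη.1,
    Real.sqrt_mul (by positivity) (Real.log η⁻¹), ← mul_assoc,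
    div_mul_cancel₀ _ (by positivity)]
  have := hb η hη.1 hη.2 1 (Or.inl rfl) k (Finset.mem_Icc.2 hk)
  convert this using 2
  ring

lemma lamF_isLittleO_sq : (fun η => lamF r η) =o[𝓝[>] 0] fun η => lamF r η ^ 2 := by
  have := (isLittleO_pow_pow_atTop_of_lt (𝕜 := ℝ) one_lt_two).comp_tendsto (tendsto_lamF hr)
  simpa [Function.comp_def] using this

lemma firstClusterRisk_isEquivalent : (fun η : ℝ => (firstClusterRisk r η 1).toReal) ~[𝓝[>] 0]
    fun η => lamF r η ^ 2 / (2 * r) := by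
  have h1 := firstClusterRisk_isBigO hr (k := 1) ⟨le_rfl, one_le_clusterSize r⟩
  have h2 : (fun η => lamF r η) =o[𝓝[>] 0] fun η => lamF r η ^ 2 / (2 * r) := by
    simp_rw [div_eq_mul_inv]
    exact (isLittleO_const_mul_right_iff' (c := (2 * r)⁻¹)
      (IsUnit.mk0 _ (by positivity))).2 (lamF_isLittleO_sq hr) |>.congr_right fun η => mul_comm _ _
  rw [IsEquivalent]
  refine (h1.trans_isLittleO h2).congr_left fun η => ?_
  simp only [Pi.sub_apply]
  rw [decayFactor_one hr]
  field_simp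

lemma firstClusterRisk_last_isLittleO (h : 2 ≤ clusterSize r) :
    (fun η : ℝ => (firstClusterRisk r η (clusterSize r)).toReal)
        =o[𝓝[>] 0] fun η => lamF r η ^ 2 := by
  have h1 := firstClusterRisk_isBigO hr (k := clusterSize r) ⟨one_le_clusterSize r, le_rfl⟩
  refine (h1.trans_isLittleO (lamF_isLittleO_sq hr)).congr_left fun η => ?_
  rw [decayFactor_clusterSize hr h, mul_zero, sub_zero]

lemma firstClusterRisk_ne_top (k : ℕ) : ∀ᶠ η in 𝓝[>] (0 : ℝ), firstClusterRisk r η k ≠ ∞ := by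
  filter_upwards [eventually_small 1] with η hη
  have h1 : η < 1 := by linarith [le_half_of_one_le_log hη.1 hη.2]
  rw [firstClusterRisk_eq hr hη.1 h1]
  exact ENNReal.ofReal_ne_top

lemma strictAntiOn_firstClusterRisk : ∀ᶠ η in 𝓝[>] (0 : ℝ),
    StrictAntiOn (fun k => firstClusterRisk r η k) (Set.Icc 1 (clusterSize r)) := by
  obtain ⟨C, hC, hb⟩ := clusterRisk_atom_bounds hr
  have hv := oracleVar_pos hr
  have key : ∀ k ∈ Set.Icc 1 (clusterSize r), ∀ k' ∈ Set.Icc 1 (clusterSize r),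
      ∀ᶠ η in 𝓝[>] (0 : ℝ), k < k' → firstClusterRisk r η k' < firstClusterRisk r η k := by
    intro k hk k' hk'
    by_cases hlt : k < k'
    swap
    · exact Eventually.of_forall fun η h => absurd h hlt
    have hd := strictAntiOn_decayFactor hr hk hk' hlt
    set δ := oracleVar r * (decayFactor r k - decayFactor r k') with hδ
    have hδ0 : 0 < δ := mul_pos hv (sub_pos.2 hd)
    filter_upwards [eventually_small (max 1 ((2 * C / δ + 1) ^ 2))] with η hη _
    obtain ⟨h0, hη⟩ := hη
    have hl := (le_max_left _ _).trans hη
    have hl2 := (le_max_right _ _).trans hη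
    have h1 : η < 1 := by linarith [le_half_of_one_le_log h0 hl]
    rw [firstClusterRisk_eq hr h0 h1, firstClusterRisk_eq hr h0 h1]
    have b1 := abs_le.1 (hb η h0 hl 1 (Or.inl rfl) k (Finset.mem_Icc.2 hk))
    have b2 := abs_le.1 (hb η h0 hl 1 (Or.inl rfl) k' (Finset.mem_Icc.2 hk'))
    set l := Real.log η⁻¹
    have hs : 2 * C / δ + 1 ≤ √l := Real.le_sqrt_of_sq_le hl2
    have hs0 : 0 < √l := lt_of_lt_of_le (by positivity) hs
    have hsq : √l * √l = l := Real.mul_self_sqrt (by linarith)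
    have hgap : 2 * C * √l < δ * l := by
      have : 2 * C < δ * √l := by
        have : 2 * C / δ < √l := by linarith
        rwa [div_lt_iff₀' hδ0] at this
      calc 2 * C * √l < δ * √l * √l := by gcongr
        _ = δ * l := by rw [mul_assoc, hsq]
    have e : δ * l = oracleVar r * l * decayFactor r k - oracleVar r * l * decayFactor r k' := by
      rw [hδ]; ring
    rw [ENNReal.ofReal_lt_ofReal_iff_of_nonneg (clusterRisk_nonneg hr h0 h1 _)]
    linarith
  have h2 : ∀ᶠ η in 𝓝[>] (0 : ℝ), ∀ k ∈ Set.Icc 1 (clusterSize r),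
      ∀ k' ∈ Set.Icc 1 (clusterSize r), k < k' →
        firstClusterRisk r η k' < firstClusterRisk r η k :=
    ((Set.finite_Icc _ _).eventually_all).2 fun k hk =>
      ((Set.finite_Icc _ _).eventually_all).2 fun k' hk' => key k hk k' hk'
  filter_upwards [h2] with η hη k hk k' hk' hlt using hη k hk k' hk' hlt

end

/-! ### The Bayes risk of the cluster prior -/

lemma bayesConst_mul {r : ℝ} (hr : 0 < r) (l : ℝ) : (1 - oracleVar r) * l * bayesConst r =
    (clusterSize r : ℝ)⁻¹ *
      ∑ k ∈ Finset.Icc 1 (clusterSize r), oracleVar r * l * decayFactor r k := by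
  have e : ∀ k, oracleVar r * l * decayFactor r k =
      (1 - oracleVar r) * l * (r * decayFactor r k) := fun k => by
    rw [← oracleVar_div hr]; field_simp
  simp_rw [e]
  rw [← Finset.mul_sum, bayesConst]
  ring

section
variable {r η : ℝ} (hr : 0 < r) (h0 : 0 < η) (h1 : η < 1)
include hr h0 h1

lemma predBayesRisk_clusterPrior (n : ℕ) : predBayesRisk r (clusterPrior n r η) =
    n * ∫⁻ t, ENNReal.ofReal (clusterRisk r η t) ∂clusterPriorOne r η := by
  have := isProbabilityMeasure_clusterPriorOne r h0 h1
  exact predBayesRisk_pi hr (sub_pos.2 h1) (dirac_zero_le_clusterPriorOne r η)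

lemma lintegral_clusterRisk_cluster (j : ℤ) :
    ∫⁻ t, ENNReal.ofReal (clusterRisk r η t) ∂cluster r η j =
      ENNReal.ofReal ((clusterSize r : ℝ)⁻¹ *
        ∑ k ∈ Finset.Icc 1 (clusterSize r), clusterRisk r η (atom r η j k)) := by
  have hK : (0 : ℝ) < clusterSize r := by exact_mod_cast one_le_clusterSize r
  rw [lintegral_cluster, ENNReal.ofReal_mul (by positivity), ENNReal.ofReal_inv_of_pos hK,
    ENNReal.ofReal_natCast,
    ENNReal.ofReal_sum_of_nonneg fun k _ => clusterRisk_nonneg hr h0 h1 _]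

lemma lintegral_clusterRisk_cluster_le {j : ℤ} {c : ℝ}
    (h : ∀ k ∈ Finset.Icc 1 (clusterSize r), clusterRisk r η (atom r η j k) ≤ c) :
    ∫⁻ t, ENNReal.ofReal (clusterRisk r η t) ∂cluster r η j ≤ ENNReal.ofReal c := by
  have hK : (0 : ℝ) < clusterSize r := by exact_mod_cast one_le_clusterSize r
  rw [lintegral_clusterRisk_cluster hr h0 h1]
  refine ENNReal.ofReal_le_ofReal ?_
  have := Finset.sum_le_sum h
  rw [Finset.sum_const, Nat.card_Icc, add_tsub_cancel_right, nsmul_eq_mul] at this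
  rw [inv_mul_le_iff₀ hK]
  exact this

/-- Far clusters carry little mass and only a polynomially growing risk. -/
lemma clusterRisk_atom_succ_le (hl : 1 ≤ Real.log η⁻¹) (i k : ℕ) :
    clusterRisk r η (atom r η (i + 1) k) ≤
        (i + 1) ^ 2 * ((1 / oracleVar r + 1) * Real.log η⁻¹) ∧
    clusterRisk r η (atom r η (-(i + 1)) k) ≤
        (i + 1) ^ 2 * ((1 / oracleVar r + 1) * Real.log η⁻¹) := by
  have hv := oracleVar_pos hr
  have hη := le_half_of_one_le_log h0 hl
  have hnl := neg_log_one_sub_le h0 hη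
  have hsq := sq_atom_succ_le hr h0 h1 i k
  have key : ∀ t : ℝ, t ^ 2 = atom r η (i + 1) k ^ 2 → clusterRisk r η t ≤
      (i + 1) ^ 2 * ((1 / oracleVar r + 1) * Real.log η⁻¹) := by
    intro t ht
    refine (clusterRisk_le hr h0 h1 t).trans ?_
    rw [ht]
    have a1 : atom r η (i + 1) k ^ 2 / (2 * oracleVar r) ≤
        (i + 1) ^ 2 * (1 / oracleVar r * Real.log η⁻¹) := by
      rw [div_le_iff₀ (by positivity)]
      refine hsq.trans_eq ?_
      field_simp
    have a2 : (1 : ℝ) ≤ (i + 1) ^ 2 := by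
      have : (0 : ℝ) ≤ i := by positivity
      nlinarith
    have a3 : (1 : ℝ) ≤ (i + 1) ^ 2 * Real.log η⁻¹ := by nlinarith
    linarith
  refine ⟨key _ rfl, key _ ?_⟩
  rw [atom_neg, neg_sq]

end

lemma lintegral_clusterRisk_bounds {r : ℝ} (hr : 0 < r) : ∃ C : ℝ, 0 ≤ C ∧ ∀ η : ℝ, 0 < η →
    1 ≤ Real.log η⁻¹ →
    ENNReal.ofReal (η * ((1 - η) * ((1 - oracleVar r) * Real.log η⁻¹ * bayesConst r -
      C * √(Real.log η⁻¹)))) ≤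
        ∫⁻ t, ENNReal.ofReal (clusterRisk r η t) ∂clusterPriorOne r η ∧
    ∫⁻ t, ENNReal.ofReal (clusterRisk r η t) ∂clusterPriorOne r η ≤
      ENNReal.ofReal (η * ((1 - oracleVar r) * Real.log η⁻¹ * bayesConst r +
        C * (√(Real.log η⁻¹) + η * Real.log η⁻¹))) := by
  obtain ⟨C, hC, hb⟩ := clusterRisk_atom_bounds hr
  have hv := oracleVar_pos hr
  have hK : (0 : ℝ) < clusterSize r := by exact_mod_cast one_le_clusterSize r
  set D := 1 / oracleVar r + 1 with hD
  have hD0 : 0 < D := by positivity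
  have hS : Summable fun i : ℕ => ((i : ℝ) + 2) ^ 2 * (1 / 2) ^ i := by
    have h2 := summable_pow_mul_geometric_of_norm_lt_one 2 (r := (1 / 2 : ℝ)) (by norm_num)
    have h1 := summable_pow_mul_geometric_of_norm_lt_one 1 (r := (1 / 2 : ℝ)) (by norm_num)
    have h0 := summable_pow_mul_geometric_of_norm_lt_one 0 (r := (1 / 2 : ℝ)) (by norm_num)
    refine ((h2.add (h1.mul_left 4)).add (h0.mul_left 4)).congr fun i => ?_
    ring
  set S := ∑' i : ℕ, ((i : ℝ) + 2) ^ 2 * (1 / 2) ^ i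
  have hS0 : 0 ≤ S := tsum_nonneg fun i => by positivity
  refine ⟨C + 2 + D * S, by positivity, fun η h0 hl => ?_⟩
  have hη := le_half_of_one_le_log h0 hl
  have h1 : η < 1 := by linarith
  have hnl := neg_log_one_sub_le h0 hη
  have hb' := fun j hj => hb η h0 hl j hj
  have hbc := bayesConst_mul hr (Real.log η⁻¹)
  set l := Real.log η⁻¹
  have hsl : 1 ≤ √l := Real.one_le_sqrt.2 hl
  set avg : ℤ → ℝ := fun j => (clusterSize r : ℝ)⁻¹ *
    ∑ k ∈ Finset.Icc 1 (clusterSize r), clusterRisk r η (atom r η j k)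
  have hint : ∀ j, ∫⁻ t, ENNReal.ofReal (clusterRisk r η t) ∂cluster r η j =
      ENNReal.ofReal (avg j) := lintegral_clusterRisk_cluster hr h0 h1
  have havg0 : ∀ j, 0 ≤ avg j := fun j =>
    mul_nonneg (by positivity) (Finset.sum_nonneg fun k _ => clusterRisk_nonneg hr h0 h1 _)
  have hconst : C * √l = (clusterSize r : ℝ)⁻¹ *
      ∑ k ∈ Finset.Icc 1 (clusterSize r), C * √l := by
    rw [Finset.sum_const, Nat.card_Icc, add_tsub_cancel_right, nsmul_eq_mul,
      inv_mul_cancel_left₀ hK.ne']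
  have hlow : ∀ j : ℤ, (j = 1 ∨ j = -1) →
      (1 - oracleVar r) * l * bayesConst r - C * √l ≤ avg j := by
    intro j hj
    rw [hbc, hconst, ← mul_sub, ← Finset.sum_sub_distrib]
    refine mul_le_mul_of_nonneg_left (Finset.sum_le_sum fun k hk => ?_) (by positivity)
    linarith [(abs_le.1 (hb' j hj k hk)).1]
  have hupp : ∀ j : ℤ, (j = 1 ∨ j = -1) →
      avg j ≤ (1 - oracleVar r) * l * bayesConst r + C * √l := by
    intro j hj
    rw [hbc, hconst, ← mul_add, ← Finset.sum_add_distrib]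
    refine mul_le_mul_of_nonneg_left (Finset.sum_le_sum fun k hk => ?_) (by positivity)
    linarith [(abs_le.1 (hb' j hj k hk)).2]
  set x := (1 - oracleVar r) * l * bayesConst r
  rw [lintegral_clusterPriorOne]
  set T : ℕ → ℝ≥0∞ := fun i => ENNReal.ofReal (η ^ (i + 1)) *
    (∫⁻ t, ENNReal.ofReal (clusterRisk r η t) ∂cluster r η (i + 1) +
      ∫⁻ t, ENNReal.ofReal (clusterRisk r η t) ∂cluster r η (-(i + 1))) with hT
  have hT0 : T 0 = ENNReal.ofReal (η * (avg 1 + avg (-1))) := by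
    rw [hT]
    simp only [zero_add, pow_one, Nat.cast_zero]
    rw [hint, hint, ← ENNReal.ofReal_add (havg0 _) (havg0 _), ← ENNReal.ofReal_mul h0.le]
  constructor
  · calc _ ≤ ENNReal.ofReal ((1 - η) / 2 * (η * (avg 1 + avg (-1)))) := by
          refine ENNReal.ofReal_le_ofReal ?_
          have e1 := hlow 1 (Or.inl rfl)
          have e2 := hlow (-1) (Or.inr rfl)
          have e3 : C * √l ≤ (C + 2 + D * S) * √l := by
            gcongr
            have : 0 ≤ D * S := by positivity
            linarith
          have e4 : 0 ≤ (1 - η) / 2 * η := by nlinarith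
          have e5 : 2 * (x - (C + 2 + D * S) * √l) ≤ avg 1 + avg (-1) := by linarith
          calc η * ((1 - η) * (x - (C + 2 + D * S) * √l))
              = (1 - η) / 2 * η * (2 * (x - (C + 2 + D * S) * √l)) := by ring
            _ ≤ (1 - η) / 2 * η * (avg 1 + avg (-1)) := by gcongr
            _ = _ := by ring
      _ = ENNReal.ofReal ((1 - η) / 2) * T 0 := by rw [hT0, ENNReal.ofReal_mul (by linarith)]
      _ ≤ ENNReal.ofReal ((1 - η) / 2) * ∑' i, T i := by
          gcongr
          exact ENNReal.le_tsum 0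
      _ ≤ _ := le_add_self
  · have htail : ∑' i, T (i + 1) ≤ ENNReal.ofReal (η ^ 2 * (2 * (D * l)) * S) := by
      have hterm : ∀ i, T (i + 1) ≤
          ENNReal.ofReal (η ^ 2 * (2 * (D * l)) * (((i : ℝ) + 2) ^ 2 * (1 / 2) ^ i)) := by
        intro i
        have b1 := lintegral_clusterRisk_cluster_le hr h0 h1 fun k _ =>
          (clusterRisk_atom_succ_le hr h0 h1 hl (i + 1) k).1
        have b2 := lintegral_clusterRisk_cluster_le hr h0 h1 fun k _ =>
          (clusterRisk_atom_succ_le hr h0 h1 hl (i + 1) k).2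
        have hn : 0 ≤ (((i + 1 : ℕ) : ℝ) + 1) ^ 2 * (D * l) := by positivity
        calc T (i + 1) ≤ ENNReal.ofReal (η ^ (i + 1 + 1)) *
              (ENNReal.ofReal ((((i + 1 : ℕ) : ℝ) + 1) ^ 2 * (D * l)) +
                ENNReal.ofReal ((((i + 1 : ℕ) : ℝ) + 1) ^ 2 * (D * l))) := by
              rw [hT]
              exact mul_le_mul_right (add_le_add b1 b2) _
          _ = ENNReal.ofReal (η ^ (i + 1 + 1) * (2 * ((((i + 1 : ℕ) : ℝ) + 1) ^ 2 * (D * l)))) := by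
              rw [← ENNReal.ofReal_add hn hn, ← ENNReal.ofReal_mul (by positivity), two_mul]
          _ ≤ _ := by
              refine ENNReal.ofReal_le_ofReal ?_
              have : η ^ i ≤ (1 / 2) ^ i := pow_le_pow_left₀ h0.le hη i
              push_cast
              calc η ^ (i + 1 + 1) * (2 * (((i : ℝ) + 1 + 1) ^ 2 * (D * l)))
                  = η ^ 2 * (2 * (D * l)) * (((i : ℝ) + 2) ^ 2 * η ^ i) := by ring
                _ ≤ _ := by gcongr
      refine (ENNReal.tsum_le_tsum hterm).trans_eq ?_
      rw [← ENNReal.ofReal_tsum_of_nonneg (fun i => by positivity) (hS.mul_left _), tsum_mul_left]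
    have hz : ENNReal.ofReal (clusterRisk r η 0) ≤ ENNReal.ofReal (2 * η) := by
      refine ENNReal.ofReal_le_ofReal ((clusterRisk_le hr h0 h1 0).trans ?_)
      simpa using hnl
    have e1 := hupp 1 (Or.inl rfl)
    have e2 := hupp (-1) (Or.inr rfl)
    have e0 := add_nonneg (havg0 1) (havg0 (-1))
    calc _ ≤ 1 * ENNReal.ofReal (2 * η) + ENNReal.ofReal (1 / 2) *
          (ENNReal.ofReal (η * (avg 1 + avg (-1))) +
            ENNReal.ofReal (η ^ 2 * (2 * (D * l)) * S)) := by
          refine add_le_add (mul_le_mul' ?_ hz) (mul_le_mul' ?_ ?_)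
          · rw [← ENNReal.ofReal_one]; exact ENNReal.ofReal_le_ofReal (by linarith)
          · exact ENNReal.ofReal_le_ofReal (by linarith)
          · rw [tsum_eq_zero_add' ENNReal.summable]
            exact add_le_add hT0.le htail
      _ = ENNReal.ofReal (2 * η + 1 / 2 * (η * (avg 1 + avg (-1)) +
            η ^ 2 * (2 * (D * l)) * S)) := by
          rw [one_mul, ← ENNReal.ofReal_add (by positivity) (by positivity),
            ← ENNReal.ofReal_mul (by norm_num), ← ENNReal.ofReal_add (by positivity)
              (by positivity)]
      _ ≤ _ := by
          refine ENNReal.ofReal_le_ofReal ?_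
          have e3 : 1 / 2 * (η * (avg 1 + avg (-1))) ≤ η * (x + C * √l) := by
            have := mul_le_mul_of_nonneg_left (add_le_add e1 e2) h0.le
            linarith
          have e4 : η * 2 ≤ η * (2 * √l) := by gcongr; linarith
          have e5 : 0 ≤ η * (D * S * √l) := by positivity
          have e6 : 0 ≤ η * ((C + 2) * (η * l)) := by positivity
          calc _ = η * 2 + 1 / 2 * (η * (avg 1 + avg (-1))) + η * (D * S * (η * l)) := by ring
            _ ≤ η * (2 * √l) + η * (x + C * √l) + η * (D * S * (η * l)) +
                η * (D * S * √l) + η * ((C + 2) * (η * l)) := by linarith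
            _ = _ := by ring

/-! ### Concentration of the cluster prior on the sparse sets -/

lemma clusterPriorOne_compl_zero_le (r : ℝ) {η : ℝ} (h0 : 0 < η) (h1 : η < 1) :
    clusterPriorOne r η {0}ᶜ ≤ ENNReal.ofReal η := by
  have e : clusterPriorOne r η = ENNReal.ofReal (1 - η) • Measure.dirac 0 + clusterTail r η := rfl
  rw [e, Measure.add_apply, Measure.smul_apply, Measure.dirac_apply]
  simp only [Set.mem_compl_iff, Set.mem_singleton_iff, not_true_eq_false, not_false_eq_true,
    Set.indicator_of_notMem, smul_eq_mul, mul_zero, zero_add]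
  exact (measure_mono (Set.subset_univ _)).trans_eq (clusterTail_univ r h0 h1)

/-- Chernoff's bound for the number of nonzero coordinates. -/
lemma clusterPrior_compl_sparseSet_le (r : ℝ) {η : ℝ} (h0 : 0 < η) (h1 : η < 1) {ε : ℝ}
    (hε : 0 < ε) (n : ℕ) {s : ℝ} (hs : n * η = s) :
    clusterPrior n r η (sparseSet n ((1 + ε) * s))ᶜ ≤
      ENNReal.ofReal (Real.exp (-(((1 + ε) * Real.log (1 + ε) - ε) * s))) := by
  have := isProbabilityMeasure_clusterPriorOne r h0 h1
  have hs0 : 0 ≤ s := by rw [← hs]; positivity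
  let g : ℝ → ℝ≥0∞ := fun t => if t ≠ 0 then ENNReal.ofReal (1 + ε) else 1
  have hg : Measurable g := Measurable.ite (measurableSet_singleton (0 : ℝ)).compl
    measurable_const measurable_const
  have hgint : ∫⁻ t, g t ∂clusterPriorOne r η ≤ ENNReal.ofReal (Real.exp (ε * η)) := by
    have e : g = fun t => 1 + ({0}ᶜ : Set ℝ).indicator (fun _ => ENNReal.ofReal ε) t := by
      funext t
      by_cases ht : t = 0
      · simp [g, ht]
      · simp [g, ht, ENNReal.ofReal_add zero_le_one hε.le]
    rw [e, lintegral_add_left measurable_const, lintegral_indicator_const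
      (measurableSet_singleton (0 : ℝ)).compl]
    simp only [lintegral_const, measure_univ, mul_one]
    calc 1 + ENNReal.ofReal ε * clusterPriorOne r η {0}ᶜ
        ≤ ENNReal.ofReal 1 + ENNReal.ofReal ε * ENNReal.ofReal η := by
          rw [ENNReal.ofReal_one]
          gcongr
          exact clusterPriorOne_compl_zero_le r h0 h1
      _ = ENNReal.ofReal (1 + ε * η) := by
          rw [← ENNReal.ofReal_mul hε.le, ← ENNReal.ofReal_add zero_le_one (by positivity)]
      _ ≤ _ := ENNReal.ofReal_le_ofReal (by linarith [Real.add_one_le_exp (ε * η)])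
  have hf : Measurable fun θ : Fin n → ℝ => ∏ i, g (θ i) :=
    Finset.measurable_prod _ fun i _ => hg.comp (measurable_pi_apply i)
  have hfint : ∫⁻ θ, ∏ i, g (θ i) ∂clusterPrior n r η ≤ ENNReal.ofReal (Real.exp (ε * s)) := by
    rw [clusterPrior, lintegral_fin_prod (fun _ => clusterPriorOne r η) (fun _ => g) fun _ => hg]
    calc ∏ _i : Fin n, ∫⁻ t, g t ∂clusterPriorOne r η
        ≤ ∏ _i : Fin n, ENNReal.ofReal (Real.exp (ε * η)) :=
          Finset.prod_le_prod' fun _ _ => hgint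
      _ = ENNReal.ofReal (Real.exp (ε * s)) := by
          rw [Finset.prod_const, Finset.card_univ, Fintype.card_fin,
            ← ENNReal.ofReal_pow (Real.exp_pos _).le, ← Real.exp_nat_mul, ← hs]
          congr 2; ring
  set a := ENNReal.ofReal (Real.exp (Real.log (1 + ε) * ((1 + ε) * s))) with ha
  have hsub : (sparseSet n ((1 + ε) * s))ᶜ ⊆ {θ | a ≤ ∏ i, g (θ i)} := by
    intro θ hθ
    have hc : (1 + ε) * s < ((Finset.univ.filter fun i => θ i ≠ 0).card : ℝ) := by
      have h2 : ¬ ((({i | θ i ≠ 0} : Set (Fin n)).ncard : ℝ) ≤ (1 + ε) * s) := hθ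
      rw [Set.ncard_eq_toFinset_card'] at h2
      simpa using h2
    have e : ∏ i, g (θ i) = ENNReal.ofReal (1 + ε) ^ (Finset.univ.filter fun i => θ i ≠ 0).card := by
      simp only [g]
      rw [Finset.prod_ite]
      simp
    change a ≤ ∏ i, g (θ i)
    rw [e, ha, ← ENNReal.ofReal_pow (by positivity)]
    refine ENNReal.ofReal_le_ofReal ?_
    rw [← Real.exp_log (by positivity : 0 < 1 + ε), ← Real.exp_nat_mul, Real.log_exp,
      Real.exp_log (by positivity)]
    refine Real.exp_le_exp.2 ?_
    rw [mul_comm]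
    exact mul_le_mul_of_nonneg_right hc.le (Real.log_nonneg (by linarith))
  have hmarkov := (mul_meas_ge_le_lintegral (μ := clusterPrior n r η) hf a).trans hfint
  have ha0 : a ≠ 0 := by rw [ha]; simpa using Real.exp_pos _
  refine (measure_mono hsub).trans ?_
  rw [mul_comm a, ← ENNReal.le_div_iff_mul_le (Or.inl ha0) (Or.inl ENNReal.ofReal_ne_top)] at hmarkov
  refine hmarkov.trans_eq ?_
  rw [ha, ← ENNReal.ofReal_div_of_pos (Real.exp_pos _), ← Real.exp_sub]
  congr 2
  ring

/-- The exponent `(1 + ε) log (1 + ε) - ε` in Chernoff's bound is positive. -/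
lemma chernoff_exponent_pos {ε : ℝ} (hε : 0 < ε) : 0 < (1 + ε) * Real.log (1 + ε) - ε := by
  have h1 : (0 : ℝ) < 1 + ε := by linarith
  have h2 := Real.log_lt_sub_one_of_pos (inv_pos.2 h1) (by
    intro h
    have := inv_eq_one.1 h
    linarith)
  rw [Real.log_inv] at h2
  have h3 : (1 + ε) * (1 - (1 + ε)⁻¹) = ε := by field_simp; ring
  nlinarith [mul_lt_mul_of_pos_left h2 h1]

lemma isProbabilityMeasure_clusterPrior (n : ℕ) (r : ℝ) {η : ℝ} (h0 : 0 < η) (h1 : η < 1) :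
    IsProbabilityMeasure (clusterPrior n r η) := by
  have := isProbabilityMeasure_clusterPriorOne r h0 h1
  rw [clusterPrior]
  infer_instance

/-- The sparsity rate `s n / n` approaches `0` from above. -/
lemma tendsto_sparsity {s : ℕ → ℕ} (h1 : ∀ᶠ n in atTop, 1 ≤ s n)
    (h0 : Tendsto (fun n : ℕ => (s n : ℝ) / n) atTop (𝓝 0)) :
    Tendsto (fun n : ℕ => (s n : ℝ) / n) atTop (𝓝[>] 0) := by
  refine tendsto_nhdsWithin_iff.2 ⟨h0, ?_⟩
  filter_upwards [h1, eventually_gt_atTop 0] with n hn hn0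
  have : (0 : ℝ) < s n := by exact_mod_cast hn
  have : (0 : ℝ) < n := by exact_mod_cast hn0
  change (0 : ℝ) < _
  positivity

lemma tendsto_clusterPrior_sparseSet (r : ℝ) {s : ℕ → ℕ} (h1 : ∀ᶠ n in atTop, 1 ≤ s n)
    (h0 : Tendsto (fun n : ℕ => (s n : ℝ) / n) atTop (𝓝 0)) (hs : Tendsto s atTop atTop)
    {ε : ℝ} (hε : 0 < ε) :
    Tendsto (fun n => clusterPrior n r (s n / n) (sparseSet n ((1 + ε) * s n))) atTop (𝓝 1) := by
  set c := (1 + ε) * Real.log (1 + ε) - ε with hc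
  have hcpos : 0 < c := chernoff_exponent_pos hε
  have hη : ∀ᶠ n : ℕ in atTop, 0 < n ∧ 0 < (s n : ℝ) / n ∧ (s n : ℝ) / n < 1 := by
    filter_upwards [eventually_gt_atTop 0, tendsto_sparsity h1 h0 self_mem_nhdsWithin,
      h0.eventually (gt_mem_nhds one_pos)] with n hn hp hl
    exact ⟨hn, hp, hl⟩
  have hexp : Tendsto (fun n => ENNReal.ofReal (Real.exp (-(c * s n)))) atTop (𝓝 0) := by
    rw [← ENNReal.ofReal_zero]
    refine ENNReal.tendsto_ofReal (Real.tendsto_exp_neg_atTop_nhds_zero.comp ?_)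
    exact (tendsto_natCast_atTop_atTop.comp hs).const_mul_atTop hcpos
  have hlow : Tendsto (fun n => 1 - ENNReal.ofReal (Real.exp (-(c * s n)))) atTop (𝓝 1) := by
    have := ENNReal.Tendsto.sub (tendsto_const_nhds (x := (1 : ℝ≥0∞)) (f := atTop (α := ℕ))) hexp
      (Or.inl ENNReal.one_ne_top)
    simpa using this
  refine tendsto_of_tendsto_of_tendsto_of_le_of_le' hlow tendsto_const_nhds ?_ ?_
  · filter_upwards [hη] with n ⟨hn, hp, hl⟩
    have := isProbabilityMeasure_clusterPrior n r hp hl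
    have hn' : (n : ℝ) ≠ 0 := by exact_mod_cast hn.ne'
    have hb := clusterPrior_compl_sparseSet_le r hp hl hε n (mul_div_cancel₀ (s n : ℝ) hn')
    rw [tsub_le_iff_right]
    calc (1 : ℝ≥0∞) = clusterPrior n r (s n / n)
          (sparseSet n ((1 + ε) * s n) ∪ (sparseSet n ((1 + ε) * s n))ᶜ) := by
          rw [Set.union_compl_self, measure_univ]
      _ ≤ _ := (measure_union_le _ _).trans (by gcongr)
  · filter_upwards [hη] with n ⟨_, hp, hl⟩
    have := isProbabilityMeasure_clusterPrior n r hp hl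
    exact prob_le_one

/-! ### Asymptotics of the Bayes risk and of the minimax risk -/

lemma ofReal_le_div_ofReal {d x : ℝ} (hd : 0 < d) {a : ℝ≥0∞} (h : ENNReal.ofReal (d * x) ≤ a) :
    ENNReal.ofReal x ≤ a / ENNReal.ofReal d := by
  rw [ENNReal.le_div_iff_mul_le (Or.inl (by simpa using hd)) (Or.inl ENNReal.ofReal_ne_top),
    ← ENNReal.ofReal_mul' hd.le, mul_comm]
  exact h

lemma div_ofReal_le_ofReal {d x : ℝ} (hd : 0 < d) {a : ℝ≥0∞} (h : a ≤ ENNReal.ofReal (d * x)) :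
    a / ENNReal.ofReal d ≤ ENNReal.ofReal x := by
  rw [ENNReal.div_le_iff_le_mul (Or.inl (by simpa using hd)) (Or.inl ENNReal.ofReal_ne_top),
    ← ENNReal.ofReal_mul' hd.le, mul_comm]
  exact h

lemma tendsto_inv_sqrt_log_inv :
    Tendsto (fun η : ℝ => (√(Real.log η⁻¹))⁻¹) (𝓝[>] 0) (𝓝 0) :=
  tendsto_inv_atTop_zero.comp (Real.tendsto_sqrt_atTop.comp tendsto_log_inv)

/-- The first order `s (1 - v) log (1/η)`, `v = oracleVar r`, of the minimax risk. -/
lemma sparsity_mul_sq_lamF {r : ℝ} (hr : 0 < r) {η : ℝ} (h0 : 0 < η) (h1 : η < 1) (s : ℝ) :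
    s * (lamF r η ^ 2 / (2 * r)) = s * ((1 - oracleVar r) * Real.log η⁻¹) := by
  rw [sq_lamF hr h0 h1, ← oracleVar_div hr]
  field_simp

variable {r : ℝ} {s : ℕ → ℕ}

lemma tendsto_predBayesRisk_div (hr : 0 < r) (h1 : ∀ᶠ n in atTop, 1 ≤ s n)
    (h0 : Tendsto (fun n : ℕ => (s n : ℝ) / n) atTop (𝓝 0)) :
    Tendsto (fun n : ℕ => predBayesRisk r (clusterPrior n r (s n / n)) /
        ENNReal.ofReal (n * (s n / n) * (lamF r (s n / n) ^ 2 / (2 * r))))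
      atTop (𝓝 (ENNReal.ofReal (bayesConst r))) := by
  obtain ⟨C, hC, hb⟩ := lintegral_clusterRisk_bounds hr
  have hη := tendsto_sparsity h1 h0
  have hm : 0 < 1 - oracleVar r := by linarith [oracleVar_lt_one hr]
  set m := 1 - oracleVar r with hmdef
  have hid : Tendsto (fun η : ℝ => η) (𝓝[>] 0) (𝓝 0) := tendsto_nhdsWithin_of_tendsto_nhds tendsto_id
  have hlow : Tendsto (fun η : ℝ => ENNReal.ofReal
      ((1 - η) * (bayesConst r - C / m * (√(Real.log η⁻¹))⁻¹))) (𝓝[>] 0)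
      (𝓝 (ENNReal.ofReal (bayesConst r))) := by
    refine ENNReal.tendsto_ofReal ?_
    have := (hid.const_sub 1).mul
      ((tendsto_inv_sqrt_log_inv.const_mul (C / m)).const_sub (bayesConst r))
    simpa using this
  have hupp : Tendsto (fun η : ℝ => ENNReal.ofReal
      (bayesConst r + C / m * ((√(Real.log η⁻¹))⁻¹ + η))) (𝓝[>] 0)
      (𝓝 (ENNReal.ofReal (bayesConst r))) := by
    refine ENNReal.tendsto_ofReal ?_
    have := ((tendsto_inv_sqrt_log_inv.add hid).const_mul (C / m)).const_add (bayesConst r)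
    simpa using this
  have hev : ∀ᶠ n : ℕ in atTop, 0 < n ∧ 0 < (s n : ℝ) / n ∧ (s n : ℝ) / n < 1 ∧
      1 ≤ Real.log ((s n : ℝ) / n)⁻¹ := by
    filter_upwards [eventually_gt_atTop 0, hη self_mem_nhdsWithin,
      h0.eventually (gt_mem_nhds one_pos),
      (tendsto_log_inv.comp hη).eventually (eventually_ge_atTop 1)] with n hn hp hl hL
    exact ⟨hn, hp, hl, hL⟩
  refine tendsto_of_tendsto_of_tendsto_of_le_of_le' (hlow.comp hη) (hupp.comp hη) ?_ ?_
  all_goals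
    filter_upwards [hev] with n ⟨hn, hp, hl, hL⟩
    have hn' : (0 : ℝ) < n := by exact_mod_cast hn
    simp only [Function.comp_apply]
    generalize (s n : ℝ) / n = η at *
    obtain ⟨hb1, hb2⟩ := hb η hp hL
    rw [sparsity_mul_sq_lamF hr hp hl, predBayesRisk_clusterPrior hr hp hl]
    have hsq : 0 < √(Real.log η⁻¹) := Real.sqrt_pos.2 (by linarith)
    have hss : Real.log η⁻¹ = √(Real.log η⁻¹) * √(Real.log η⁻¹) :=
      (Real.mul_self_sqrt (by linarith)).symm
    have hnn : (n : ℝ≥0∞) = ENNReal.ofReal n := (ENNReal.ofReal_natCast n).symm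
    have hd : 0 < n * η * (m * Real.log η⁻¹) := by positivity
  · refine ofReal_le_div_ofReal hd ?_
    rw [hnn]
    refine le_trans (le_of_eq ?_) (mul_le_mul_right hb1 _)
    rw [← ENNReal.ofReal_mul hn'.le]
    congr 1
    generalize √(Real.log η⁻¹) = q at *
    rw [hss]
    field_simp
  · refine div_ofReal_le_ofReal hd ?_
    rw [hnn]
    refine (mul_le_mul_right hb2 _).trans (le_of_eq ?_)
    rw [← ENNReal.ofReal_mul hn'.le]
    congr 1
    generalize √(Real.log η⁻¹) = q at *
    rw [hss]
    field_simp

lemma tendsto_predMinimaxRisk_div (hr : 0 < r) (h1 : ∀ᶠ n in atTop, 1 ≤ s n)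
    (h0 : Tendsto (fun n : ℕ => (s n : ℝ) / n) atTop (𝓝 0)) :
    Tendsto (fun n : ℕ => predMinimaxRisk r (sparseSet n (s n)) /
        ENNReal.ofReal (n * (s n / n) * (lamF r (s n / n) ^ 2 / (2 * r))))
      atTop (𝓝 1) := by
  obtain ⟨C, hC, hb⟩ := predMinimaxRisk_bounds hr
  have hη := tendsto_sparsity h1 h0
  have hm : 0 < 1 - oracleVar r := by linarith [oracleVar_lt_one hr]
  set m := 1 - oracleVar r with hmdef
  have hlow : Tendsto (fun η : ℝ => ENNReal.ofReal (1 - C / m * (√(Real.log η⁻¹))⁻¹)) (𝓝[>] 0)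
      (𝓝 1) := by
    rw [← ENNReal.ofReal_one]
    refine ENNReal.tendsto_ofReal ?_
    simpa using (tendsto_inv_sqrt_log_inv.const_mul (C / m)).const_sub 1
  have hupp : Tendsto (fun η : ℝ => ENNReal.ofReal (1 + C / m * (√(Real.log η⁻¹))⁻¹)) (𝓝[>] 0)
      (𝓝 1) := by
    rw [← ENNReal.ofReal_one]
    refine ENNReal.tendsto_ofReal ?_
    simpa using (tendsto_inv_sqrt_log_inv.const_mul (C / m)).const_add 1
  have hev : ∀ᶠ n : ℕ in atTop, 0 < n ∧ 1 ≤ s n ∧ 0 < (s n : ℝ) / n ∧ (s n : ℝ) / n < 1 ∧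
      1 ≤ Real.log ((s n : ℝ) / n)⁻¹ := by
    filter_upwards [eventually_gt_atTop 0, h1, hη self_mem_nhdsWithin,
      h0.eventually (gt_mem_nhds one_pos),
      (tendsto_log_inv.comp hη).eventually (eventually_ge_atTop 1)] with n hn hs hp hl hL
    exact ⟨hn, hs, hp, hl, hL⟩
  refine tendsto_of_tendsto_of_tendsto_of_le_of_le' (hlow.comp hη) (hupp.comp hη) ?_ ?_
  all_goals
    filter_upwards [hev] with n ⟨hn, hs, hp, hl, hL⟩
    have hn' : (n : ℝ) ≠ 0 := by exact_mod_cast hn.ne'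
    have hs' : (0 : ℝ) < s n := by exact_mod_cast hs
    simp only [Function.comp_apply]
    obtain ⟨hb1, hb2⟩ := hb n (s n) hs hL
    rw [sparsity_mul_sq_lamF hr hp hl, mul_div_cancel₀ (s n : ℝ) hn']
    generalize Real.log ((s n : ℝ) / n)⁻¹ = l at *
    have hsq : 0 < √l := Real.sqrt_pos.2 (by linarith)
    have hss : l = √l * √l := (Real.mul_self_sqrt (by linarith)).symm
    have hd : 0 < (s n : ℝ) * (m * l) := by positivity
  · refine ofReal_le_div_ofReal hd (le_trans (le_of_eq ?_) hb1)
    congr 1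
    generalize √l = q at *
    rw [hss]
    field_simp
  · refine div_ofReal_le_ofReal hd (hb2.trans (le_of_eq ?_))
    congr 1
    generalize √l = q at *
    rw [hss]
    field_simp

lemma eventually_scale_pos (hr : 0 < r) (h1 : ∀ᶠ n in atTop, 1 ≤ s n)
    (h0 : Tendsto (fun n : ℕ => (s n : ℝ) / n) atTop (𝓝 0)) :
    ∀ᶠ n : ℕ in atTop,
      0 < (n : ℝ) * (s n / n) * (lamF r (s n / n) ^ 2 / (2 * r)) := by
  have hη := tendsto_sparsity h1 h0
  have hm : 0 < 1 - oracleVar r := by linarith [oracleVar_lt_one hr]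
  filter_upwards [eventually_gt_atTop 0, hη self_mem_nhdsWithin,
    h0.eventually (gt_mem_nhds one_pos),
    (tendsto_log_inv.comp hη).eventually (eventually_ge_atTop 1)] with n hn hp hl hL
  have hn' : (0 : ℝ) < n := by exact_mod_cast hn
  have hp' : (0 : ℝ) < (s n : ℝ) / n := hp
  have hL' : 0 < Real.log ((s n : ℝ) / n)⁻¹ := lt_of_lt_of_le one_pos hL
  rw [sparsity_mul_sq_lamF hr hp hl]
  exact mul_pos (mul_pos hn' hp') (mul_pos hm hL')

lemma tendsto_predBayesRisk_div_predMinimaxRisk (hr : 0 < r) (h1 : ∀ᶠ n in atTop, 1 ≤ s n)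
    (h0 : Tendsto (fun n : ℕ => (s n : ℝ) / n) atTop (𝓝 0)) :
    Tendsto (fun n : ℕ => predBayesRisk r (clusterPrior n r (s n / n)) /
        predMinimaxRisk r (sparseSet n (s n)))
      atTop (𝓝 (ENNReal.ofReal (bayesConst r))) := by
  have h := ENNReal.Tendsto.div (tendsto_predBayesRisk_div hr h1 h0) (Or.inr one_ne_zero)
    (tendsto_predMinimaxRisk_div hr h1 h0) (Or.inl ENNReal.one_ne_top)
  rw [div_one] at h
  refine h.congr' ?_
  filter_upwards [eventually_scale_pos hr h1 h0] with n hd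
  simp only [div_eq_mul_inv _ (ENNReal.ofReal _)]
  exact ENNReal.mul_div_mul_right _ _ (by simp)
    (ENNReal.inv_ne_top.2 (by simpa using hd))

/-! ### The value of the limit -/

lemma clusterSize_eq_one (hr : 1 / 2 < r) : clusterSize r = 1 := by
  have h : ¬ r < 1 / 2 := by linarith
  rw [clusterSize, if_neg h]

lemma bayesConst_eq_one (hr : 1 / 2 < r) : bayesConst r = 1 := by
  have h0 : 0 < r := by linarith
  rw [bayesConst, clusterSize_eq_one hr]
  simp [decayFactor_one h0, h0.ne']

lemma bayesConst_lt_one (hr : 0 < r) (h : 1 < clusterSize r) : bayesConst r < 1 := by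
  have hK : (0 : ℝ) < clusterSize r := by exact_mod_cast (by omega : 0 < clusterSize r)
  have hle : ∀ k ∈ Finset.Icc 1 (clusterSize r), r * decayFactor r k ≤ 1 := by
    intro k hk
    have hk' := Finset.mem_Icc.1 hk
    have := (strictAntiOn_decayFactor hr).antitoneOn
      (Set.mem_Icc.2 ⟨le_rfl, h.le⟩) (Set.mem_Icc.2 hk') hk'.1
    rw [decayFactor_one hr] at this
    calc r * decayFactor r k ≤ r * r⁻¹ := by gcongr
      _ = 1 := mul_inv_cancel₀ hr.ne'
  have hlt := Finset.sum_lt_sum hle ⟨clusterSize r, Finset.mem_Icc.2 ⟨h.le, le_rfl⟩, by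
    rw [decayFactor_clusterSize hr h]; simp⟩
  rw [bayesConst, inv_mul_lt_iff₀ hK]
  simpa using hlt

lemma eventually_predBayesRisk_lt (hr : 0 < r) (h : bayesConst r < 1)
    (h1 : ∀ᶠ n in atTop, 1 ≤ s n)
    (h0 : Tendsto (fun n : ℕ => (s n : ℝ) / n) atTop (𝓝 0)) :
    ∀ᶠ n in atTop, predBayesRisk r (clusterPrior n r (s n / n)) <
      predMinimaxRisk r (sparseSet n (s n)) := by
  have hlt : ENNReal.ofReal (bayesConst r) < 1 := by simpa using h
  filter_upwards [(tendsto_predBayesRisk_div hr h1 h0).eventually_lt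
    (tendsto_predMinimaxRisk_div hr h1 h0) hlt] with n hn
  by_contra! hcon
  exact absurd hn (not_lt.2 (ENNReal.div_le_div_right hcon _))

lemma asymptoticallyLeastFavorable_clusterPrior (hr : 1 / 2 < r) (h1 : ∀ᶠ n in atTop, 1 ≤ s n)
    (h0 : Tendsto (fun n : ℕ => (s n : ℝ) / n) atTop (𝓝 0)) (hs : Tendsto s atTop atTop) :
    AsymptoticallyLeastFavorable r s fun n => clusterPrior n r (s n / n) := by
  refine ⟨?_, fun ε hε => tendsto_clusterPrior_sparseSet r h1 h0 hs hε, ?_⟩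
  · filter_upwards [tendsto_sparsity h1 h0 self_mem_nhdsWithin,
      h0.eventually (gt_mem_nhds one_pos)] with n hp hl
    exact isProbabilityMeasure_clusterPrior n r hp hl
  · have := tendsto_predBayesRisk_div_predMinimaxRisk (by linarith : 0 < r) h1 h0
    rwa [bayesConst_eq_one hr, ENNReal.ofReal_one] at this

end SparsePrediction

theorem theorem2 (r : ℝ) (hr : 0 < r) :
    -- the risk at the atoms of the first cluster, to first order as `η → 0`
    (∀ k ∈ Set.Icc 1 (clusterSize r),
      (∀ᶠ η in 𝓝[>] (0 : ℝ), firstClusterRisk r η k ≠ ∞) ∧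
      (fun η : ℝ => (firstClusterRisk r η k).toReal - lamF r η ^ 2 / 2 * decayFactor r k)
        =O[𝓝[>] 0] fun η => lamF r η) ∧
    -- it is `λ_f² / (2r)` at `μ₁₁ = λ_f`, strictly decreases along the cluster, stays of the exact
    -- order `λ_f²` before the last atom, and is negligible at the last atom when `K ≥ 2`
    (∀ η ∈ Set.Ioo (0 : ℝ) 1, atom r η 1 1 = lamF r η) ∧
    ((fun η : ℝ => (firstClusterRisk r η 1).toReal) ~[𝓝[>] 0]
      fun η => lamF r η ^ 2 / (2 * r)) ∧
    (∀ᶠ η in 𝓝[>] (0 : ℝ),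
      StrictAntiOn (fun k => firstClusterRisk r η k) (Set.Icc 1 (clusterSize r))) ∧
    StrictAntiOn (decayFactor r) (Set.Icc 1 (clusterSize r)) ∧
    (∀ k ∈ Set.Ico 1 (clusterSize r), 0 < decayFactor r k) ∧
    (2 ≤ clusterSize r → decayFactor r (clusterSize r) = 0 ∧
      (fun η : ℝ => (firstClusterRisk r η (clusterSize r)).toReal)
        =o[𝓝[>] 0] fun η => lamF r η ^ 2) ∧
    -- the Bayes risk of the multivariate cluster prior, with `η = s n / n`
    (∀ s : ℕ → ℕ, (∀ᶠ n in atTop, 1 ≤ s n) →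
      Tendsto (fun n : ℕ => (s n : ℝ) / n) atTop (𝓝 0) →
      Tendsto (fun n : ℕ => predBayesRisk r (clusterPrior n r (s n / n)) /
          ENNReal.ofReal (n * (s n / n) * (lamF r (s n / n) ^ 2 / (2 * r))))
        atTop (𝓝 (ENNReal.ofReal (bayesConst r))) ∧
      Tendsto (fun n : ℕ => predBayesRisk r (clusterPrior n r (s n / n)) /
          predMinimaxRisk r (sparseSet n (s n)))
        atTop (𝓝 (ENNReal.ofReal (bayesConst r))) ∧
      (1 / 2 < r → Tendsto s atTop atTop →
        clusterSize r = 1 ∧ bayesConst r = 1 ∧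
        AsymptoticallyLeastFavorable r s fun n => clusterPrior n r (s n / n)) ∧
      (r < 1 / 2 → 2 ≤ clusterSize r ∧ bayesConst r < 1 ∧
        ∀ᶠ n in atTop, predBayesRisk r (clusterPrior n r (s n / n)) <
          predMinimaxRisk r (sparseSet n (s n)))) := by
  refine ⟨fun k hk => ⟨firstClusterRisk_ne_top hr k, firstClusterRisk_isBigO hr hk⟩, ?_, firstClusterRisk_isEquivalent hr,
    strictAntiOn_firstClusterRisk hr, strictAntiOn_decayFactor hr,
    fun k hk => decayFactor_pos hr hk,
    fun h => ⟨decayFactor_clusterSize hr h, firstClusterRisk_last_isLittleO hr h⟩, ?_⟩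
  · rintro η ⟨h0, h1⟩
    rw [atom_one, firstAtom, Nat.sub_self, pow_zero, mul_one, min_eq_left (lamF_le_lamE hr h0 h1)]
  intro s h1 h0
  refine ⟨tendsto_predBayesRisk_div hr h1 h0, tendsto_predBayesRisk_div_predMinimaxRisk hr h1 h0,
    fun h hs => ⟨clusterSize_eq_one h, bayesConst_eq_one h,
      asymptoticallyLeastFavorable_clusterPrior h h1 h0 hs⟩, fun h => ?_⟩
  have hK := (one_lt_clusterSize_iff hr).2 h
  exact ⟨hK, bayesConst_lt_one hr hK, eventually_predBayesRisk_lt hr (bayesConst_lt_one hr hK) h1 h0⟩
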